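/- Let $n\ge 1$ and let $A_n=\{xz=y^{n+1}\}\subset\mathbb{C}^3$, a normal complex surface whose only singular point is the origin $0$. For an integral scheme $X$ of finite type over $\mathbb{C}$, let $\mathcal{D}_X=\mathcal{D}er_{\mathbb{C}}(\mathcal{O}_X)$ be its sheaf of derivations and $r$ its rank. The blow-up of $X$ at $\mathcal{D}_X$ is the integral scheme $f\colon \mathrm{Bl}_{\mathrm{Der}}(X)\to X$ such that $f^*\mathcal{D}_X/\mathrm{tor}$ is locally free of rank $r$ and which is universal with this property: every morphism $\sigma\colon Z\to X$ from an integral scheme $Z$ such that $\sigma^*\mathcal{D}_X/\mathrm{tor}$ is locally free of rank $r$ factors uniquely through $f$. Put $X_0=A_n$ and $X_{k+1}=\mathrm{Bl}_{\mathrm{Der}}(X_k)$ for $k\ge 0$, and let $N=n/2$ if $n$ is even and $N=(n+1)/2$ if $n$ is odd. Then all the iterated blow-ups $X_k$ exist; $X_k$ is singular for every $k<N$; and the composition $X_N\to A_n$ is a resolution of $(A_n,0)$, i.e. $X_N$ is integral and smooth over $\mathbb{C}$, and the morphism is proper and restricts to an isomorphism over $A_n\setminus\{0\}$. Moreover it is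 the minimal resolution: every resolution of $(A_n,0)$ factors uniquely through $X_N\to A_n$. -/

import Mathlib

open CategoryTheory AlgebraicGeometry
open scoped TensorProduct

noncomputable section

namespace DerBlowup

/-! ### The surface `A_n` -/

/-- The coordinate ring `ℂ[x, y, z] / (x z - y ^ (n + 1))` of the surface `A_n`
(the variables `x, y, z` are `X 0, X 1, X 2`). -/
abbrev AnRing (n : ℕ) : Type :=
  MvPolynomial (Fin 3) ℂ ⧸
    Ideal.span {(MvPolynomial.X 0 * MvPolynomial.X 2 - MvPolynomial.X 1 ^ (n + 1) :
      MvPolynomial (Fin 3) ℂ)}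

/-- The surface `A_n = V(x z - y ^ (n + 1)) ⊂ ℂ³`, as a scheme. -/
abbrev An (n : ℕ) : Scheme.{0} := Spec (CommRingCat.of (AnRing n))

/-- The structure morphism of `A_n` over `ℂ`. -/
abbrev AnStr (n : ℕ) : An n ⟶ Spec (CommRingCat.of ℂ) :=
  Spec.map (CommRingCat.ofHom (algebraMap ℂ (AnRing n)))

/-- Evaluation of functions on `A_n` at the origin. -/
def evalOrigin (n : ℕ) : AnRing n →ₐ[ℂ] ℂ :=
  Ideal.Quotient.liftₐ _ (MvPolynomial.aeval (fun _ => (0 : ℂ))) (by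
    intro a ha
    have h : Ideal.span {(MvPolynomial.X 0 * MvPolynomial.X 2 - MvPolynomial.X 1 ^ (n + 1) :
        MvPolynomial (Fin 3) ℂ)} ≤
        RingHom.ker (MvPolynomial.aeval (R := ℂ) (fun _ : Fin 3 => (0 : ℂ))) := by
      rw [Ideal.span_le, Set.singleton_subset_iff, SetLike.mem_coe, RingHom.mem_ker]
      simp
    exact h ha)

/-- The origin `0` of `A_n`: the closed point given by the maximal ideal of the functions
vanishing at `(0, 0, 0)`. -/
def origin (n : ℕ) : An n :=
  (⟨RingHom.ker (evalOrigin n), RingHom.ker_isPrime _⟩ : PrimeSpectrum (AnRing n))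

/-! ### Blow-up at the sheaf of derivations -/

section Algebra

variable (R A : Type) [CommRing R] [Algebra ℂ R] [CommRing A] [Algebra R A]

/-- For `Spec A → Spec R`, the pullback to `A` of the `R`-module `Der_ℂ(R)`, modulo torsion. -/
abbrev DerPullbackModTorsion : Type :=
  (A ⊗[R] Derivation ℂ R R) ⧸ Submodule.torsion A (A ⊗[R] Derivation ℂ R R)

/-- The pullback of `Der_ℂ(R)` to `A`, modulo torsion, is a free `A`-module, of rank equal to the
rank of the `R`-module `Der_ℂ(R)` (for a domain `R`, `Module.finrank` is the dimension after
extension to the fraction field). -/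
def DerPullbackFree : Prop :=
  Nonempty ((Fin (Module.finrank R (Derivation ℂ R R)) → A) ≃ₗ[A] DerPullbackModTorsion R A)

end Algebra

/-- The `ℂ`-algebra structure on the functions on an open subset of a scheme over `ℂ`. -/
def strHom {X : Scheme.{0}} (s : X ⟶ Spec (CommRingCat.of ℂ)) (U : X.Opens) : ℂ →+* Γ(X, U) :=
  ((Scheme.ΓSpecIso (CommRingCat.of ℂ)).inv ≫ s.appLE ⊤ U le_top).hom

/-- Let `s : X ⟶ Spec ℂ` be an integral scheme of finite type and `D` its sheaf of derivations,
i.e. the coherent sheaf whose sections on an affine open `U` are the `ℂ`-derivations of `Γ(X, U)`.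
For `σ : Z ⟶ X` with `Z` integral, this says that `σ^* D / tor` is locally free of rank equal to
the rank of `D`. -/
def DerPullbackLocallyFree {X Z : Scheme.{0}} (s : X ⟶ Spec (CommRingCat.of ℂ)) (σ : Z ⟶ X) :
    Prop :=
  ∀ z : Z, ∃ (U : X.Opens) (V : Z.Opens) (e : V ≤ σ ⁻¹ᵁ U),
    IsAffineOpen U ∧ IsAffineOpen V ∧ z ∈ V ∧
      letI : Algebra ℂ Γ(X, U) := (strHom s U).toAlgebra
      letI : Algebra Γ(X, U) Γ(Z, V) := (σ.appLE U V e).hom.toAlgebra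
      DerPullbackFree Γ(X, U) Γ(Z, V)

/-- `f : Y ⟶ X` is the blow-up of the integral scheme `s : X ⟶ Spec ℂ` (of finite type) at its
sheaf of derivations: the universal morphism from an integral scheme such that the pullback of the
sheaf of derivations modulo torsion is locally free of the same rank. As `Y` is itself integral,
this determines `f` up to a unique isomorphism over `X`. -/
structure IsDerBlowup {X Y : Scheme.{0}} (s : X ⟶ Spec (CommRingCat.of ℂ)) (f : Y ⟶ X) :
    Prop where
  integral : IsIntegral Y
  locallyFree : DerPullbackLocallyFree s f
  universal : ∀ (Z : Scheme.{0}) (σ : Z ⟶ X), IsIntegral Z → DerPullbackLocallyFree s σ →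
    ∃! β : Z ⟶ Y, β ≫ f = σ

/-- `π : Y ⟶ X` is the composition of a sequence of `k` blow-ups
`Y = X_k ⟶ X_{k-1} ⟶ ⋯ ⟶ X_0 = X`, each at the sheaf of derivations of its target. -/
def IsIteratedDerBlowup {X : Scheme.{0}} (s : X ⟶ Spec (CommRingCat.of ℂ)) :
    ℕ → ∀ {Y : Scheme.{0}}, (Y ⟶ X) → Prop
  | 0, _, π => IsIso π
  | k + 1, Y', π' => ∃ (Y : Scheme.{0}) (π : Y ⟶ X) (f : Y' ⟶ Y),
      IsIteratedDerBlowup s k π ∧ IsDerBlowup (π ≫ s) f ∧ π' = f ≫ π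

/-! ### Resolutions -/

/-- `π : Y ⟶ X` is a resolution of the singularity `(X, x)`, where `x` is a closed point: `Y` is
integral and smooth over `ℂ`, `π` is proper, and `π` is an isomorphism over every open subset not
containing `x` (that is, over `X ∖ {x}`). -/
structure IsResolution {X Y : Scheme.{0}} (s : X ⟶ Spec (CommRingCat.of ℂ)) (x : X)
    (π : Y ⟶ X) : Prop where
  integral : IsIntegral Y
  smooth : Smooth (π ≫ s)
  proper : IsProper π
  isIso_away : ∀ U : X.Opens, x ∉ U → IsIso (π ∣_ U)

/-- The minimal resolution of `(X, x)`: the resolution through which every resolution of `(X, x)`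
factors uniquely. -/
structure IsMinimalResolution {X Y : Scheme.{0}} (s : X ⟶ Spec (CommRingCat.of ℂ)) (x : X)
    (π : Y ⟶ X) : Prop extends IsResolution s x π where
  minimal : ∀ (Y' : Scheme.{0}) (π' : Y' ⟶ X), IsResolution s x π' →
    ∃! h : Y' ⟶ Y, h ≫ π = π'

/-- The number of blow-ups needed for `A_n`. -/
def numSteps (n : ℕ) : ℕ := if Even n then n / 2 else (n + 1) / 2

end DerBlowup

end

/-! Write `x = u^(m+1)`, `y = uv`, `z = v^(m+1)`. The derivations of `A_m` are generated by `E =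
u∂_u`, `E' = v∂_v`, `P = v^m ∂_u`, `P' = u^m ∂_v` (`span_anDer`), with `yP = zE`, `xP = y^m E`, `yP'
= xE'`, `zP' = y^m E'`. Let `m ≥ 1`. For a map from a local domain to `A_m`, not landing in the
origin, these relations show that the pullback modulo torsion is free of rank 2 exactly when each of
the ideals `(x, y)` and `(z, y)` is generated by one of its two generators
(`derPullbackFree_of_dvd`, `dvd_of_derPullbackFree`). A map into the origin never qualifies, because
there the pullback still needs three generators (`not_derPullbackFree_of_eq_zero`). Hence blowing up
the derivations means blowing up `(x, y)` and `(z, y)`.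

The blow-up of `A_{k+1}` at `(x, y)` is explicit. Where `x` generates it is the plane `A_0`; where
`y` generates it is `A_k`. On the plane `(z, y)` is already principal, and on `A_k` it is the ideal
`(z, y)` of that chart, so the second blow-up is the first one with `x` and `z` exchanged. The two
together turn `A_m` into `A_{m-2}`; for `m = 1` the first blow-up principalizes both ideals and
leaves `A_0` (`IsAnChart.exists_nashModification`). Everything else on the blown-up surface is
smooth, so the `k`-th surface has one chart `A_{n-2k}` (truncated subtraction) around its only
possibly singular point, and `A_m` is singular for `m ≥ 1`.

For minimality, a resolution is lifted through one blow-up after another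
(`IsPartialResolution.comp`), and the universal property reduces this to showing that a smooth
surface birational to `A_m` principalizes `(x, y)`; the swap of `x` and `z` handles `(z, y)`. This
is `dvd_or_dvd_of_localCoord`, a discrepancy argument. Let `O` be the local ring at a closed point,
with coordinates `s, t`, and suppose that neither of `x, y` divides the other. Since `O` is
factorial, the residue of `w = x/y` is transcendental, so the curve `y = 0` of the `(w, y)`-plane is
contracted to the closed point of `O`. The form `dx∧dy/x` is regular on `O`, because each prime
factor of `x` divides `xz = y^(m+1)`. In the coordinates `(w, y)` it is `dw∧dy/w`, which has no zero
along `y = 0`. But `s` and `t` vanish along that curve, hence so does `ds∧dt`: a contradiction. In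
other words, the form has discrepancy zero along this curve, while every exceptional curve over a
smooth point has positive discrepancy. -/

open CategoryTheory AlgebraicGeometry
open scoped TensorProduct

noncomputable section

namespace DerBlowup

/-! ### The coordinate ring of `A_n` -/

section AnRing

open MvPolynomial

/-- The equation of `A_n`. -/
abbrev anEq (n : ℕ) : MvPolynomial (Fin 3) ℂ := X 0 * X 2 - X 1 ^ (n + 1)

/-- The coordinate ring of `A_n`, as an opaque type. -/
def AnR (n : ℕ) : Type := AnRing n

instance (n : ℕ) : CommRing (AnR n) := inferInstanceAs (CommRing (AnRing n))
instance (n : ℕ) : Algebra ℂ (AnR n) := inferInstanceAs (Algebra ℂ (AnRing n))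

/-- The quotient map onto the coordinate ring of `A_n`. -/
def anMk (n : ℕ) : MvPolynomial (Fin 3) ℂ →ₐ[ℂ] AnR n :=
  Ideal.Quotient.mkₐ ℂ (Ideal.span {anEq n})

lemma anMk_surjective (n : ℕ) : Function.Surjective (anMk n) :=
  Ideal.Quotient.mkₐ_surjective ℂ (Ideal.span {anEq n})

lemma anMk_eq_zero_iff {n : ℕ} {f : MvPolynomial (Fin 3) ℂ} : anMk n f = 0 ↔ anEq n ∣ f :=
  Ideal.Quotient.eq_zero_iff_mem.trans Ideal.mem_span_singleton

/-- The value of a function at the origin of `A_n`. -/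
def evalO (n : ℕ) : AnR n →ₐ[ℂ] ℂ := evalOrigin n

lemma evalO_anMk (n : ℕ) (f : MvPolynomial (Fin 3) ℂ) :
    evalO n (anMk n f) = aeval (R := ℂ) (fun _ : Fin 3 ↦ (0 : ℂ)) f := rfl

/-- The coordinate function `x` on `A_n`. -/
def cx (n : ℕ) : AnR n := anMk n (X 0)

/-- The coordinate function `y` on `A_n`. -/
def cy (n : ℕ) : AnR n := anMk n (X 1)

/-- The coordinate function `z` on `A_n`. -/
def cz (n : ℕ) : AnR n := anMk n (X 2)

lemma cx_mul_cz (n : ℕ) : cx n * cz n = cy n ^ (n + 1) := by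
  have : anMk n (anEq n) = 0 := anMk_eq_zero_iff.mpr dvd_rfl
  rw [map_sub, map_mul, map_pow, sub_eq_zero] at this
  exact this

lemma anRing_induction {n : ℕ} {p : AnR n → Prop} (hC : ∀ a : ℂ, p (algebraMap ℂ _ a))
    (hadd : ∀ a b, p a → p b → p (a + b)) (hmul : ∀ a b, p a → p b → p (a * b))
    (hx : p (cx n)) (hy : p (cy n)) (hz : p (cz n)) (f : AnR n) : p f := by
  obtain ⟨f, rfl⟩ := anMk_surjective n f
  induction f using MvPolynomial.induction_on with
  | C a => rw [algHom_C]; exact hC a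
  | add f g hf hg => rw [map_add]; exact hadd _ _ hf hg
  | mul_X f i hf =>
    rw [map_mul]
    refine hmul _ _ hf ?_
    fin_cases i
    exacts [hx, hy, hz]

/-- The ring homomorphism out of the coordinate ring of `A_n` with given values on scalars and
on the coordinate functions. -/
def liftAn {S : Type*} [CommRing S] (n : ℕ) (c : ℂ →+* S) (a b d : S)
    (h : a * d = b ^ (n + 1)) : AnR n →+* S :=
  Ideal.Quotient.lift (Ideal.span {anEq n}) (eval₂Hom c ![a, b, d]) (by
    intro f hf
    obtain ⟨g, rfl⟩ := Ideal.mem_span_singleton.mp hf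
    simp [h])

section liftAn

variable {S : Type*} [CommRing S] {n : ℕ} {c : ℂ →+* S} {a b d : S} (h : a * d = b ^ (n + 1))

lemma liftAn_anMk (f : MvPolynomial (Fin 3) ℂ) :
    liftAn n c a b d h (anMk n f) = eval₂ c ![a, b, d] f := rfl

@[simp] lemma liftAn_cx : liftAn n c a b d h (cx n) = a := by simp [liftAn_anMk, cx]
@[simp] lemma liftAn_cy : liftAn n c a b d h (cy n) = b := by simp [liftAn_anMk, cy]
@[simp] lemma liftAn_cz : liftAn n c a b d h (cz n) = d := by simp [liftAn_anMk, cz]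
@[simp] lemma liftAn_algebraMap (r : ℂ) : liftAn n c a b d h (algebraMap ℂ _ r) = c r := by
  rw [← algHom_C (anMk n), liftAn_anMk]; simp

lemma liftAn_comp_algebraMap : (liftAn n c a b d h).comp (algebraMap ℂ _) = c := by
  ext; simp

end liftAn

lemma anRing_hom_ext {S : Type*} [CommRing S] {n : ℕ} {f g : AnR n →+* S}
    (hC : f.comp (algebraMap ℂ _) = g.comp (algebraMap ℂ _)) (hx : f (cx n) = g (cx n))
    (hy : f (cy n) = g (cy n)) (hz : f (cz n) = g (cz n)) : f = g := by
  refine RingHom.ext fun r ↦ ?_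
  refine anRing_induction (p := fun r ↦ f r = g r) (fun a ↦ RingHom.congr_fun hC a)
    ?_ ?_ hx hy hz r
  · intro a b ha hb; simp [ha, hb]
  · intro a b ha hb; simp [ha, hb]

/-- The involution of `A_n` exchanging `x` and `z`. -/
def swapHom (n : ℕ) : AnR n →+* AnR n :=
  liftAn n (algebraMap ℂ _) (cz n) (cy n) (cx n) (by rw [mul_comm, cx_mul_cz])

lemma swapHom_comp_swapHom (n : ℕ) : (swapHom n).comp (swapHom n) = RingHom.id _ := by
  apply anRing_hom_ext
  · ext r; simp [swapHom]
  all_goals simp [swapHom]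

/-- The chart of the blow-up of `A_n` at `(x, y)` on which `x` generates. -/
def chartOne (n : ℕ) : AnR n →+* AnR 0 :=
  liftAn n (algebraMap ℂ _) (cx 0) (cy 0) (cx 0 ^ n * cz 0 ^ (n + 1)) (by
    have := cx_mul_cz 0
    simp only [zero_add, pow_one] at this
    simp only [← this]; ring)

/-- The chart of the blow-up of `A_{n+1}` at `(x, y)` on which `y` generates. -/
def chartTwo (n : ℕ) : AnR (n + 1) →+* AnR n :=
  liftAn (n + 1) (algebraMap ℂ _) (cx n * cy n) (cy n) (cz n) (by
    rw [mul_right_comm, cx_mul_cz]; ring)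

lemma evalO_cx (n : ℕ) : evalO n (cx n) = 0 := by
  simp [cx, evalO_anMk]
lemma evalO_cy (n : ℕ) : evalO n (cy n) = 0 := by
  simp [cy, evalO_anMk]
lemma evalO_cz (n : ℕ) : evalO n (cz n) = 0 := by
  simp [cz, evalO_anMk]

lemma sub_evalO_mem (n : ℕ) (f : AnR n) :
    f - algebraMap ℂ _ (evalO n f) ∈ Ideal.span {cx n, cy n, cz n} := by
  refine anRing_induction (p := fun f ↦ f - algebraMap ℂ _ (evalO n f) ∈
    Ideal.span {cx n, cy n, cz n}) ?_ ?_ ?_ ?_ ?_ ?_ f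
  · intro a; simp
  · intro a b ha hb
    convert add_mem ha hb using 1
    simp only [map_add]; ring
  · intro a b ha hb
    convert add_mem (Ideal.mul_mem_left _ a hb)
      (Ideal.mul_mem_left _ (algebraMap ℂ _ (evalO n b)) ha) using 1
    simp only [map_mul]; ring
  · rw [evalO_cx, map_zero, sub_zero]; exact Ideal.subset_span (by simp)
  · rw [evalO_cy, map_zero, sub_zero]; exact Ideal.subset_span (by simp)
  · rw [evalO_cz, map_zero, sub_zero]; exact Ideal.subset_span (by simp)

lemma mem_span_iff_evalO (n : ℕ) (f : AnR n) :
    f ∈ Ideal.span {cx n, cy n, cz n} ↔ evalO n f = 0 := by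
  constructor
  · intro h
    have : Ideal.span {cx n, cy n, cz n} ≤ RingHom.ker (evalO n) := by
      rw [Ideal.span_le]
      rintro _ (rfl | rfl | rfl)
      exacts [evalO_cx n, evalO_cy n, evalO_cz n]
    exact this h
  · intro h
    simpa [h] using sub_evalO_mem n f

/-- The field of rational functions on `A_n`. -/
abbrev RatTwo : Type := FractionRing (MvPolynomial (Fin 2) ℂ)

/-- The embedding of the coordinate ring of `A_n` into the rational functions in `x` and `y`. -/
def toRatTwo (n : ℕ) : AnR n →+* RatTwo :=
  liftAn n (algebraMap ℂ _) (algebraMap _ _ (X 0 : MvPolynomial (Fin 2) ℂ))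
    (algebraMap _ _ (X 1 : MvPolynomial (Fin 2) ℂ))
    ((algebraMap _ _ (X 1 : MvPolynomial (Fin 2) ℂ)) ^ (n + 1) /
      (algebraMap _ _ (X 0 : MvPolynomial (Fin 2) ℂ))) (by
    have : algebraMap (MvPolynomial (Fin 2) ℂ) RatTwo (X 0) ≠ 0 := by
      simp
    field_simp)

/-- Since `z = y^(n+1)/x`, inverting `x` leaves only polynomials in `x` and `y`. Later this
expresses functions on surfaces birational to `A_n` as fractions in `x` and `y`. -/
lemma exists_cx_pow_mul_eq (n : ℕ) (f : AnR n) :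
    ∃ (N : ℕ) (g : MvPolynomial (Fin 2) ℂ), cx n ^ N * f = aeval ![cx n, cy n] g := by
  refine anRing_induction (p := fun f ↦ ∃ (N : ℕ) (g : MvPolynomial (Fin 2) ℂ),
    cx n ^ N * f = aeval ![cx n, cy n] g) ?_ ?_ ?_ ?_ ?_ ?_ f
  · intro a; exact ⟨0, C a, by simp⟩
  · rintro a b ⟨N, g, hg⟩ ⟨N', g', hg'⟩
    refine ⟨N + N', X 0 ^ N' * g + X 0 ^ N * g', ?_⟩
    simp only [map_add, map_mul, map_pow, aeval_X, Matrix.cons_val_zero, ← hg, ← hg']; ring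
  · rintro a b ⟨N, g, hg⟩ ⟨N', g', hg'⟩
    refine ⟨N + N', g * g', ?_⟩
    simp only [map_mul, ← hg, ← hg']; ring
  · exact ⟨0, X 0, by simp⟩
  · exact ⟨0, X 1, by simp⟩
  · exact ⟨1, X 1 ^ (n + 1), by simp [cx_mul_cz]⟩

/-- The prime `X 0` does not divide the equation of the surface, as it does not divide `y^(n+1)`. -/
lemma cx_mul_eq_zero {n : ℕ} {f : AnR n} (h : cx n * f = 0) : f = 0 := by
  obtain ⟨f, rfl⟩ := anMk_surjective n f
  rw [cx, ← map_mul, anMk_eq_zero_iff] at h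
  obtain ⟨g, hg⟩ := h
  have hp : Prime (X 0 : MvPolynomial (Fin 3) ℂ) := X_prime
  have hd : (X 0 : MvPolynomial (Fin 3) ℂ) ∣ g := by
    refine (hp.dvd_or_dvd (Dvd.intro _ hg)).resolve_left fun h ↦ ?_
    have h1 : (X 0 : MvPolynomial (Fin 3) ℂ) ∣ X 1 ^ (n + 1) :=
      (dvd_sub_right (Dvd.intro _ rfl)).mp h
    have := hp.dvd_of_dvd_pow h1
    simp [X_dvd_X] at this
  obtain ⟨g, rfl⟩ := hd
  rw [anMk_eq_zero_iff]
  refine ⟨g, mul_left_cancel₀ hp.ne_zero ?_⟩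
  rw [hg]; ring

lemma toRatTwo_aeval (n : ℕ) (g : MvPolynomial (Fin 2) ℂ) :
    toRatTwo n (aeval ![cx n, cy n] g) = algebraMap _ _ g := by
  induction g using MvPolynomial.induction_on with
  | C a =>
    rw [algHom_C, toRatTwo, liftAn_algebraMap]; rfl
  | add f g hf hg => simp only [map_add, hf, hg]
  | mul_X f i hf =>
    simp only [map_mul, hf]
    fin_cases i <;> simp [toRatTwo]

lemma toRatTwo_injective (n : ℕ) : Function.Injective (toRatTwo n) := by
  rw [injective_iff_map_eq_zero]
  intro f hf
  obtain ⟨N, g, hg⟩ := exists_cx_pow_mul_eq n f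
  have h0 : algebraMap (MvPolynomial (Fin 2) ℂ) RatTwo g = 0 := by
    rw [← toRatTwo_aeval n, ← hg, map_mul, hf, mul_zero]
  have h1 : g = 0 := by simpa using! h0
  rw [h1, map_zero] at hg
  clear hf h0 h1
  induction N with
  | zero => simpa using hg
  | succ N ih => exact ih (cx_mul_eq_zero (by rw [← hg]; ring))

instance (n : ℕ) : IsDomain (AnR n) := (toRatTwo_injective n).isDomain

lemma aeval_cx_cy_injective (n : ℕ) :
    Function.Injective (aeval (R := ℂ) (S₁ := AnR n) ![cx n, cy n]) := by
  intro f g h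
  have := congrArg (toRatTwo n) h
  rw [toRatTwo_aeval, toRatTwo_aeval] at this
  exact IsFractionRing.injective _ _ this

lemma cx_ne_zero (n : ℕ) : cx n ≠ 0 := by
  intro h
  have : aeval (R := ℂ) (S₁ := AnR n) ![cx n, cy n] (X 0) = aeval ![cx n, cy n] (0 : MvPolynomial (Fin 2) ℂ) := by simp [h]
  exact X_ne_zero (R := ℂ) _ (aeval_cx_cy_injective n this)

lemma cy_ne_zero (n : ℕ) : cy n ≠ 0 := by
  intro h
  have : aeval (R := ℂ) (S₁ := AnR n) ![cx n, cy n] (X 1) = aeval ![cx n, cy n] (0 : MvPolynomial (Fin 2) ℂ) := by simp [h]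
  exact X_ne_zero (R := ℂ) _ (aeval_cx_cy_injective n this)

lemma cz_ne_zero (n : ℕ) : cz n ≠ 0 := by
  intro h
  have := cx_mul_cz n
  rw [h, mul_zero] at this
  exact cy_ne_zero n (pow_eq_zero_iff (Nat.succ_ne_zero n) |>.mp this.symm)

end AnRing

end DerBlowup

namespace DerBlowup

/-! ### Derivations of the coordinate ring of `A_n` -/

section AnDer

open MvPolynomial

/-- The derivation of the coordinate ring of `A_n` with the given values on `x`, `y`, `z`. -/
def mkAnDer (n : ℕ) (v : Fin 3 → MvPolynomial (Fin 3) ℂ)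
    (h : anEq n ∣ X 2 * v 0 + X 0 * v 2 - (n + 1 : MvPolynomial (Fin 3) ℂ) * X 1 ^ n * v 1) :
    Derivation ℂ (AnR n) (AnR n) :=
  Derivation.liftOfSurjective (anMk_surjective n) (d := mkDerivation ℂ v) (by
      intro f hf
      rw [anMk_eq_zero_iff] at hf ⊢
      obtain ⟨g, rfl⟩ := hf
      have : mkDerivation ℂ v (anEq n) =
          X 2 * v 0 + X 0 * v 2 - (n + 1 : MvPolynomial (Fin 3) ℂ) * X 1 ^ n * v 1 := by
        simp [Derivation.leibniz, Derivation.leibniz_pow]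
        ring
      rw [Derivation.leibniz, this, smul_eq_mul, smul_eq_mul]
      exact dvd_add (Dvd.intro _ rfl) (h.mul_left _))

lemma mkAnDer_anMk {n : ℕ} {v : Fin 3 → MvPolynomial (Fin 3) ℂ} (h) (i : Fin 3) :
    mkAnDer n v h (anMk n (X i)) = anMk n (v i) := by
  rw [mkAnDer, Derivation.liftOfSurjective_apply, mkDerivation_X]

/-- The derivation of `A_n` given by `u ∂/∂u` in the coordinates `x = u ^ (n + 1)`, `y = u v`,
`z = v ^ (n + 1)`. -/
def derE (n : ℕ) : Derivation ℂ (AnR n) (AnR n) :=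
  mkAnDer n ![(n + 1 : MvPolynomial (Fin 3) ℂ) * X 0, X 1, 0] ⟨n + 1, by simp [anEq]; ring⟩

/-- The derivation of `A_n` given by `v ∂/∂v`. -/
def derE' (n : ℕ) : Derivation ℂ (AnR n) (AnR n) :=
  mkAnDer n ![0, X 1, (n + 1 : MvPolynomial (Fin 3) ℂ) * X 2] ⟨n + 1, by simp [anEq]; ring⟩

/-- The derivation of `A_n` given by `v ^ n ∂/∂u`. -/
def derP (n : ℕ) : Derivation ℂ (AnR n) (AnR n) :=
  mkAnDer n ![(n + 1 : MvPolynomial (Fin 3) ℂ) * X 1 ^ n, X 2, 0] ⟨0, by simp; ring⟩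

/-- The derivation of `A_n` given by `u ^ n ∂/∂v`. -/
def derP' (n : ℕ) : Derivation ℂ (AnR n) (AnR n) :=
  mkAnDer n ![0, X 0, (n + 1 : MvPolynomial (Fin 3) ℂ) * X 1 ^ n] ⟨0, by simp; ring⟩

@[simp] lemma derE_cx (n : ℕ) : derE n (cx n) = (n + 1) * cx n := by
  rw [derE, cx, mkAnDer_anMk]; simp [cx, cy, cz]
@[simp] lemma derE_cy (n : ℕ) : derE n (cy n) = cy n := by
  rw [derE, cy, mkAnDer_anMk]; simp [cx, cy, cz]
@[simp] lemma derE_cz (n : ℕ) : derE n (cz n) = 0 := by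
  rw [derE, cz, mkAnDer_anMk]; simp [cx, cy, cz]
@[simp] lemma derE'_cx (n : ℕ) : derE' n (cx n) = 0 := by
  rw [derE', cx, mkAnDer_anMk]; simp [cx, cy, cz]
@[simp] lemma derE'_cy (n : ℕ) : derE' n (cy n) = cy n := by
  rw [derE', cy, mkAnDer_anMk]; simp [cx, cy, cz]
@[simp] lemma derE'_cz (n : ℕ) : derE' n (cz n) = (n + 1) * cz n := by
  rw [derE', cz, mkAnDer_anMk]; simp [cx, cy, cz]
@[simp] lemma derP_cx (n : ℕ) : derP n (cx n) = (n + 1) * cy n ^ n := by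
  rw [derP, cx, mkAnDer_anMk]; simp [cx, cy, cz]
@[simp] lemma derP_cy (n : ℕ) : derP n (cy n) = cz n := by
  rw [derP, cy, mkAnDer_anMk]; simp [cx, cy, cz]
@[simp] lemma derP_cz (n : ℕ) : derP n (cz n) = 0 := by
  rw [derP, cz, mkAnDer_anMk]; simp [cx, cy, cz]
@[simp] lemma derP'_cx (n : ℕ) : derP' n (cx n) = 0 := by
  rw [derP', cx, mkAnDer_anMk]; simp [cx, cy, cz]
@[simp] lemma derP'_cy (n : ℕ) : derP' n (cy n) = cx n := by
  rw [derP', cy, mkAnDer_anMk]; simp [cx, cy, cz]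
@[simp] lemma derP'_cz (n : ℕ) : derP' n (cz n) = (n + 1) * cy n ^ n := by
  rw [derP', cz, mkAnDer_anMk]; simp [cx, cy, cz]

lemma anDer_ext {n : ℕ} {M : Type*} [AddCommGroup M] [Module ℂ M] [Module (AnR n) M]
    [IsScalarTower ℂ (AnR n) M]
    {D D' : Derivation ℂ (AnR n) M} (hx : D (cx n) = D' (cx n))
    (hy : D (cy n) = D' (cy n)) (hz : D (cz n) = D' (cz n)) : D = D' := by
  ext f
  refine anRing_induction (p := fun f ↦ D f = D' f) ?_ ?_ ?_ hx hy hz f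
  · intro a; simp
  · intro a b ha hb; simp [ha, hb]
  · intro a b ha hb; simp [ha, hb]

lemma cy_smul_derP (n : ℕ) : cy n • derP n = cz n • derE n := by
  apply anDer_ext
  · simp only [Derivation.smul_apply, derP_cx, derE_cx, smul_eq_mul]
    linear_combination (-(n + 1) : AnR n) * cx_mul_cz n
  · simp [mul_comm]
  · simp

lemma cx_smul_derP (n : ℕ) : cx n • derP n = cy n ^ n • derE n := by
  apply anDer_ext
  · simp only [Derivation.smul_apply, derP_cx, derE_cx, smul_eq_mul]; ring
  · simp only [Derivation.smul_apply, derP_cy, derE_cy, smul_eq_mul]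
    linear_combination cx_mul_cz n
  · simp

lemma cy_smul_derP' (n : ℕ) : cy n • derP' n = cx n • derE' n := by
  apply anDer_ext
  · simp
  · simp [mul_comm]
  · simp only [Derivation.smul_apply, derP'_cz, derE'_cz, smul_eq_mul]
    linear_combination (-(n + 1) : AnR n) * cx_mul_cz n

lemma cz_smul_derP' (n : ℕ) : cz n • derP' n = cy n ^ n • derE' n := by
  apply anDer_ext
  · simp
  · simp only [Derivation.smul_apply, derP'_cy, derE'_cy, smul_eq_mul]
    linear_combination cx_mul_cz n
  · simp only [Derivation.smul_apply, derP'_cz, derE'_cz, smul_eq_mul]; ring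

lemma anDer_relation {n : ℕ} {M : Type*} [AddCommGroup M] [Module ℂ M] [Module (AnR n) M]
    [IsScalarTower ℂ (AnR n) M] (D : Derivation ℂ (AnR n) M) :
    cz n • D (cx n) + cx n • D (cz n) = ((n + 1 : AnR n) * cy n ^ n) • D (cy n) := by
  have := congrArg D (cx_mul_cz n)
  rw [Derivation.leibniz, Derivation.leibniz_pow] at this
  rw [add_comm, this, mul_smul, ← Nat.cast_smul_eq_nsmul (AnR n)]
  simp

lemma natCast_add_one_isUnit (n : ℕ) {A : Type*} [CommRing A] [Algebra ℂ A] :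
    IsUnit (n + 1 : A) := by
  have := (isUnit_iff_ne_zero.mpr (Nat.cast_add_one_ne_zero n : (n : ℂ) + 1 ≠ 0)).map
    (algebraMap ℂ A)
  simpa using this

/-- Lifted to polynomials and restricted to the line `x = z = 0`, the relation reads `(n+1) y^n b =
y^(n+1) g`, so `b` vanishes at `y = 0`. Applied to `b = D y`, it confines the values of derivations
at `y` to the maximal ideal of the origin. -/
lemma evalO_eq_zero_of_cy_pow_mul {n : ℕ} {a b c : AnR n}
    (h : cz n * a + cx n * c = (n + 1) * cy n ^ n * b) : evalO n b = 0 := by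
  obtain ⟨a, rfl⟩ := anMk_surjective n a
  obtain ⟨b, rfl⟩ := anMk_surjective n b
  obtain ⟨c, rfl⟩ := anMk_surjective n c
  have h' : anMk n
      (X 2 * a + X 0 * c - (n + 1 : MvPolynomial (Fin 3) ℂ) * X 1 ^ n * b) = 0 := by
    rw [map_sub, sub_eq_zero]
    simpa [cx, cy, cz] using h
  obtain ⟨g, hg⟩ := anMk_eq_zero_iff.mp h'
  have h1 := congrArg (aeval (R := ℂ) ![0, (Polynomial.X : Polynomial ℂ), 0]) hg
  simp only [map_add, map_sub, map_mul, map_pow, map_natCast, map_one, aeval_X,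
    Matrix.cons_val] at h1
  have h2 : ((n : Polynomial ℂ) + 1) * aeval (R := ℂ) ![0, (Polynomial.X : Polynomial ℂ), 0] b =
      Polynomial.X * aeval (R := ℂ) ![0, (Polynomial.X : Polynomial ℂ), 0] g := by
    apply mul_left_cancel₀ (pow_ne_zero n Polynomial.X_ne_zero)
    linear_combination -h1
  have h3 := congrArg (Polynomial.aeval (0 : ℂ)) h2
  simp only [map_mul, Polynomial.aeval_X, zero_mul, map_add, map_natCast, map_one,
    mul_eq_zero] at h3
  have h4 := h3.resolve_left (Nat.cast_add_one_ne_zero n)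
  rw [evalO_anMk]
  refine Eq.trans ?_ h4
  rw [← AlgHom.comp_apply]
  congr 1
  ext i
  fin_cases i <;> simp

/-- Modulo `x` the ring is `ℂ[y, z]/(y^(n+1))`, in which `z` is a nonzerodivisor. The proof carries
this out on polynomial lifts. -/
lemma cx_dvd_of_cz_mul {n : ℕ} {a c : AnR n} (h : cz n * a + cx n * c = 0) : cx n ∣ a := by
  obtain ⟨a, rfl⟩ := anMk_surjective n a
  obtain ⟨c, rfl⟩ := anMk_surjective n c
  have h' : anMk n (X 2 * a + X 0 * c) = 0 := by
    simpa [cx, cy, cz] using h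
  obtain ⟨g, hg⟩ := anMk_eq_zero_iff.mp h'
  let θ : MvPolynomial (Fin 3) ℂ →ₐ[ℂ] MvPolynomial (Fin 3) ℂ := aeval ![0, X 1, X 2]
  have h1 := congrArg θ hg
  simp only [θ, map_add, map_sub, map_mul, map_pow, aeval_X, Matrix.cons_val, zero_mul, add_zero,
    zero_sub] at h1
  have h2 : (X 2 : MvPolynomial (Fin 3) ℂ) ∣ θ g := by
    refine ((X_prime (R := ℂ) (i := (2 : Fin 3))).dvd_or_dvd (a := X 1 ^ (n + 1))
      ⟨- θ a, by simp only [θ]; linear_combination h1⟩).resolve_left fun h ↦ ?_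
    have := (X_prime (R := ℂ) (i := (2 : Fin 3))).dvd_of_dvd_pow h
    simp [X_dvd_X] at this
  obtain ⟨k, hk⟩ := h2
  have h3 : θ a = - X 1 ^ (n + 1) * k := by
    apply mul_left_cancel₀ (X_ne_zero (R := ℂ) (2 : Fin 3))
    simp only [θ] at hk ⊢
    rw [h1, hk]; ring
  have h4 : ∀ f : MvPolynomial (Fin 3) ℂ, X 0 ∣ f - θ f := by
    intro f
    induction f using MvPolynomial.induction_on with
    | C a => simp [θ]
    | add f g hf hg => convert dvd_add hf hg using 1; rw [map_add]; ring
    | mul_X f i hf =>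
      have : X 0 ∣ (X i : MvPolynomial (Fin 3) ℂ) - θ (X i) := by
        fin_cases i <;> simp [θ]
      convert dvd_add (hf.mul_right (X i)) (this.mul_left (θ f)) using 1
      rw [map_mul]; ring
  obtain ⟨l, hl⟩ := h4 a
  refine ⟨anMk n l - cz n * anMk n k, ?_⟩
  -- The second term also becomes a multiple of `x` on the surface, because `y^(n+1) = xz` there.
  have h5 : a = X 0 * l - X 1 ^ (n + 1) * k := by rw [← hl, h3]; ring
  have h6 := congrArg (anMk n) h5
  simp only [map_sub, map_mul, map_pow] at h6
  rw [h6]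
  change cx n * _ - cy n ^ (n + 1) * _ = _
  linear_combination anMk n k * cx_mul_cz n

/-- The derivations of `A_n` are generated by `derE`, `derE'`, `derP` and `derP'`. -/
lemma span_anDer (n : ℕ) :
    Submodule.span (AnR n) {derE n, derE' n, derP n, derP' n} = ⊤ := by
  rw [eq_top_iff]
  rintro D -
  set S := Submodule.span (AnR n) {derE n, derE' n, derP n, derP' n}
  have hE : derE n ∈ S := Submodule.subset_span (by simp)
  have hE' : derE' n ∈ S := Submodule.subset_span (by simp)
  have hP : derP n ∈ S := Submodule.subset_span (by simp)
  have hP' : derP' n ∈ S := Submodule.subset_span (by simp)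
  -- If `D y = 0`, then `z·Dx + x·Dz = 0` forces `Dx = xa` and `Dz = -za`, so `D` is the multiple
  -- `a/(n+1)` of `E - E'`.
  have key : ∀ D : Derivation ℂ (AnR n) (AnR n), D (cy n) = 0 → D ∈ S := by
    intro D hD
    have hr := anDer_relation D
    rw [hD, smul_zero, smul_eq_mul, smul_eq_mul] at hr
    obtain ⟨a, ha⟩ := cx_dvd_of_cz_mul hr
    have hz : D (cz n) = - cz n * a := by
      apply mul_left_cancel₀ (cx_ne_zero n)
      rw [ha] at hr
      linear_combination hr
    obtain ⟨u, hu⟩ := (natCast_add_one_isUnit n (A := AnR n)).exists_right_inv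
    have : D = (u * a) • derE n - (u * a) • derE' n := by
      apply anDer_ext
      · simp only [ha, Derivation.sub_apply, Derivation.smul_apply, derE_cx, derE'_cx,
          smul_eq_mul]
        linear_combination - cx n * a * hu
      · simp [hD]
      · simp only [hz, Derivation.sub_apply, Derivation.smul_apply, derE_cz, derE'_cz,
          smul_eq_mul]
        linear_combination cz n * a * hu
    rw [this]
    exact S.sub_mem (S.smul_mem _ hE) (S.smul_mem _ hE')
  -- `P'`, `E`, `P` send `y` to `x`, `y`, `z`, so a combination of them matches `D` on `y` once `D
  -- y` lies in `(x, y, z)`.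
  have hy : D (cy n) ∈ Ideal.span {cx n, cy n, cz n} := by
    rw [mem_span_iff_evalO]
    exact evalO_eq_zero_of_cy_pow_mul (by simpa using anDer_relation D)
  obtain ⟨a, b, c, habc⟩ := Submodule.mem_span_triple.mp hy
  have : D - (a • derP' n + b • derE n + c • derP n) ∈ S := by
    apply key
    simp only [Derivation.sub_apply, Derivation.add_apply, Derivation.smul_apply, derP'_cy,
      derE_cy, derP_cy, habc, sub_self]
  have h2 := S.add_mem this
    (S.add_mem (S.add_mem (S.smul_mem a hP') (S.smul_mem b hE)) (S.smul_mem c hP))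
  simpa using h2

lemma evalO_anDer (n : ℕ) (hn : 1 ≤ n) (D : Derivation ℂ (AnR n) (AnR n))
    (f : AnR n) : evalO n (D f) = 0 := by
  have h : ∀ D : Derivation ℂ (AnR n) (AnR n), evalO n (D (cx n)) = 0 ∧
      evalO n (D (cy n)) = 0 ∧ evalO n (D (cz n)) = 0 := by
    intro D
    have hD : D ∈ Submodule.span (AnR n) {derE n, derE' n, derP n, derP' n} := by
      rw [span_anDer]; trivial
    induction hD using Submodule.span_induction with
    | mem D hD =>
      have : n ≠ 0 := by omega
      rcases hD with rfl | rfl | rfl | rfl <;>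
      simp [evalO_cx, evalO_cy, evalO_cz, this]
    | zero => simp
    | add D D' _ _ h h' => simp [h, h']
    | smul a D _ h => simp [h]
  refine anRing_induction (p := fun f ↦ evalO n (D f) = 0) ?_ ?_ ?_ (h D).1 (h D).2.1
    (h D).2.2 f
  · intro a; simp
  · intro a b ha hb; simp [ha, hb]
  · intro a b ha hb; simp [ha, hb]

lemma linearIndependent_derE (n : ℕ) :
    LinearIndependent (AnR n) ![derE n, derE' n] := by
  rw [LinearIndependent.pair_iff]
  intro a b h
  have hx := congrArg (fun D : Derivation ℂ (AnR n) (AnR n) ↦ D (cx n)) h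
  have hz := congrArg (fun D : Derivation ℂ (AnR n) (AnR n) ↦ D (cz n)) h
  have := (natCast_add_one_isUnit n (A := AnR n)).ne_zero
  simpa [this, cx_ne_zero, cz_ne_zero] using And.intro hx hz

/-- `E` and `E'` are independent, and multiplication by `y` carries `P` and `P'` into their span, so
the quotient by that span is torsion. -/
lemma finrank_anDer (n : ℕ) :
    Module.finrank (AnR n) (Derivation ℂ (AnR n) (AnR n)) = 2 := by
  set N := Submodule.span (AnR n) (Set.range ![derE n, derE' n]) with hN
  have h1 : Module.rank (AnR n) N = 2 := by
    have := rank_span (linearIndependent_derE n)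
    rw [← hN] at this
    rw [this, Cardinal.mk_range_eq _ (linearIndependent_derE n).injective]
    simp
  have h2 : Module.rank (AnR n) (Derivation ℂ (AnR n) (AnR n) ⧸ N) = 0 := by
    rw [rank_eq_zero_iff]
    intro D
    obtain ⟨D, rfl⟩ := Submodule.Quotient.mk_surjective _ D
    refine ⟨cy n, cy_ne_zero n, ?_⟩
    rw [← Submodule.Quotient.mk_smul, Submodule.Quotient.mk_eq_zero]
    have hD : D ∈ Submodule.span (AnR n) {derE n, derE' n, derP n, derP' n} := by
      rw [span_anDer]; trivial
    have hE : derE n ∈ N := Submodule.subset_span ⟨0, rfl⟩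
    have hE' : derE' n ∈ N := Submodule.subset_span ⟨1, rfl⟩
    induction hD using Submodule.span_induction with
    | mem D hD =>
      rcases hD with rfl | rfl | rfl | rfl
      · exact N.smul_mem _ hE
      · exact N.smul_mem _ hE'
      · rw [cy_smul_derP]; exact N.smul_mem _ hE
      · rw [cy_smul_derP']; exact N.smul_mem _ hE'
    | zero => simp
    | add D D' _ _ h h' => rw [smul_add]; exact N.add_mem h h'
    | smul a D _ h => rw [smul_comm]; exact N.smul_mem _ h
  have := rank_quotient_add_rank_of_isDomain N
  rw [h1, h2, zero_add] at this
  rw [Module.finrank, ← this]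
  simp

end AnDer

end DerBlowup

namespace DerBlowup

/-! ### Derivations and localization -/

section Localization

variable {R R' : Type} [CommRing R] [CommRing R'] [Algebra ℂ R] [Algebra ℂ R'] [Algebra R R']
  [IsScalarTower ℂ R R']

/-- Along a formally étale map the Kähler differentials are obtained by base change, so the linear
map on `Ω` defined by the derivation extends. -/
lemma exists_derivation_extension [Algebra.FormallyEtale R R'] {N : Type} [AddCommGroup N]
    [Module ℂ N] [Module R N] [Module R' N] [IsScalarTower R R' N] [IsScalarTower ℂ R N]
    [IsScalarTower ℂ R' N] (D : Derivation ℂ R N) :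
    ∃ D' : Derivation ℂ R' N, ∀ r, D' (algebraMap R R' r) = D r := by
  let e := KaehlerDifferential.tensorKaehlerEquivOfFormallyEtale ℂ R R'
  let g : Ω[R'⁄ℂ] →ₗ[R'] N := (D.liftKaehlerDifferential.liftBaseChange R').comp e.symm.toLinearMap
  refine ⟨g.compDer (KaehlerDifferential.D ℂ R'), fun r ↦ ?_⟩
  have : e.symm (KaehlerDifferential.D ℂ R' (algebraMap R R' r)) =
      1 ⊗ₜ KaehlerDifferential.D ℂ R r :=
    KaehlerDifferential.tensorKaehlerEquivOfFormallyEtale_symm_D_algebraMap ..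
  simp [g, this]

lemma derivation_ext_of_isLocalization (M : Submonoid R) [IsLocalization M R'] {N : Type}
    [AddCommGroup N] [Module ℂ N] [Module R' N] [IsScalarTower ℂ R' N]
    {D D' : Derivation ℂ R' N} (h : ∀ r, D (algebraMap R R' r) = D' (algebraMap R R' r)) :
    D = D' := by
  ext b
  obtain ⟨⟨r, s⟩, hs⟩ := IsLocalization.surj M b
  have hu := IsLocalization.map_units R' s
  have h1 := congrArg D hs
  have h2 := congrArg D' hs
  simp only [Derivation.leibniz, h] at h1 h2
  rw [← h2, add_right_inj] at h1
  obtain ⟨u, hu⟩ := hu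
  rw [← hu] at h1
  exact (MulAction.injective u) h1

variable (R R') in
/-- The extension of derivations along a localization. -/
def derExtend (M : Submonoid R) [IsLocalization M R'] :
    Derivation ℂ R R →ₗ[R] Derivation ℂ R' R' :=
  haveI := Algebra.FormallyEtale.of_isLocalization (Rₘ := R') M
  have H (D : Derivation ℂ R R) :=
    exists_derivation_extension (R := R) (R' := R') (N := R')
      ((Algebra.linearMap R R').compDer D)
  { toFun D := (H D).choose
    map_add' D D' := derivation_ext_of_isLocalization M fun r ↦ by
      rw [Derivation.add_apply, (H _).choose_spec, (H _).choose_spec, (H _).choose_spec]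
      simp
    map_smul' a D := derivation_ext_of_isLocalization M fun r ↦ by
      rw [RingHom.id_apply, Derivation.smul_apply, (H _).choose_spec, (H _).choose_spec]
      simp [Algebra.smul_def] }

lemma derExtend_apply (M : Submonoid R) [IsLocalization M R'] (D : Derivation ℂ R R) (r : R) :
    derExtend R R' M D (algebraMap R R' r) = algebraMap R R' (D r) :=
  haveI := Algebra.FormallyEtale.of_isLocalization (Rₘ := R') M
  (exists_derivation_extension (R := R) (R' := R') (N := R')
      ((Algebra.linearMap R R').compDer D)).choose_spec r

/-- Finite type is needed for surjectivity: the values of a derivation on finitely many algebra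
generators have a common denominator `s`, and `s` times the derivation then preserves `R`. -/
lemma isLocalizedModule_derExtend [IsDomain R] [Algebra.FiniteType ℂ R] (M : Submonoid R)
    (hM : M ≤ nonZeroDivisors R) [IsLocalization M R'] :
    IsLocalizedModule M (derExtend R R' M) where
  map_units s := by
    obtain ⟨u, hu⟩ := IsLocalization.map_units R' s
    rw [Module.End.isUnit_iff]
    constructor
    · intro D D' h
      have h' : (s : R) • D = (s : R) • D' := h
      rw [← algebraMap_smul R', ← algebraMap_smul R' (s : R) D', ← hu] at h'
      exact (MulAction.injective u) h'
    · intro D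
      refine ⟨u⁻¹ • D, ?_⟩
      change (s : R) • (u⁻¹ • D) = D
      rw [← algebraMap_smul R', ← hu]
      exact smul_inv_smul u D
  surj D := by
    classical
    have hinj := IsLocalization.injective R' hM
    obtain ⟨S, hS⟩ := Algebra.FiniteType.out (R := ℂ) (A := R)
    have key : ∃ s : M, ∀ x ∈ Algebra.adjoin ℂ (S : Set R),
        ∃ y, algebraMap R R' y = algebraMap R R' s * D (algebraMap R R' x) := by
      obtain ⟨s, hs⟩ := IsLocalization.exist_integer_multiples_of_finset M
        (S.image fun x ↦ D (algebraMap R R' x))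
      refine ⟨s, fun x hx ↦ ?_⟩
      induction hx using Algebra.adjoin_induction with
      | mem x hx =>
        obtain ⟨y, hy⟩ := hs _ (Finset.mem_image_of_mem _ hx)
        exact ⟨y, by rw [hy, Algebra.smul_def]⟩
      | algebraMap r => exact ⟨0, by simp [← IsScalarTower.algebraMap_apply]⟩
      | add x x' _ _ h h' =>
        obtain ⟨y, hy⟩ := h
        obtain ⟨y', hy'⟩ := h'
        exact ⟨y + y', by simp only [map_add, hy, hy', mul_add]⟩
      | mul x x' _ _ h h' =>
        obtain ⟨y, hy⟩ := h
        obtain ⟨y', hy'⟩ := h'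
        refine ⟨x * y' + x' * y, ?_⟩
        simp only [map_add, map_mul, hy, hy', Derivation.leibniz, smul_eq_mul]
        ring
    obtain ⟨s, hs⟩ := key
    rw [hS] at hs
    choose g hg using fun x ↦ hs x trivial
    let D₀ : Derivation ℂ R R := Derivation.mk'
      { toFun := g
        map_add' := fun x y ↦ hinj (by simp only [hg, map_add, mul_add])
        map_smul' := fun a x ↦ hinj (by
          simp only [hg, RingHom.id_apply, Algebra.smul_def, map_mul, Derivation.leibniz,
            smul_eq_mul, ← IsScalarTower.algebraMap_apply ℂ R R', Derivation.map_algebraMap,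
            Algebra.algebraMap_self, RingHom.id_apply]
          ring) } (fun x y ↦ hinj (by
          simp only [LinearMap.coe_mk, AddHom.coe_mk, hg, map_add, map_mul, Derivation.leibniz,
            smul_eq_mul]
          ring))
    refine ⟨⟨D₀, s⟩, derivation_ext_of_isLocalization M fun r ↦ ?_⟩
    rw [derExtend_apply]
    change (s : R) • D (algebraMap R R' r) = algebraMap R R' (g r)
    rw [hg, Algebra.smul_def]
  exists_of_eq {D D'} h := by
    refine ⟨1, ?_⟩
    rw [one_smul, one_smul]
    ext r
    apply IsLocalization.injective R' hM
    rw [← derExtend_apply M D, h, derExtend_apply]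

lemma finrank_derivation_of_isLocalization [IsDomain R] [Algebra.FiniteType ℂ R]
    (M : Submonoid R) (hM : M ≤ nonZeroDivisors R) [IsLocalization M R'] :
    Module.finrank R' (Derivation ℂ R' R') = Module.finrank R (Derivation ℂ R R) := by
  haveI := isLocalizedModule_derExtend (R' := R') M hM
  rw [← IsLocalizedModule.finrank_eq M (derExtend R R' M) hM, IsLocalization.finrank_eq R' M hM]

end Localization

/-! ### Quotients modulo torsion over a domain -/

section Torsion

variable {A M N : Type*} [CommRing A] [IsDomain A] [AddCommGroup M] [Module A M]
  [AddCommGroup N] [Module A N]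

lemma exists_smul_of_mem_torsion {m : M} :
    m ∈ Submodule.torsion A M ↔ ∃ a : A, a ≠ 0 ∧ a • m = 0 := by
  rw [Submodule.mem_torsion_iff]
  constructor
  · rintro ⟨a, ha⟩
    exact ⟨a, nonZeroDivisors.coe_ne_zero a, ha⟩
  · rintro ⟨a, ha, h⟩
    exact ⟨⟨a, mem_nonZeroDivisors_of_ne_zero ha⟩, h⟩

/-- Equivalent modules have equivalent quotients modulo torsion. -/
def modTorsionEquiv (e : M ≃ₗ[A] N) :
    (M ⧸ Submodule.torsion A M) ≃ₗ[A] (N ⧸ Submodule.torsion A N) :=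
  Submodule.Quotient.equiv _ _ e (by
    ext n
    simp only [Submodule.mem_map, exists_smul_of_mem_torsion]
    constructor
    · rintro ⟨m, ⟨a, ha, h⟩, rfl⟩
      exact ⟨a, ha, by simp [← map_smul, h]⟩
    · rintro ⟨a, ha, h⟩
      exact ⟨e.symm n, ⟨a, ha, by simp [← map_smul, h]⟩, by simp⟩)

/-- A torsion kernel is the whole torsion submodule, as the target is torsion free. Surjections of
this kind survive base change, which the torsion submodule itself need not do. -/
lemma nonempty_equiv_modTorsion_of_surjective {r : ℕ} (f : M →ₗ[A] (Fin r → A))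
    (hf : Function.Surjective f) (h : ∀ m, f m = 0 → ∃ a : A, a ≠ 0 ∧ a • m = 0) :
    Nonempty ((Fin r → A) ≃ₗ[A] M ⧸ Submodule.torsion A M) := by
  have hk : Submodule.torsion A M = LinearMap.ker f := by
    ext m
    rw [exists_smul_of_mem_torsion, LinearMap.mem_ker]
    refine ⟨?_, h m⟩
    rintro ⟨a, ha, ham⟩
    have : a • f m = 0 := by rw [← map_smul, ham, map_zero]
    exact (smul_eq_zero.mp this).resolve_left ha
  rw [hk]
  exact ⟨(f.quotKerEquivOfSurjective hf).symm⟩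

end Torsion

/-! ### Freeness of the pullback under localization and base change -/

section PullbackFree

/-- Derivations commute with localization, so both sides concern isomorphic `A`-modules and the same
rank. This makes the condition independent of the affine open of the base on which it is tested. -/
lemma derPullbackFree_iff_of_isLocalization {R R' A : Type} [CommRing R] [CommRing R']
    [CommRing A] [Algebra ℂ R] [Algebra ℂ R'] [Algebra R R'] [IsScalarTower ℂ R R']
    [Algebra R A] [Algebra R' A] [IsScalarTower R R' A] [IsDomain R] [IsDomain A]
    [Algebra.FiniteType ℂ R] (M : Submonoid R) (hM : M ≤ nonZeroDivisors R)
    [IsLocalization M R'] :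
    DerPullbackFree R A ↔ DerPullbackFree R' A := by
  haveI := isLocalizedModule_derExtend (R' := R') M hM
  have hb : IsBaseChange R' (derExtend R R' M) := IsLocalizedModule.isBaseChange M R' _
  let e : (A ⊗[R] Derivation ℂ R R) ≃ₗ[A] (A ⊗[R'] Derivation ℂ R' R') :=
    (TensorProduct.AlgebraTensorModule.cancelBaseChange R R' A A (Derivation ℂ R R)).symm ≪≫ₗ
      TensorProduct.AlgebraTensorModule.congr (LinearEquiv.refl A A) hb.equiv
  rw [DerPullbackFree, DerPullbackFree, finrank_derivation_of_isLocalization (R' := R') M hM]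
  exact ⟨fun ⟨g⟩ ↦ ⟨g ≪≫ₗ modTorsionEquiv e⟩, fun ⟨g⟩ ↦ ⟨g ≪≫ₗ (modTorsionEquiv e).symm⟩⟩

/-- By right exactness, the kernel after base change is generated by the image of the old kernel.
Its annihilators stay nonzero because `A → A'` is injective. -/
lemma exists_baseChange_surjective {A A' M : Type} [CommRing A] [CommRing A'] [Algebra A A']
    [IsDomain A] [IsDomain A'] (hA : Function.Injective (algebraMap A A')) [AddCommGroup M]
    [Module A M] {r : ℕ} (f : M →ₗ[A] (Fin r → A)) (hf : Function.Surjective f)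
    (h : ∀ m, f m = 0 → ∃ a : A, a ≠ 0 ∧ a • m = 0) :
    ∃ f' : (A' ⊗[A] M) →ₗ[A'] (Fin r → A'), Function.Surjective f' ∧
      ∀ m, f' m = 0 → ∃ a : A', a ≠ 0 ∧ a • m = 0 := by
  have hex : Function.Exact (LinearMap.ker f).subtype f := LinearMap.exact_subtype_ker_map f
  have hex' : Function.Exact (LinearMap.lTensor A' (LinearMap.ker f).subtype)
      (LinearMap.lTensor A' f) := lTensor_exact A' hex hf
  have hsurj : Function.Surjective (f.baseChange A') := LinearMap.lTensor_surjective A' hf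
  let p : (A' ⊗[A] (Fin r → A)) ≃ₗ[A'] (Fin r → A') := TensorProduct.piScalarRight A A' A' (Fin r)
  refine ⟨p.toLinearMap ∘ₗ f.baseChange A', p.surjective.comp hsurj, fun m hm ↦ ?_⟩
  have h0 : f.baseChange A' m = 0 := p.injective (by simpa using hm)
  obtain ⟨t, rfl⟩ := (hex' m).mp h0
  clear hm h0
  induction t with
  | zero => exact ⟨1, one_ne_zero, by simp⟩
  | add t t' ht ht' =>
    obtain ⟨a, ha, h⟩ := ht
    obtain ⟨a', ha', h'⟩ := ht'
    refine ⟨a * a', mul_ne_zero ha ha', ?_⟩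
    rw [map_add, smul_add, mul_smul, smul_comm, h, mul_smul, h']
    simp
  | tmul b m =>
    obtain ⟨a, ha, h⟩ := h m.1 m.2
    refine ⟨algebraMap A A' a, by simpa using (map_ne_zero_iff _ hA).mpr ha, ?_⟩
    rw [LinearMap.lTensor_tmul, Submodule.subtype_apply, TensorProduct.smul_tmul',
      algebraMap_smul, TensorProduct.smul_tmul, h, TensorProduct.tmul_zero]

lemma DerPullbackFree.exists_surjective {R A : Type} [CommRing R] [CommRing A]
    [Algebra ℂ R] [Algebra R A] [IsDomain A] (h : DerPullbackFree R A) :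
    ∃ f : (A ⊗[R] Derivation ℂ R R) →ₗ[A] (Fin (Module.finrank R (Derivation ℂ R R)) → A),
      Function.Surjective f ∧ ∀ m, f m = 0 → ∃ a : A, a ≠ 0 ∧ a • m = 0 := by
  obtain ⟨g⟩ := h
  refine ⟨g.symm.toLinearMap ∘ₗ Submodule.mkQ _,
    g.symm.surjective.comp (Submodule.mkQ_surjective _), fun m hm ↦ ?_⟩
  have : Submodule.mkQ (Submodule.torsion A (A ⊗[R] Derivation ℂ R R)) m = 0 :=
    g.symm.injective (by simpa using hm)
  rwa [Submodule.mkQ_apply, Submodule.Quotient.mk_eq_zero, exists_smul_of_mem_torsion] at this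

lemma DerPullbackFree.baseChange {R A A' : Type} [CommRing R] [CommRing A] [CommRing A']
    [Algebra ℂ R] [Algebra R A] [Algebra R A'] [Algebra A A'] [IsScalarTower R A A']
    [IsDomain A] [IsDomain A'] (hA : Function.Injective (algebraMap A A'))
    (h : DerPullbackFree R A) : DerPullbackFree R A' := by
  obtain ⟨f, hf, h⟩ := h.exists_surjective
  obtain ⟨f', hf', h'⟩ := exists_baseChange_surjective hA f hf h
  let e : (A' ⊗[A] (A ⊗[R] Derivation ℂ R R)) ≃ₗ[A'] (A' ⊗[R] Derivation ℂ R R) :=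
    TensorProduct.AlgebraTensorModule.cancelBaseChange R A A' A' (Derivation ℂ R R)
  refine nonempty_equiv_modTorsion_of_surjective (f' ∘ₗ e.symm.toLinearMap)
    (hf'.comp e.symm.surjective) fun m hm ↦ ?_
  obtain ⟨a, ha, H⟩ := h' _ hm
  exact ⟨a, ha, e.symm.injective (by rw [map_zero, map_smul]; exact H)⟩

lemma derPullbackFree_of_free {R A : Type} [CommRing R] [CommRing A] [Nontrivial R]
    [Algebra ℂ R] [Algebra R A] [IsDomain A] [Module.Free R (Derivation ℂ R R)]
    [Module.Finite R (Derivation ℂ R R)] : DerPullbackFree R A := by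
  let b := Module.finBasis R (Derivation ℂ R R)
  let e := (Algebra.TensorProduct.basis A b).equivFun
  refine nonempty_equiv_modTorsion_of_surjective e.toLinearMap e.surjective fun m hm ↦
    ⟨1, one_ne_zero, ?_⟩
  rw [one_smul]
  exact e.injective (by simpa using hm)

end PullbackFree

end DerBlowup

namespace DerBlowup

/-! ### Pullbacks of the module of derivations of `A_n` -/

section Pullback

variable {n : ℕ} {A : Type} [CommRing A] [Algebra (AnR n) A]

variable (A) in
/-- The functional on the pullback of the derivations of `A_n` given by evaluation at `f`. -/
def evalDer (f : AnR n) : (A ⊗[AnR n] Derivation ℂ (AnR n) (AnR n)) →ₗ[A] A :=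
  LinearMap.liftBaseChange A
    { toFun := fun D ↦ algebraMap (AnR n) A (D f)
      map_add' := fun D D' ↦ by simp
      map_smul' := fun r D ↦ by simp [Algebra.smul_def] }

@[simp] lemma evalDer_one_tmul (f : AnR n) (D : Derivation ℂ (AnR n) (AnR n)) :
    evalDer A f (1 ⊗ₜ D) = algebraMap (AnR n) A (D f) := by
  simp [evalDer]

lemma span_one_tmul : Submodule.span A (({derE n, derE' n, derP n, derP' n} :
    Set (Derivation ℂ (AnR n) (AnR n))).image fun D ↦ (1 : A) ⊗ₜ[AnR n] D) = ⊤ := by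
  have := Submodule.baseChange_span (R := AnR n) (A := A)
    ({derE n, derE' n, derP n, derP' n} : Set (Derivation ℂ (AnR n) (AnR n)))
  rw [span_anDer, Submodule.baseChange_top] at this
  exact this.symm

lemma one_tmul_smul (r : AnR n) (D : Derivation ℂ (AnR n) (AnR n)) :
    (1 : A) ⊗ₜ[AnR n] (r • D) = algebraMap (AnR n) A r • (1 ⊗ₜ[AnR n] D) := by
  rw [TensorProduct.tmul_smul, algebraMap_smul]

variable [IsDomain A]

/-- A pair of elements of the pullback modulo torsion, generating it and independent under some
pair of functionals, makes it free. -/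
lemma derPullbackFree_of_pair (f g : AnR n) (D₁ D₂ : Derivation ℂ (AnR n) (AnR n))
    (hdet : algebraMap _ A (D₁ f) * algebraMap _ A (D₂ g) -
      algebraMap _ A (D₁ g) * algebraMap _ A (D₂ f) ≠ 0)
    (hspan : ∀ D ∈ ({derE n, derE' n, derP n, derP' n} : Set (Derivation ℂ (AnR n) (AnR n))),
      ∃ (c a b : A), c ≠ 0 ∧
        c • ((1 : A) ⊗ₜ[AnR n] D - (a • (1 ⊗ₜ[AnR n] D₁) + b • (1 ⊗ₜ[AnR n] D₂))) = 0) :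
    DerPullbackFree (AnR n) A := by
  rw [DerPullbackFree, finrank_anDer]
  set T := Submodule.torsion A (A ⊗[AnR n] Derivation ℂ (AnR n) (AnR n)) with hT
  let u : Fin 2 → (A ⊗[AnR n] Derivation ℂ (AnR n) (AnR n)) ⧸ T :=
    ![T.mkQ (1 ⊗ₜ D₁), T.mkQ (1 ⊗ₜ D₂)]
  have hli : LinearIndependent A u := by
    rw [LinearIndependent.pair_iff]
    intro a b hab
    rw [← map_smul, ← map_smul, ← map_add, Submodule.mkQ_apply, Submodule.Quotient.mk_eq_zero,
      exists_smul_of_mem_torsion] at hab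
    obtain ⟨c, hc, h⟩ := hab
    have hf := congrArg (evalDer A f) h
    have hg := congrArg (evalDer A g) h
    simp only [map_smul, map_add, evalDer_one_tmul, map_zero, smul_eq_mul, mul_eq_zero, hc,
      false_or] at hf hg
    constructor
    · apply (mul_eq_zero.mp _).resolve_right hdet
      linear_combination algebraMap _ A (D₂ g) * hf - algebraMap _ A (D₂ f) * hg
    · apply (mul_eq_zero.mp _).resolve_right hdet
      linear_combination algebraMap _ A (D₁ f) * hg - algebraMap _ A (D₁ g) * hf
  have hsp : ⊤ ≤ Submodule.span A (Set.range u) := by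
    rw [← Submodule.range_mkQ T, ← Submodule.map_top, ← span_one_tmul, Submodule.map_span,
      Submodule.span_le]
    rintro _ ⟨_, ⟨D, hD, rfl⟩, rfl⟩
    obtain ⟨c, a, b, hc, h⟩ := hspan D hD
    have h' : _ ∈ T := exists_smul_of_mem_torsion.mpr ⟨c, hc, h⟩
    rw [← Submodule.Quotient.mk_eq_zero, ← Submodule.mkQ_apply, map_sub, sub_eq_zero] at h'
    rw [SetLike.mem_coe]
    dsimp only
    rw [h', map_add, map_smul, map_smul]
    exact add_mem (Submodule.smul_mem _ _ (Submodule.subset_span ⟨0, rfl⟩))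
      (Submodule.smul_mem _ _ (Submodule.subset_span ⟨1, rfl⟩))
  exact ⟨(Module.Basis.mk hli hsp).equivFun.symm⟩

local notation "xA" => algebraMap (AnR n) A (cx n)
local notation "yA" => algebraMap (AnR n) A (cy n)
local notation "zA" => algebraMap (AnR n) A (cz n)

omit [IsDomain A] in
lemma map_cx_mul_cz : xA * zA = yA ^ (n + 1) := by rw [← map_mul, cx_mul_cz, map_pow]

variable (A) in
omit [IsDomain A] in
lemma one_tmul_relations :
    yA • ((1 : A) ⊗ₜ[AnR n] derP n) = zA • (1 ⊗ₜ derE n) ∧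
    xA • ((1 : A) ⊗ₜ[AnR n] derP n) = yA ^ n • (1 ⊗ₜ derE n) ∧
    yA • ((1 : A) ⊗ₜ[AnR n] derP' n) = xA • (1 ⊗ₜ derE' n) ∧
    zA • ((1 : A) ⊗ₜ[AnR n] derP' n) = yA ^ n • (1 ⊗ₜ derE' n) := by
  simp only [← map_pow]
  refine ⟨?_, ?_, ?_, ?_⟩
  · rw [← one_tmul_smul, cy_smul_derP, one_tmul_smul]
  · rw [← one_tmul_smul, cx_smul_derP, one_tmul_smul]
  · rw [← one_tmul_smul, cy_smul_derP', one_tmul_smul]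
  · rw [← one_tmul_smul, cz_smul_derP', one_tmul_smul]

/-- Here `E` and `P'` give a basis. With `y = xq`, cancelling `x` in `xE' = yP'` and in `xP = y^n E`
yields `E' = qP'` and `P = x^(n-1) q^n E` modulo torsion. -/
lemma derPullbackFree_of_cx_dvd (hn : 1 ≤ n) (hx : xA ≠ 0) (h : xA ∣ yA) :
    DerPullbackFree (AnR n) A := by
  haveI : Algebra ℂ A := ((algebraMap (AnR n) A).comp (algebraMap ℂ _)).toAlgebra
  have hu := (natCast_add_one_isUnit n (A := A)).ne_zero
  obtain ⟨q, hq⟩ := h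
  obtain ⟨k, rfl⟩ : ∃ k, n = k + 1 := ⟨n - 1, by omega⟩
  obtain ⟨h1, h2, h3, h4⟩ := one_tmul_relations (n := k + 1) A
  refine derPullbackFree_of_pair (cx _) (cy _) (derE _) (derP' _) ?_ ?_
  · simpa [hx] using hu
  · rintro D (rfl | rfl | rfl | rfl)
    · exact ⟨1, 1, 0, one_ne_zero, by simp⟩
    · refine ⟨_, 0, q, hx, ?_⟩
      rw [smul_sub, ← h3, zero_smul, zero_add, smul_smul, hq, sub_self]
    · refine ⟨_, algebraMap _ A (cx (k + 1)) ^ k * q ^ (k + 1), 0, hx, ?_⟩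
      rw [smul_sub, h2, zero_smul, add_zero, smul_smul, hq, sub_eq_zero]
      congr 1; ring
    · exact ⟨1, 0, 1, one_ne_zero, by simp⟩

lemma derPullbackFree_of_cz_dvd (hn : 1 ≤ n) (hz : zA ≠ 0) (h : zA ∣ yA) :
    DerPullbackFree (AnR n) A := by
  haveI : Algebra ℂ A := ((algebraMap (AnR n) A).comp (algebraMap ℂ _)).toAlgebra
  have hu := (natCast_add_one_isUnit n (A := A)).ne_zero
  obtain ⟨q, hq⟩ := h
  obtain ⟨k, rfl⟩ : ∃ k, n = k + 1 := ⟨n - 1, by omega⟩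
  obtain ⟨h1, h2, h3, h4⟩ := one_tmul_relations (n := k + 1) A
  refine derPullbackFree_of_pair (cz _) (cy _) (derE' _) (derP _) ?_ ?_
  · simpa [hz] using hu
  · rintro D (rfl | rfl | rfl | rfl)
    · refine ⟨_, 0, q, hz, ?_⟩
      rw [smul_sub, ← h1, zero_smul, zero_add, smul_smul, hq, sub_self]
    · exact ⟨1, 1, 0, one_ne_zero, by simp⟩
    · exact ⟨1, 0, 1, one_ne_zero, by simp⟩
    · refine ⟨_, algebraMap _ A (cz (k + 1)) ^ k * q ^ (k + 1), 0, hz, ?_⟩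
      rw [smul_sub, h4, zero_smul, add_zero, smul_smul, hq, sub_eq_zero]
      congr 1; ring

/-- Here `E` and `E'` give a basis: cancelling `y` in `yP = zE` and `yP' = xE'` expresses `P` and
`P'` through them. -/
lemma derPullbackFree_of_cy_dvd (hy : yA ≠ 0) (h : yA ∣ xA) (h' : yA ∣ zA) :
    DerPullbackFree (AnR n) A := by
  haveI : Algebra ℂ A := ((algebraMap (AnR n) A).comp (algebraMap ℂ _)).toAlgebra
  have hu := (natCast_add_one_isUnit n (A := A)).ne_zero
  have hx : xA ≠ 0 := fun h0 ↦ hy (by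
    have := map_cx_mul_cz (n := n) (A := A)
    rw [h0, zero_mul] at this
    exact (pow_eq_zero_iff (Nat.succ_ne_zero n)).mp this.symm)
  obtain ⟨p, hp⟩ := h
  obtain ⟨q, hq⟩ := h'
  obtain ⟨h1, h2, h3, h4⟩ := one_tmul_relations (n := n) A
  refine derPullbackFree_of_pair (cx _) (cy _) (derE _) (derE' _) ?_ ?_
  · simpa [hx, hy] using hu
  · rintro D (rfl | rfl | rfl | rfl)
    · exact ⟨1, 1, 0, one_ne_zero, by simp⟩
    · exact ⟨1, 0, 1, one_ne_zero, by simp⟩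
    · refine ⟨_, q, 0, hy, ?_⟩
      rw [smul_sub, h1, zero_smul, add_zero, smul_smul, hq, sub_self]
    · refine ⟨_, 0, p, hy, ?_⟩
      rw [smul_sub, h3, zero_smul, zero_add, smul_smul, hp, sub_self]

/-- If the maximal ideal of the origin of `A_n` becomes principal and nonzero, the pullback of the
derivations modulo torsion becomes free. -/
lemma derPullbackFree_of_dvd (hn : 1 ≤ n) (h0 : ¬ (xA = 0 ∧ yA = 0 ∧ zA = 0))
    (hxy : xA ∣ yA ∨ yA ∣ xA) (hzy : zA ∣ yA ∨ yA ∣ zA) : DerPullbackFree (AnR n) A := by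
  have hrel := map_cx_mul_cz (n := n) (A := A)
  have hn' : n + 1 ≠ 0 := by omega
  by_cases hy : yA = 0
  · by_cases hx : xA = 0
    · by_cases hz : zA = 0
      · exact absurd ⟨hx, hy, hz⟩ h0
      · exact derPullbackFree_of_cz_dvd hn hz (by simp [hy])
    · exact derPullbackFree_of_cx_dvd hn hx (by simp [hy])
  · have hx : xA ≠ 0 := fun h ↦ hy (by rw [h] at hrel; simpa [hn'] using hrel.symm)
    have hz : zA ≠ 0 := fun h ↦ hy (by rw [h] at hrel; simpa [hn'] using hrel.symm)
    rcases hxy with h | h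
    · exact derPullbackFree_of_cx_dvd hn hx h
    rcases hzy with h' | h'
    · exact derPullbackFree_of_cz_dvd hn hz h'
    · exact derPullbackFree_of_cy_dvd hy h h'

end Pullback

/-! ### What freeness of the pullback forces on `x`, `y`, `z` -/

section Dual

variable {n : ℕ}

/-- The derivation of `A_n` at the origin with given values on `x`, `y` and `z`. -/
def toDual (hn : 1 ≤ n) (a b c : ℂ) : AnR n →+* DualNumber ℂ :=
  liftAn n (algebraMap ℂ _) (TrivSqZeroExt.inr a) (TrivSqZeroExt.inr b) (TrivSqZeroExt.inr c) (by
    obtain ⟨k, rfl⟩ : ∃ k, n = k + 1 := ⟨n - 1, by omega⟩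
    rw [TrivSqZeroExt.inr_mul_inr, pow_succ, pow_succ, mul_assoc, TrivSqZeroExt.inr_mul_inr,
      mul_zero])

lemma fst_toDual (hn : 1 ≤ n) (a b c : ℂ) (f : AnR n) :
    (toDual hn a b c f).fst = evalO n f := by
  have : ((TrivSqZeroExt.fstHom ℂ ℂ ℂ).toRingHom.comp (toDual hn a b c)) =
      (evalO n).toRingHom := by
    apply anRing_hom_ext
    · ext r; simp [toDual, TrivSqZeroExt.algebraMap_eq_inl]
    · simp [toDual, evalO_cx]
    · simp [toDual, evalO_cy]
    · simp [toDual, evalO_cz]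
  exact RingHom.congr_fun this f

lemma snd_toDual_mul (hn : 1 ≤ n) (a b c : ℂ) (f g : AnR n) :
    (toDual hn a b c (f * g)).snd =
      evalO n f * (toDual hn a b c g).snd + evalO n g * (toDual hn a b c f).snd := by
  rw [map_mul, TrivSqZeroExt.snd_mul, fst_toDual, fst_toDual]
  simp [mul_comm]

/-- Derivations preserve the maximal ideal of the origin, so they act on the cotangent space. Three
entries of that action (`x` in `Dx`, `z` in `Dz`, `z` in `Dy`) separate `E`, `E'`, `P`. The pullback
therefore maps onto `A³`, which rank two excludes. -/
lemma not_derPullbackFree_of_eq_zero {A : Type} [CommRing A] [Algebra (AnR n) A] [IsDomain A]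
    (hn : 1 ≤ n) (hx : algebraMap (AnR n) A (cx n) = 0) (hy : algebraMap (AnR n) A (cy n) = 0)
    (hz : algebraMap (AnR n) A (cz n) = 0) : ¬ DerPullbackFree (AnR n) A := by
  intro h
  obtain ⟨f, hf, hf'⟩ := h.exists_surjective
  letI : Algebra ℂ A := ((algebraMap (AnR n) A).comp (algebraMap ℂ _)).toAlgebra
  have hu := natCast_add_one_isUnit n (A := A)
  have hA : ∀ r : AnR n, algebraMap (AnR n) A r = algebraMap ℂ A (evalO n r) := by
    intro r
    have : r - algebraMap ℂ _ (evalO n r) ∈ RingHom.ker (algebraMap (AnR n) A) := by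
      refine Ideal.span_le.mpr ?_ (sub_evalO_mem n r)
      rintro _ (rfl | rfl | rfl)
      exacts [hx, hy, hz]
    rw [RingHom.mem_ker, map_sub, sub_eq_zero] at this
    exact this
  let coef (v : Fin 3 → ℂ) (w : AnR n) : Derivation ℂ (AnR n) (AnR n) →ₗ[AnR n] A :=
    { toFun := fun D ↦ algebraMap ℂ A (toDual hn (v 0) (v 1) (v 2) (D w)).snd
      map_add' := fun D D' ↦ by simp
      map_smul' := fun r D ↦ by
        rw [Derivation.smul_apply, smul_eq_mul, snd_toDual_mul, evalO_anDer n hn, zero_mul,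
          add_zero, RingHom.id_apply, Algebra.smul_def, hA, map_mul] }
  let Λ : (A ⊗[AnR n] Derivation ℂ (AnR n) (AnR n)) →ₗ[A] (Fin 3 → A) :=
    LinearMap.pi ![(coef ![1, 0, 0] (cx n)).liftBaseChange A,
      (coef ![0, 0, 1] (cz n)).liftBaseChange A, (coef ![0, 0, 1] (cy n)).liftBaseChange A]
  have hΛ : Function.Surjective Λ := by
    obtain ⟨u, hu⟩ := hu
    have hu' : ((u⁻¹ : Aˣ) : A) * (n + 1) = 1 := by rw [← hu]; simp
    have hpow : ∀ b, toDual hn b 0 0 (cy n) = 0 ∧ toDual hn 0 0 b (cy n) = 0 := by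
      intro b; simp [toDual]
    have hn0 : n ≠ 0 := by omega
    intro v
    refine ⟨(v 0 * u⁻¹) ⊗ₜ derE n + (v 1 * u⁻¹) ⊗ₜ derE' n + (v 2) ⊗ₜ derP n, ?_⟩
    ext i
    fin_cases i <;>
    simp [Λ, coef, hpow, hn0, toDual, mul_assoc, hu', TrivSqZeroExt.snd_mul]
  have hker : LinearMap.ker f ≤ LinearMap.ker Λ := by
    intro m hm
    obtain ⟨a, ha, h⟩ := hf' m hm
    have : a • Λ m = 0 := by rw [← map_smul, h, map_zero]
    exact (smul_eq_zero.mp this).resolve_left ha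
  let g : (Fin (Module.finrank (AnR n) (Derivation ℂ (AnR n) (AnR n))) → A) →ₗ[A] (Fin 3 → A) :=
    (LinearMap.ker f).liftQ Λ hker ∘ₗ (f.quotKerEquivOfSurjective hf).symm.toLinearMap
  have hg : Function.Surjective g := by
    intro v
    obtain ⟨m, hm⟩ := hΛ v
    exact ⟨f.quotKerEquivOfSurjective hf (Submodule.Quotient.mk m), by simp [g, hm]⟩
  have := le_of_fin_surjective A g hg
  rw [finrank_anDer] at this
  omega

/-- If all minors of generators were in the maximal ideal, bilinearity would put the determinant of
the standard basis there. -/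
lemma exists_isUnit_minor {A : Type*} [CommRing A] [IsLocalRing A] {S : Set (Fin 2 → A)}
    (hS : Submodule.span A S = ⊤) : ∃ v ∈ S, ∃ w ∈ S, IsUnit (v 0 * w 1 - v 1 * w 0) := by
  by_contra! hc
  have step : ∀ v w : Fin 2 → A, v 0 * w 1 - v 1 * w 0 ∈ IsLocalRing.maximalIdeal A := by
    intro v w
    have hv : v ∈ Submodule.span A S := by rw [hS]; trivial
    have hw : w ∈ Submodule.span A S := by rw [hS]; trivial
    induction hv, hw using Submodule.span_induction₂ with
    | mem_mem v w h h' => exact hc v h w h'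
    | zero_left => simp
    | zero_right => simp
    | add_left u v w _ _ _ h h' =>
      convert add_mem h h' using 1
      simp only [Pi.add_apply]; ring
    | add_right u v w _ _ _ h h' =>
      convert add_mem h h' using 1
      simp only [Pi.add_apply]; ring
    | smul_left r u v _ _ h =>
      convert Ideal.mul_mem_left _ r h using 1
      simp only [Pi.smul_apply, smul_eq_mul]; ring
    | smul_right r u v _ _ h =>
      convert Ideal.mul_mem_left _ r h using 1
      simp only [Pi.smul_apply, smul_eq_mul]; ring
  have := step ![1, 0] ![0, 1]
  simp at this

lemma minor_relation {A : Type*} [CommRing A] {a b : A} {v w : Fin 2 → A} (h : a • v = b • w)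
    (u : Fin 2 → A) : a * (v 0 * u 1 - v 1 * u 0) = b * (w 0 * u 1 - w 1 * u 0) := by
  have h0 := congrFun h 0
  have h1 := congrFun h 1
  simp only [Pi.smul_apply, smul_eq_mul] at h0 h1
  linear_combination u 1 * h0 - u 0 * h1

/-- The vectors stand for the images of `E`, `E'`, `P`, `P'`. A relation between two of them becomes
a relation between their minors against any fixed third vector, and a unit minor turns it into a
divisibility. The proof runs through the possible pairs with unit minor. -/
lemma dvd_of_minor {A : Type*} [CommRing A] [IsDomain A] {x y z : A} {n : ℕ} (hn : 1 ≤ n)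
    {e₁ e₂ e₃ e₄ : Fin 2 → A} (h1 : y • e₃ = z • e₁) (h2 : x • e₃ = y ^ n • e₁)
    (h3 : y • e₄ = x • e₂) (h4 : z • e₄ = y ^ n • e₂) {v w : Fin 2 → A}
    (hv : v ∈ ({e₁, e₂, e₃, e₄} : Set (Fin 2 → A))) (hw : w ∈ ({e₁, e₂, e₃, e₄} : Set (Fin 2 → A)))
    (hu : IsUnit (v 0 * w 1 - v 1 * w 0)) : (x ∣ y ∨ y ∣ x) ∧ (z ∣ y ∨ y ∣ z) := by
  let d (v w : Fin 2 → A) : A := v 0 * w 1 - v 1 * w 0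
  have r1 (u) : y * d e₃ u = z * d e₁ u := minor_relation h1 u
  have r2 (u) : x * d e₃ u = y ^ n * d e₁ u := minor_relation h2 u
  have r3 (u) : y * d e₄ u = x * d e₂ u := minor_relation h3 u
  have r4 (u) : z * d e₄ u = y ^ n * d e₂ u := minor_relation h4 u
  have anti (D D') : d D D' = - d D' D := by simp only [d]; ring
  have self (D) : d D D = 0 := by simp only [d]; ring
  change IsUnit (d v w) at hu
  clear_value d
  have dvd_of {a b c u : A} (hu : IsUnit u) (h : a * b = c * u) : a ∣ c := by
    obtain ⟨u, rfl⟩ := hu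
    exact ⟨b * ((u⁻¹ : Aˣ) : A), by rw [← mul_assoc, h]; simp⟩
  have hyn {a c u : A} (hu : IsUnit u) (h : y ^ n * a = c * u) : y ∣ c :=
    (dvd_pow_self y (by omega)).trans (dvd_of hu h)
  have ne {u : A} (hu : IsUnit u) (a : A) (h : a * u = 0) : a = 0 :=
    (mul_eq_zero.mp h).resolve_right hu.ne_zero
  have case12 (k : IsUnit (d e₁ e₂)) : (x ∣ y ∨ y ∣ x) ∧ (z ∣ y ∨ y ∣ z) := by
    refine ⟨Or.inr (dvd_of (b := - d e₄ e₁) k ?_), Or.inr (dvd_of k (r1 _))⟩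
    rw [anti e₁, mul_neg, r3]; ring
  -- `E` and `P` are linked by both of their relations, so they can be independent only if `y = z =
  -- 0`; the pair `E'`, `P'` below is symmetric.
  have case13 (k : IsUnit (d e₁ e₃)) : (x ∣ y ∨ y ∣ x) ∧ (z ∣ y ∨ y ∣ z) := by
    have hz : z = 0 := ne k _ (by rw [← r1, self, mul_zero])
    have hy : y = 0 := by
      have := ne k _ (by rw [← r2 e₃, self, mul_zero])
      exact (pow_eq_zero_iff (by omega)).mp this
    simp [hy, hz]
  have case14 (k : IsUnit (d e₁ e₄)) : (x ∣ y ∨ y ∣ x) ∧ (z ∣ y ∨ y ∣ z) := by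
    refine ⟨Or.inl (dvd_of (b := - d e₂ e₁) k ?_), Or.inr (dvd_of k (r1 _))⟩
    rw [anti e₁, mul_neg, mul_neg, r3]
  have case23 (k : IsUnit (d e₂ e₃)) : (x ∣ y ∨ y ∣ x) ∧ (z ∣ y ∨ y ∣ z) := by
    refine ⟨Or.inr (dvd_of k (r3 _)), Or.inl (dvd_of (b := - d e₁ e₂) k ?_)⟩
    rw [anti e₂, mul_neg, mul_neg, r1]
  have case24 (k : IsUnit (d e₂ e₄)) : (x ∣ y ∨ y ∣ x) ∧ (z ∣ y ∨ y ∣ z) := by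
    have hx : x = 0 := ne k _ (by rw [← r3, self, mul_zero])
    have hy : y = 0 := by
      have := ne k _ (by rw [← r4 e₄, self, mul_zero])
      exact (pow_eq_zero_iff (by omega)).mp this
    simp [hy, hx]
  have case34 (k : IsUnit (d e₃ e₄)) : (x ∣ y ∨ y ∣ x) ∧ (z ∣ y ∨ y ∣ z) := by
    refine ⟨Or.inr (hyn k (r2 _).symm), Or.inr (hyn (a := - d e₂ e₃) k ?_)⟩
    rw [anti e₃, mul_neg, mul_neg, r4]
  have sw {v w} (h : IsUnit (d v w)) : IsUnit (d w v) := by rw [anti]; exact h.neg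
  have no {v} (h : IsUnit (d v v)) : (x ∣ y ∨ y ∣ x) ∧ (z ∣ y ∨ y ∣ z) := by
    rw [self] at h; exact absurd h not_isUnit_zero
  rcases hv with rfl | rfl | rfl | rfl <;> rcases hw with rfl | rfl | rfl | rfl
  exacts [no hu, case12 hu, case13 hu, case14 hu, case12 (sw hu), no hu, case23 hu, case24 hu,
    case13 (sw hu), case23 (sw hu), no hu, case34 hu, case14 (sw hu), case24 (sw hu),
    case34 (sw hu), no hu]

/-- If the pullback of the derivations of `A_n` modulo torsion becomes free over a local domain,
the maximal ideal of the origin becomes principal. -/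
lemma dvd_of_derPullbackFree {A : Type} [CommRing A] [Algebra (AnR n) A] [IsDomain A]
    [IsLocalRing A] (hn : 1 ≤ n) (h : DerPullbackFree (AnR n) A) :
    (algebraMap (AnR n) A (cx n) ∣ algebraMap (AnR n) A (cy n) ∨
      algebraMap (AnR n) A (cy n) ∣ algebraMap (AnR n) A (cx n)) ∧
    (algebraMap (AnR n) A (cz n) ∣ algebraMap (AnR n) A (cy n) ∨
      algebraMap (AnR n) A (cy n) ∣ algebraMap (AnR n) A (cz n)) := by
  obtain ⟨f, hf, -⟩ := h.exists_surjective
  revert f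
  rw [finrank_anDer]
  intro f hf
  have hspan : Submodule.span A ({f (1 ⊗ₜ derE n), f (1 ⊗ₜ derE' n), f (1 ⊗ₜ derP n),
      f (1 ⊗ₜ derP' n)} : Set (Fin 2 → A)) = ⊤ := by
    have := congrArg (Submodule.map f) (span_one_tmul (n := n) (A := A))
    rw [Submodule.map_span, Submodule.map_top, LinearMap.range_eq_top.mpr hf] at this
    simpa only [Set.image_insert_eq, Set.image_singleton] using this
  obtain ⟨v, hv, w, hw, hu⟩ := exists_isUnit_minor hspan
  obtain ⟨h1, h2, h3, h4⟩ := one_tmul_relations (n := n) A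
  replace h1 := congrArg f h1
  replace h2 := congrArg f h2
  replace h3 := congrArg f h3
  replace h4 := congrArg f h4
  rw [map_smul, map_smul] at h1 h2 h3 h4
  exact dvd_of_minor hn h1 h2 h3 h4 hv hw hu

end Dual

end DerBlowup

namespace DerBlowup

/-! ### Local rings of smooth surfaces -/

section LocalCoordinates

/-- Local coordinates `s`, `t` at a rational point of a smooth surface, together with the
derivations `∂/∂s` and `∂/∂t`. -/
structure LocalCoord (O : Type) [CommRing O] [IsLocalRing O] [Algebra ℂ O] where
  s : O
  t : O
  ds : Derivation ℂ O O
  dt : Derivation ℂ O O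
  eval : O →ₐ[ℂ] ℂ
  max_eq : IsLocalRing.maximalIdeal O = Ideal.span {s, t}
  ds_s : ds s = 1
  ds_t : ds t = 0
  dt_s : dt s = 0
  dt_t : dt t = 1

variable {O : Type} [CommRing O] [IsLocalRing O] [Algebra ℂ O]

lemma mem_maximalIdeal_iff_eval (ε : O →ₐ[ℂ] ℂ) (f : O) :
    f ∈ IsLocalRing.maximalIdeal O ↔ ε f = 0 := by
  have hmax : (RingHom.ker ε).IsMaximal :=
    RingHom.ker_isMaximal_of_surjective ε fun c ↦ ⟨algebraMap ℂ O c, by simp⟩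
  rw [← IsLocalRing.eq_maximalIdeal hmax, RingHom.mem_ker]

/-- The projection to the cotangent space at a rational point. -/
def cotangentDer (ε : O →ₐ[ℂ] ℂ) :
    Derivation ℂ O (IsLocalRing.maximalIdeal O).Cotangent :=
  have hmem (f : O) : f - algebraMap ℂ O (ε f) ∈ IsLocalRing.maximalIdeal O := by
    rw [mem_maximalIdeal_iff_eval ε]; simp
  Derivation.mk'
    { toFun := fun f ↦ (IsLocalRing.maximalIdeal O).toCotangent ⟨f - algebraMap ℂ O (ε f), hmem f⟩
      map_add' := fun f g ↦ by
        rw [← map_add]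
        congr 1
        ext
        simp only [map_add, AddMemClass.mk_add_mk]
        ring
      map_smul' := fun c f ↦ by
        rw [RingHom.id_apply, ← algebraMap_smul O c (Ideal.toCotangent _ _), ← map_smul]
        congr 1
        ext
        simp only [Algebra.smul_def, SetLike.mk_smul_mk, map_mul, AlgHom.commutes,
          Algebra.algebraMap_self, RingHom.id_apply]
        ring } (fun f g ↦ by
    simp only [LinearMap.coe_mk, AddHom.coe_mk]
    rw [← map_smul, ← map_smul, ← map_add, ← sub_eq_zero, ← map_sub, Ideal.toCotangent_eq_zero]
    have : ((f * g - algebraMap ℂ O (ε (f * g))) - (f * (g - algebraMap ℂ O (ε g)) +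
        g * (f - algebraMap ℂ O (ε f)))) =
        - ((f - algebraMap ℂ O (ε f)) * (g - algebraMap ℂ O (ε g))) := by
      rw [map_mul, map_mul]; ring
    change ((f * g - algebraMap ℂ O (ε (f * g))) - (f * (g - algebraMap ℂ O (ε g)) +
        g * (f - algebraMap ℂ O (ε f)))) ∈ _
    rw [this, sq]
    exact neg_mem (Ideal.mul_mem_mul (hmem f) (hmem g)))

/-- Differentials of functions in the maximal ideal generate `Ω`, so two of them form a basis. Their
functions are the coordinates and the dual basis gives the partial derivatives. -/
lemma exists_localCoord [IsNoetherianRing O] (ε : O →ₐ[ℂ] ℂ) (e : Ω[O⁄ℂ] ≃ₗ[O] (Fin 2 → O)) :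
    Nonempty (LocalCoord O) := by
  let S : Set (Fin 2 → O) := {v | ∃ f ∈ IsLocalRing.maximalIdeal O,
    e (KaehlerDifferential.D ℂ O f) = v}
  have hS : Submodule.span O S = ⊤ := by
    rw [eq_top_iff, ← LinearEquiv.range e, LinearMap.range_eq_map,
      ← KaehlerDifferential.span_range_derivation, Submodule.map_span, Submodule.span_le]
    rintro _ ⟨_, ⟨f, rfl⟩, rfl⟩
    -- Subtracting the value at the point does not change the differential.
    refine Submodule.subset_span ⟨f - algebraMap ℂ O (ε f), ?_, ?_⟩
    · rw [mem_maximalIdeal_iff_eval ε]; simp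
    · simp
  obtain ⟨_, ⟨s, hs, rfl⟩, _, ⟨t, ht, rfl⟩, hu⟩ := exists_isUnit_minor hS
  set v := e (KaehlerDifferential.D ℂ O s) with hv
  set w := e (KaehlerDifferential.D ℂ O t) with hw
  obtain ⟨u, hu⟩ := hu
  let a : (Fin 2 → O) →ₗ[O] O :=
    ((u⁻¹ : Oˣ) : O) • (w 1 • LinearMap.proj 0 - w 0 • LinearMap.proj 1)
  let b : (Fin 2 → O) →ₗ[O] O :=
    ((u⁻¹ : Oˣ) : O) • (v 0 • LinearMap.proj 1 - v 1 • LinearMap.proj 0)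
  have hui : ((u⁻¹ : Oˣ) : O) * (v 0 * w 1 - v 1 * w 0) = 1 := by rw [← hu]; simp
  have hab : ∀ p : Fin 2 → O, p = a p • v + b p • w := by
    intro p
    ext i
    simp only [a, b, LinearMap.smul_apply, LinearMap.sub_apply, LinearMap.proj_apply, Pi.add_apply,
      Pi.smul_apply, smul_eq_mul]
    revert i
    rw [Fin.forall_fin_two]
    constructor
    · linear_combination (- p 0) * hui
    · linear_combination (- p 1) * hui
  let ds : Derivation ℂ O O := (a ∘ₗ e.toLinearMap).compDer (KaehlerDifferential.D ℂ O)
  let dt : Derivation ℂ O O := (b ∘ₗ e.toLinearMap).compDer (KaehlerDifferential.D ℂ O)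
  have hds (f) : ds f = a (e (KaehlerDifferential.D ℂ O f)) := rfl
  have hdt (f) : dt f = b (e (KaehlerDifferential.D ℂ O f)) := rfl
  have chain {N : Type} [AddCommGroup N] [Module ℂ N] [Module O N] [IsScalarTower ℂ O N]
      (D : Derivation ℂ O N) (f : O) : D f = ds f • D s + dt f • D t := by
    have h1 : KaehlerDifferential.D ℂ O f = ds f • KaehlerDifferential.D ℂ O s +
        dt f • KaehlerDifferential.D ℂ O t := by
      apply e.injective
      rw [map_add, map_smul, map_smul, ← hv, ← hw]
      exact hab _
    have h2 := congrArg D.liftKaehlerDifferential h1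
    simpa only [map_add, map_smul, Derivation.liftKaehlerDifferential_comp_D] using h2
  have hst : Ideal.span {s, t} ≤ IsLocalRing.maximalIdeal O := by
    rw [Ideal.span_le]
    rintro _ (rfl | rfl)
    exacts [hs, ht]
  have hds_s : ds s = 1 := by
    simp only [hds, ← hv, a, LinearMap.smul_apply, LinearMap.sub_apply, LinearMap.proj_apply,
      smul_eq_mul]
    linear_combination hui
  have hds_t : ds t = 0 := by
    simp only [hds, ← hw, a, LinearMap.smul_apply, LinearMap.sub_apply, LinearMap.proj_apply,
      smul_eq_mul]
    ring
  have hdt_s : dt s = 0 := by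
    simp only [hdt, ← hv, b, LinearMap.smul_apply, LinearMap.sub_apply, LinearMap.proj_apply,
      smul_eq_mul]
    ring
  have hdt_t : dt t = 1 := by
    simp only [hdt, ← hw, b, LinearMap.smul_apply, LinearMap.sub_apply, LinearMap.proj_apply,
      smul_eq_mul]
    linear_combination hui
  refine ⟨⟨s, t, ds, dt, ε, ?_, hds_s, hds_t, hdt_s, hdt_t⟩⟩
  refine le_antisymm ?_ hst
  -- By Nakayama, it suffices to generate the maximal ideal modulo its square.
  refine Submodule.le_of_le_smul_of_le_jacobson_bot (I := IsLocalRing.maximalIdeal O)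
    (IsNoetherian.noetherian _) (IsLocalRing.maximalIdeal_le_jacobson _) ?_
  intro f hf
  -- The first-order Taylor remainder: both partial derivatives vanish at the point, so by the chain
  -- rule its class in the cotangent space is zero.
  let g := f - (algebraMap ℂ O (ε (ds f)) * s + algebraMap ℂ O (ε (dt f)) * t)
  have h1 : algebraMap ℂ O (ε (ds f)) * s + algebraMap ℂ O (ε (dt f)) * t ∈
      Ideal.span {s, t} := Ideal.mem_span_pair.mpr ⟨_, _, rfl⟩
  have hg : g ∈ IsLocalRing.maximalIdeal O := sub_mem hf (hst h1)
  have hg2 : g ∈ IsLocalRing.maximalIdeal O ^ 2 := by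
    rw [mem_maximalIdeal_iff_eval ε] at hg hs ht
    have h0 : cotangentDer ε g = 0 := by
      have hz : ∀ c ∈ IsLocalRing.maximalIdeal O,
          ∀ p : (IsLocalRing.maximalIdeal O).Cotangent, c • p = 0 := by
        intro c hc p
        obtain ⟨p, rfl⟩ := Ideal.toCotangent_surjective _ p
        rw [← map_smul, Ideal.toCotangent_eq_zero, sq]
        exact Ideal.mul_mem_mul hc p.2
      rw [chain (cotangentDer ε) g, hz _ _, hz _ _, add_zero]
      all_goals
          rw [mem_maximalIdeal_iff_eval ε]
          simp only [g, map_sub, map_add, Derivation.leibniz, Derivation.map_algebraMap, hds_s,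
            hds_t, hdt_s, hdt_t, smul_eq_mul, map_mul, map_zero, map_one, AlgHom.commutes,
            Algebra.algebraMap_self, RingHom.id_apply]
          ring
    have h1 : cotangentDer ε g = (IsLocalRing.maximalIdeal O).toCotangent
      ⟨g, (mem_maximalIdeal_iff_eval ε g).mpr hg⟩ := by
      change (IsLocalRing.maximalIdeal O).toCotangent ⟨g - algebraMap ℂ O (ε g), _⟩ = _
      congr 1
      ext
      simp [hg]
    rw [h1, Ideal.toCotangent_eq_zero] at h0
    exact h0
  rw [smul_eq_mul, ← sq]
  have : f = (algebraMap ℂ O (ε (ds f)) * s + algebraMap ℂ O (ε (dt f)) * t) + g := by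
    simp [g]
  rw [this]
  exact Submodule.add_mem_sup h1 hg2

end LocalCoordinates

end DerBlowup

namespace DerBlowup

/-! ### Factoriality of the local ring at a point of a smooth surface -/

section Factoriality

variable {O : Type} [CommRing O] [IsLocalRing O] [Algebra ℂ O] (c : LocalCoord O)

include c

lemma LocalCoord.s_mem : c.s ∈ IsLocalRing.maximalIdeal O := by
  rw [c.max_eq]; exact Ideal.subset_span (by simp)

lemma LocalCoord.t_mem : c.t ∈ IsLocalRing.maximalIdeal O := by
  rw [c.max_eq]; exact Ideal.subset_span (by simp)

/-- Applying `∂/∂s` to `s^(k+1) = tg` gives `(k+1)s^k = t·∂g/∂s`, and `k+1` is invertible: descent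
on the exponent. -/
lemma LocalCoord.not_dvd_pow (k : ℕ) : ¬ c.t ∣ c.s ^ k := by
  induction k with
  | zero =>
    rw [pow_zero]
    exact fun h ↦ (IsLocalRing.mem_maximalIdeal _).mp c.t_mem (isUnit_of_dvd_one h)
  | succ k ih =>
    rintro ⟨g, hg⟩
    have h := congrArg c.ds hg
    rw [Derivation.leibniz_pow, Derivation.leibniz, c.ds_s, c.ds_t] at h
    simp only [add_tsub_cancel_right, smul_eq_mul, mul_one, mul_zero, add_zero, nsmul_eq_mul] at h
    refine ih ?_
    have hu := natCast_add_one_isUnit (A := O) k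
    rw [← hu.dvd_mul_left (a := c.t)]
    exact ⟨c.ds g, by rw [← h]; push_cast; ring⟩

/-- Modulo `t` the ring behaves as a discrete valuation ring with uniformizer `s`; `k` is the order
of `f` there. -/
lemma LocalCoord.exists_eq_of_not_dvd [IsNoetherianRing O] {f : O} (hf : ¬ c.t ∣ f) :
    ∃ (k : ℕ) (a g : O), IsUnit a ∧ f = a * c.s ^ k + c.t * g := by
  classical
  have hex : ∃ k : ℕ, ¬ (f ∈ Ideal.span {c.s ^ k, c.t}) := by
    by_contra! H
    let J : Ideal O := Ideal.span {c.t}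
    have hJ : J ≠ ⊤ := fun h ↦ (IsLocalRing.mem_maximalIdeal _).mp c.t_mem
      (Ideal.span_singleton_eq_top.mp h)
    haveI : Nontrivial (O ⧸ J) := Ideal.Quotient.nontrivial_iff.mpr hJ
    haveI : IsLocalRing (O ⧸ J) :=
      IsLocalRing.of_surjective' (Ideal.Quotient.mk J) Ideal.Quotient.mk_surjective
    let I : Ideal (O ⧸ J) := Ideal.span {Ideal.Quotient.mk J c.s}
    have hI : I ≠ ⊤ := by
      intro h
      have h1 : (1 : O ⧸ J) ∈ I := h ▸ Submodule.mem_top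
      obtain ⟨a, ha⟩ := Ideal.mem_span_singleton.mp h1
      obtain ⟨a, rfl⟩ := Ideal.Quotient.mk_surjective a
      rw [← map_mul, ← map_one (Ideal.Quotient.mk J), Ideal.Quotient.eq] at ha
      have h2 : J ≤ IsLocalRing.maximalIdeal O := by
        rw [Ideal.span_singleton_le_iff_mem]; exact c.t_mem
      have h3 : (1 : O) ∈ IsLocalRing.maximalIdeal O := by
        have := add_mem (h2 ha) (Ideal.mul_mem_right a _ c.s_mem)
        simpa using this
      exact (IsLocalRing.mem_maximalIdeal _).mp h3 isUnit_one
    have h0 : Ideal.Quotient.mk J f ∈ ⨅ i : ℕ, I ^ i := by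
      rw [Submodule.mem_iInf]
      intro i
      obtain ⟨a, b, hab⟩ := Ideal.mem_span_pair.mp (H i)
      rw [Ideal.span_singleton_pow, Ideal.mem_span_singleton]
      refine ⟨Ideal.Quotient.mk J a, ?_⟩
      rw [← map_pow, ← map_mul, Ideal.Quotient.eq, Ideal.mem_span_singleton, ← hab]
      exact ⟨b, by ring⟩
    -- Krull's intersection theorem in `O/t`: infinite order along `s` would mean `t ∣ f`.
    rw [Ideal.iInf_pow_eq_bot_of_isLocalRing _ hI, Submodule.mem_bot,
      Ideal.Quotient.eq_zero_iff_mem, Ideal.mem_span_singleton] at h0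
    exact hf h0
  obtain ⟨k, hk⟩ : ∃ k, Nat.find hex = k + 1 := by
    refine Nat.exists_eq_succ_of_ne_zero fun h ↦ ?_
    have := Nat.find_spec hex
    rw [h, pow_zero] at this
    exact this (Ideal.mem_span_pair.mpr ⟨f, 0, by ring⟩)
  have h1 : f ∈ Ideal.span {c.s ^ k, c.t} := by
    by_contra h
    have := Nat.find_min' hex h
    omega
  obtain ⟨a, g, hag⟩ := Ideal.mem_span_pair.mp h1
  refine ⟨k, a, g, ?_, by rw [← hag]; ring⟩
  -- A non-unit coefficient lies in `(s, t)`, which would push `f` into `(s^(k+1), t)` against the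
  -- choice of `k`.
  by_contra ha
  have ha' : a ∈ IsLocalRing.maximalIdeal O := ha
  rw [c.max_eq] at ha'
  obtain ⟨u, v, huv⟩ := Ideal.mem_span_pair.mp ha'
  have h2 := Nat.find_spec hex
  rw [hk] at h2
  refine h2 (Ideal.mem_span_pair.mpr ⟨u, v * c.s ^ k + g, ?_⟩)
  rw [← hag, ← huv]; ring

variable [IsDomain O] [IsNoetherianRing O]

/-- Two elements not divisible by `t` have the form unit times a power of `s` modulo `t`, and so
does their product. -/
lemma LocalCoord.prime_t : Prime c.t := by
  refine ⟨fun h ↦ ?_, (IsLocalRing.mem_maximalIdeal _).mp c.t_mem, fun f g hfg ↦ ?_⟩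
  · have := c.dt_t
    rw [h, map_zero] at this
    exact zero_ne_one this
  · by_contra! H
    obtain ⟨k, a, f', ha, rfl⟩ := c.exists_eq_of_not_dvd H.1
    obtain ⟨l, b, g', hb, rfl⟩ := c.exists_eq_of_not_dvd H.2
    refine c.not_dvd_pow (k + l) ?_
    rw [← (ha.mul hb).dvd_mul_left (a := c.t)]
    obtain ⟨e, he⟩ := hfg
    exact ⟨e - (a * c.s ^ k * g' + b * c.s ^ l * f' + c.t * f' * g'), by
      rw [mul_sub, ← he]; ring⟩

/-- Smooth surfaces are locally factorial. -/
theorem LocalCoord.uniqueFactorizationMonoid : UniqueFactorizationMonoid O := by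
  classical
  -- Kaplansky's criterion. A nonzero prime `q` without `t` turns out to be generated by an element
  -- of least order along `s` modulo `t`.
  rw [UniqueFactorizationMonoid.iff_exists_prime_mem_of_isPrime]
  intro q hq hq'
  by_cases ht : c.t ∈ q
  · exact ⟨_, ht, c.prime_t⟩
  have hmul : ∀ g, c.t * g ∈ q → g ∈ q := fun g hg ↦ (hq'.mem_or_mem hg).resolve_left ht
  have hJ : Ideal.span {c.t} ≤ (⊥ : Ideal O).jacobson := by
    refine le_trans ?_ (IsLocalRing.maximalIdeal_le_jacobson _)
    rw [Ideal.span_singleton_le_iff_mem]; exact c.t_mem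
  have hex : ∃ k : ℕ, ∃ a g : O, IsUnit a ∧ a * c.s ^ k + c.t * g ∈ q := by
    by_contra! H
    apply hq
    rw [eq_bot_iff]
    refine Submodule.le_of_le_smul_of_le_jacobson_bot (IsNoetherian.noetherian q) hJ ?_
    intro f hf
    rw [bot_sup_eq]
    by_cases hd : c.t ∣ f
    · obtain ⟨g, rfl⟩ := hd
      exact Ideal.mul_mem_mul (Ideal.mem_span_singleton_self _) (hmul g hf)
    · obtain ⟨k, a, g, ha, rfl⟩ := c.exists_eq_of_not_dvd hd
      exact absurd hf (H k a g ha)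
  obtain ⟨a, g, ha, hf⟩ := Nat.find_spec hex
  set k := Nat.find hex with hk
  set f := a * c.s ^ k + c.t * g with hfdef
  -- Any element of `q` minus a suitable multiple of `f` is `t` times an element of `q`, so `q ≤ (f)
  -- + tq` and Nakayama applies.
  have hle : q ≤ Ideal.span {f} := by
    refine Submodule.le_of_le_smul_of_le_jacobson_bot (IsNoetherian.noetherian q) hJ ?_
    intro h hh
    by_cases hd : c.t ∣ h
    · obtain ⟨h, rfl⟩ := hd
      exact Submodule.mem_sup_right
        (Ideal.mul_mem_mul (Ideal.mem_span_singleton_self _) (hmul h hh))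
    · obtain ⟨l, b, g', hb, rfl⟩ := c.exists_eq_of_not_dvd hd
      have hkl : k ≤ l := Nat.find_min' hex ⟨b, g', hb, hh⟩
      obtain ⟨u, rfl⟩ := ha
      have h1 : b * c.s ^ l + c.t * g' = b * (u⁻¹ : Oˣ) * c.s ^ (l - k) * f +
          c.t * (g' - b * (u⁻¹ : Oˣ) * c.s ^ (l - k) * g) := by
        rw [hfdef, show c.s ^ l = c.s ^ (l - k) * c.s ^ k by rw [← pow_add]; congr 1; omega]
        have : (u : O) * (u⁻¹ : Oˣ) = 1 := by simp
        linear_combination (-b * c.s ^ (l - k) * c.s ^ k) * this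
      have h2 : c.t * (g' - b * (u⁻¹ : Oˣ) * c.s ^ (l - k) * g) ∈ q := by
        have := sub_mem hh (Ideal.mul_mem_left q (b * (u⁻¹ : Oˣ) * c.s ^ (l - k)) hf)
        rw [h1] at this
        simpa using this
      rw [h1]
      exact add_mem (Submodule.mem_sup_left (Ideal.mul_mem_left _ _
        (Ideal.mem_span_singleton_self _)))
        (Submodule.mem_sup_right (Ideal.mul_mem_mul (Ideal.mem_span_singleton_self _) (hmul _ h2)))
  have heq : q = Ideal.span {f} :=
    le_antisymm hle (by rwa [Ideal.span_singleton_le_iff_mem])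
  have hf0 : f ≠ 0 := by
    intro h0
    rw [h0, Ideal.span_singleton_eq_bot.mpr rfl] at heq
    exact hq heq
  exact ⟨f, hf, (Ideal.span_singleton_prime hf0).mp (heq ▸ hq')⟩

end Factoriality

/-- The Jacobian of `x, y` is divisible by `x` if every prime divisor of `x` divides `y`. -/
lemma dvd_jacobian {O : Type} [CommRing O] [IsDomain O] [UniqueFactorizationMonoid O] [Algebra ℂ O]
    (D E : Derivation ℂ O O) (x y : O) (h : ∀ q, Prime q → q ∣ x → q ∣ y) :
    x ∣ D x * E y - E x * D y := by
  induction x using UniqueFactorizationMonoid.induction_on_coprime with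
  | h0 => simp
  | h1 hx => exact hx.dvd
  | @hpr p i hp =>
    rcases i with _ | i
    · simp
    obtain ⟨d, rfl⟩ := h p hp (dvd_pow_self _ (Nat.succ_ne_zero i))
    -- On a prime power, the Jacobian of `p^(i+1), pd` is `(i+1) p^(i+1)` times that of `p, d`.
    refine ⟨(i + 1 : ℕ) * (D p * E d - E p * D d), ?_⟩
    simp only [Derivation.leibniz_pow, Derivation.leibniz, smul_eq_mul, nsmul_eq_mul,
      add_tsub_cancel_right]
    ring
  | @hcp a b hab ha hb =>
    have h1 := ha fun q hq hqa ↦ h q hq (hqa.mul_right b)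
    have h2 := hb fun q hq hqa ↦ h q hq (hqa.mul_left a)
    refine hab.mul_dvd ?_ ?_
    all_goals
      have : D (a * b) * E y - E (a * b) * D y =
        b * (D a * E y - E a * D y) + a * (D b * E y - E b * D y) := by
          simp only [Derivation.leibniz, smul_eq_mul]; ring
      rw [this]
    · exact dvd_add (h1.mul_left _) (dvd_mul_right _ _)
    · exact dvd_add (dvd_mul_right _ _) (h2.mul_left _)

/-- If neither `w` nor `w⁻¹` belongs to the local factorial domain `O`, then the residue of `w` in
`O[w] / 𝔪 O[w]` is transcendental. -/
lemma map_eq_zero_of_aeval_eq_zero {O K k : Type} [CommRing O] [IsDomain O] [IsLocalRing O]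
    [UniqueFactorizationMonoid O] [Field K] [Algebra O K] [IsFractionRing O K] [CommRing k]
    (ε : O →+* k) (hε : ∀ f ∈ IsLocalRing.maximalIdeal O, ε f = 0) {w : K}
    (hnum : ¬ IsUnit (IsFractionRing.num O w)) (hden : ¬ IsUnit (IsFractionRing.den O w : O))
    (F : Polynomial O) (hF : Polynomial.aeval w F = 0) : F.map ε = 0 := by
  induction hd : F.natDegree using Nat.strong_induction_on generalizing F with
  | _ d ih =>
  by_cases h0 : F = 0
  · simp [h0]
  set a := IsFractionRing.num O w
  set b := (IsFractionRing.den O w : O) with hb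
  have hw : w ≠ 0 := by
    rintro rfl
    exact hden (IsFractionRing.isUnit_den_zero)
  have hab : algebraMap O K a = w * algebraMap O K b := by
    have := IsFractionRing.mk'_num_den' O w
    rw [div_eq_iff] at this
    · exact this
    · simp
  obtain ⟨g, hg⟩ : a ∣ F.coeff 0 := num_dvd_of_is_root hF
  have ha : ε a = 0 := hε a hnum
  have hb0 : ε b = 0 := hε b hden
  have hdiv := Polynomial.divX_mul_X_add F
  -- The constant term is `a*g = w*b*g`, so one factor `w` cancels from `F(w) = 0`. Since `a` and
  -- `b` both reduce to zero, this replaces the reduction of `F` by a quotient of it by the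
  -- variable, and the degree drops.
  have h1 : Polynomial.aeval w (F.divX + Polynomial.C (b * g)) = 0 := by
    have h2 : Polynomial.aeval w (F.divX) * w + algebraMap O K (F.coeff 0) = 0 := by
      rw [← hF]
      conv_rhs => rw [← hdiv]
      simp
    rw [hg, map_mul, hab] at h2
    have h3 : w * (Polynomial.aeval w (F.divX + Polynomial.C (b * g))) = 0 := by
      rw [map_add, Polynomial.aeval_C, map_mul, ← h2]; ring
    exact (mul_eq_zero.mp h3).resolve_left hw
  have hmap : F.map ε = (F.divX + Polynomial.C (b * g)).map ε * Polynomial.X := by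
    conv_lhs => rw [← hdiv]
    simp [hg, ha, hb0]
  rw [hmap]
  by_cases hz : F.natDegree = 0
  · have h4 : F.divX = 0 := by
      rw [Polynomial.eq_C_of_natDegree_eq_zero hz, Polynomial.divX_C]
    simp [h4, hb0]
  rw [ih _ _ _ h1 rfl, zero_mul]
  rw [Polynomial.natDegree_add_C, Polynomial.natDegree_divX_eq_natDegree_tsub_one]
  omega

end DerBlowup

namespace DerBlowup

/-! ### The discrepancy argument -/

section Domination

lemma X_one_dvd_of_aeval_eq_zero {p : MvPolynomial (Fin 2) ℂ}
    (hp : MvPolynomial.aeval ![(Polynomial.X : Polynomial ℂ), 0] p = 0) :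
    MvPolynomial.X 1 ∣ p := by
  have h1 : ∀ p : MvPolynomial (Fin 2) ℂ, MvPolynomial.X 1 ∣
      p - Polynomial.aeval (MvPolynomial.X 0 : MvPolynomial (Fin 2) ℂ)
        (MvPolynomial.aeval ![(Polynomial.X : Polynomial ℂ), 0] p) := by
    intro p
    induction p using MvPolynomial.induction_on with
    | C a => simp [MvPolynomial.algebraMap_eq]
    | add p q hp hq =>
      rw [map_add, map_add, add_sub_add_comm]
      exact dvd_add hp hq
    | mul_X p i hp =>
      revert i
      rw [Fin.forall_fin_two]
      constructor
      · rw [map_mul, map_mul]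
        simp only [MvPolynomial.aeval_X, Matrix.cons_val_zero, Polynomial.aeval_X]
        rw [← sub_mul]
        exact hp.mul_right _
      · simp
  simpa [hp] using h1 p

lemma exists_eq_pow_mul_of_ne_zero {p : MvPolynomial (Fin 2) ℂ} (hp : p ≠ 0) :
    ∃ (i : ℕ) (p' : MvPolynomial (Fin 2) ℂ),
      MvPolynomial.aeval ![(Polynomial.X : Polynomial ℂ), 0] p' ≠ 0 ∧
        p = MvPolynomial.X 1 ^ i * p' := by
  obtain ⟨i, p', h1, h2⟩ := WfDvdMonoid.max_power_factor hp
    (MvPolynomial.X_prime (R := ℂ) (i := (1 : Fin 2))).irreducible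
  exact ⟨i, p', fun h ↦ h1 (X_one_dvd_of_aeval_eq_zero h), h2⟩

/-- Let `O` be the local ring of a smooth surface, and let `x, y` generate its function field. If
every prime divisor of `x` divides `y`, then one of `x, y` divides the other. -/
theorem dvd_or_dvd_of_localCoord {O : Type} [CommRing O] [IsDomain O] [IsLocalRing O]
    [IsNoetherianRing O] [Algebra ℂ O] (c : LocalCoord O) (x y : O)
    (hxy : ∀ q, Prime q → q ∣ x → q ∣ y)
    (hgen : ∀ f : O, ∃ p q : MvPolynomial (Fin 2) ℂ, MvPolynomial.aeval ![x, y] q ≠ 0 ∧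
      MvPolynomial.aeval ![x, y] q * f = MvPolynomial.aeval ![x, y] p) :
    x ∣ y ∨ y ∣ x := by
  haveI := c.uniqueFactorizationMonoid
  by_contra! H
  obtain ⟨hx, hy⟩ := H
  have hy0 : y ≠ 0 := by rintro rfl; exact hx (dvd_zero _)
  let K := FractionRing O
  have hinj : Function.Injective (algebraMap O K) := IsFractionRing.injective O K
  let w : K := algebraMap O K x / algebraMap O K y
  have hyK : algebraMap O K y ≠ 0 := by simpa using hy0
  have hwy : w * algebraMap O K y = algebraMap O K x := div_mul_cancel₀ _ hyK
  have hab : algebraMap O K (IsFractionRing.num O w) =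
      w * algebraMap O K (IsFractionRing.den O w) := by
    have := IsFractionRing.mk'_num_den' O w
    rw [div_eq_iff] at this
    · exact this
    · simp
  have hcross : x * (IsFractionRing.den O w) = y * IsFractionRing.num O w := by
    apply hinj
    rw [map_mul, map_mul, hab, ← hwy]; ring
  have hnum : ¬ IsUnit (IsFractionRing.num O w) := fun hu ↦
    hx (by rw [← hu.dvd_mul_right, ← hcross]; exact dvd_mul_right _ _)
  have hden : ¬ IsUnit (IsFractionRing.den O w : O) := fun hu ↦
    hy (by rw [← hu.dvd_mul_right, hcross]; exact dvd_mul_right _ _)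
  have hcm (f : O) (hf : f ∈ IsLocalRing.maximalIdeal O) : c.eval f = 0 :=
    (mem_maximalIdeal_iff_eval c.eval f).mp hf
  have hyu : c.eval y = 0 := hcm y fun hu ↦ hy (hu.dvd)
  have hres (F : Polynomial O) (hF : Polynomial.aeval w F = 0) :
      F.map (c.eval : O →+* ℂ) = 0 :=
    map_eq_zero_of_aeval_eq_zero (c.eval : O →+* ℂ) hcm hnum hden F hF
  -- `θ` evaluates polynomials at `(w, y)`, `Θ` keeps the first variable free over `O`, and `ρ`
  -- restricts to the curve `y = 0`.
  let θ : MvPolynomial (Fin 2) ℂ →ₐ[ℂ] K := MvPolynomial.aeval ![w, algebraMap O K y]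
  let Θ : MvPolynomial (Fin 2) ℂ →ₐ[ℂ] Polynomial O := MvPolynomial.aeval ![Polynomial.X, Polynomial.C y]
  let ρ : MvPolynomial (Fin 2) ℂ →ₐ[ℂ] Polynomial ℂ := MvPolynomial.aeval ![Polynomial.X, 0]
  have hθX0 : θ (MvPolynomial.X 0) = w := by simp [θ]
  have hθX1 : θ (MvPolynomial.X 1) = algebraMap O K y := by simp [θ]
  have hΘ (p : MvPolynomial (Fin 2) ℂ) : Polynomial.aeval w (Θ p) = θ p := by
    have : ((Polynomial.aeval w).restrictScalars ℂ).comp Θ = θ := by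
      apply MvPolynomial.algHom_ext
      rw [Fin.forall_fin_two]
      simp [Θ, θ]
    exact DFunLike.congr_fun this p
  have hρ (p : MvPolynomial (Fin 2) ℂ) : (Θ p).map (c.eval : O →+* ℂ) = ρ p := by
    have : (Polynomial.mapAlgHom c.eval).comp Θ = ρ := by
      apply MvPolynomial.algHom_ext
      rw [Fin.forall_fin_two]
      simp [Θ, ρ, hyu]
    exact DFunLike.congr_fun this p
  -- By transcendence of the residue of `w`, identities in `K` restrict to the curve, where `f`
  -- becomes the constant `c.eval f`: the curve is contracted to the closed point.
  have hρ' (f : O) (p q : MvPolynomial (Fin 2) ℂ) (h : algebraMap O K f * θ q = θ p) :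
      Polynomial.C (c.eval f) * ρ q = ρ p := by
    rw [← sub_eq_zero, ← hρ, ← hρ, ← hres (Polynomial.C f * Θ q - Θ p)]
    · simp
    · rw [map_sub, map_mul, hΘ, hΘ, Polynomial.aeval_C, h, sub_self]
  have hθne (p : MvPolynomial (Fin 2) ℂ) (hp : ρ p ≠ 0) : θ p ≠ 0 := by
    intro h
    have h1 := hρ' 0 p 1 (by simp [h])
    rw [map_zero, map_zero, zero_mul] at h1
    exact hp h1.symm
  have hθinj : Function.Injective θ := by
    rw [injective_iff_map_eq_zero]
    intro p hp
    by_contra hp0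
    obtain ⟨i, p', hp', rfl⟩ := exists_eq_pow_mul_of_ne_zero hp0
    rw [map_mul, map_pow, hθX1] at hp
    exact mul_ne_zero (pow_ne_zero _ hyK) (hθne p' hp') hp
  have hxyθ (p : MvPolynomial (Fin 2) ℂ) : ∃ p' : MvPolynomial (Fin 2) ℂ, algebraMap O K (MvPolynomial.aeval ![x, y] p) = θ p' := by
    refine ⟨MvPolynomial.aeval ![MvPolynomial.X 0 * MvPolynomial.X 1, MvPolynomial.X 1] p, ?_⟩
    have : (IsScalarTower.toAlgHom ℂ O K).comp (MvPolynomial.aeval ![x, y]) =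
        θ.comp (MvPolynomial.aeval ![MvPolynomial.X 0 * MvPolynomial.X 1, MvPolynomial.X 1]) := by
      apply MvPolynomial.algHom_ext
      rw [Fin.forall_fin_two]
      simp [hθX0, hθX1, hwy]
    exact DFunLike.congr_fun this p
  -- elements of `O` as fractions whose denominators are prime to `y`
  have hfrac (f : O) : ∃ p q : MvPolynomial (Fin 2) ℂ, ρ q ≠ 0 ∧ algebraMap O K f * θ q = θ p := by
    by_cases hf : f = 0
    · exact ⟨0, 1, by simp, by simp [hf]⟩
    obtain ⟨p, q, hq, h⟩ := hgen f
    obtain ⟨q', hq'⟩ := hxyθ q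
    obtain ⟨p', hp'⟩ := hxyθ p
    have h1 : algebraMap O K f * θ q' = θ p' := by rw [← hq', ← hp', ← h, map_mul, mul_comm]
    have hq0 : q' ≠ 0 := by
      rintro rfl
      rw [map_zero, map_eq_zero_iff _ hinj] at hq'
      exact hq hq'
    have hp0 : p' ≠ 0 := by
      rintro rfl
      rw [map_zero, mul_eq_zero, map_eq_zero_iff _ hinj, map_eq_zero_iff _ hθinj] at h1
      exact h1.elim hf hq0
    obtain ⟨j, q'', hq'', rfl⟩ := exists_eq_pow_mul_of_ne_zero hq0
    obtain ⟨i, p'', hp'', rfl⟩ := exists_eq_pow_mul_of_ne_zero hp0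
    have hX1 : θ (MvPolynomial.X 1) ≠ 0 := by rwa [hθX1]
    rcases le_or_gt j i with hji | hji
    · refine ⟨MvPolynomial.X 1 ^ (i - j) * p'', q'', hq'', ?_⟩
      obtain ⟨k, rfl⟩ := Nat.exists_eq_add_of_le hji
      apply mul_left_cancel₀ (pow_ne_zero j hX1)
      simp only [map_mul, map_pow, add_tsub_cancel_left] at h1 ⊢
      linear_combination h1
    -- A pole of `f` along the curve would make the numerator vanish there.
    · exfalso
      obtain ⟨k, rfl⟩ := Nat.exists_eq_add_of_lt hji
      have h2 : algebraMap O K f * θ (MvPolynomial.X 1 ^ (k + 1) * q'') = θ p'' := by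
        apply mul_left_cancel₀ (pow_ne_zero i hX1)
        simp only [map_mul, map_pow] at h1 ⊢
        rw [← h1]; ring
      have h3 := hρ' f _ _ h2
      rw [map_mul, map_pow] at h3
      have : ρ (MvPolynomial.X 1) = 0 := by simp [ρ]
      rw [this, zero_pow (Nat.succ_ne_zero _), zero_mul, mul_zero] at h3
      exact hp'' h3.symm
  -- Functions vanishing at the closed point vanish along the curve, so a factor `y` splits off.
  have hfrac' (f : O) (hf : f ∈ IsLocalRing.maximalIdeal O) :
      ∃ p q : MvPolynomial (Fin 2) ℂ, ρ q ≠ 0 ∧ algebraMap O K f * θ q = algebraMap O K y * θ p := by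
    obtain ⟨p, q, hq, h⟩ := hfrac f
    have h1 := hρ' f p q h
    rw [hcm f hf, map_zero, zero_mul, eq_comm] at h1
    obtain ⟨p', rfl⟩ := X_one_dvd_of_aeval_eq_zero h1
    exact ⟨p', q, hq, by rw [h, map_mul, hθX1]⟩
  -- the partial derivatives of `K` with respect to `w` and `y`
  letI : Algebra (MvPolynomial (Fin 2) ℂ) K := θ.toAlgebra
  have hPK (p : MvPolynomial (Fin 2) ℂ) : algebraMap (MvPolynomial (Fin 2) ℂ) K p = θ p := rfl
  haveI : IsScalarTower ℂ (MvPolynomial (Fin 2) ℂ) K := .of_algebraMap_eq fun r ↦ by rw [hPK, AlgHom.commutes θ r]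
  haveI : FaithfulSMul (MvPolynomial (Fin 2) ℂ) K := (faithfulSMul_iff_algebraMap_injective (MvPolynomial (Fin 2) ℂ) K).mpr hθinj
  haveI : IsFractionRing (MvPolynomial (Fin 2) ℂ) K := by
    refine IsFractionRing.of_field (MvPolynomial (Fin 2) ℂ) K fun z ↦ ?_
    obtain ⟨f, g, hg, rfl⟩ := IsFractionRing.div_surjective (A := O) z
    have hgK : algebraMap O K g ≠ 0 := by simpa using nonZeroDivisors.ne_zero hg
    obtain ⟨p, q, hq, h⟩ := hfrac f
    obtain ⟨p', q', hq', h'⟩ := hfrac g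
    have h1 : θ p' ≠ 0 := by rw [← h']; exact mul_ne_zero hgK (hθne _ hq')
    refine ⟨p * q', q * p', ?_⟩
    rw [hPK, hPK, map_mul, map_mul, div_eq_div_iff hgK (mul_ne_zero (hθne _ hq) h1), ← h, ← h']
    ring
  haveI : Algebra.FormallyEtale (MvPolynomial (Fin 2) ℂ) K := Algebra.FormallyEtale.of_isLocalization (nonZeroDivisors (MvPolynomial (Fin 2) ℂ))
  obtain ⟨Dw, hDw⟩ := exists_derivation_extension (R := MvPolynomial (Fin 2) ℂ) (R' := K)
    ((Algebra.linearMap (MvPolynomial (Fin 2) ℂ) K).compDer (MvPolynomial.pderiv 0))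
  obtain ⟨Dy, hDy⟩ := exists_derivation_extension (R := MvPolynomial (Fin 2) ℂ) (R' := K)
    ((Algebra.linearMap (MvPolynomial (Fin 2) ℂ) K).compDer (MvPolynomial.pderiv 1))
  replace hDw (p : MvPolynomial (Fin 2) ℂ) : Dw (θ p) = θ (MvPolynomial.pderiv 0 p) := hDw p
  replace hDy (p : MvPolynomial (Fin 2) ℂ) : Dy (θ p) = θ (MvPolynomial.pderiv 1 p) := hDy p
  have chain (D : Derivation ℂ K K) (f : K) :
      D f = Dw f * D w + Dy f * D (algebraMap O K y) := by
    have : D = D w • Dw + D (algebraMap O K y) • Dy := by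
      apply derivation_ext_of_isLocalization (R := MvPolynomial (Fin 2) ℂ) (nonZeroDivisors (MvPolynomial (Fin 2) ℂ))
      intro p
      have h2 : (D.compAlgebraMap (MvPolynomial (Fin 2) ℂ)) = (D w • Dw + D (algebraMap O K y) • Dy).compAlgebraMap (MvPolynomial (Fin 2) ℂ) := by
        apply MvPolynomial.derivation_ext
        rw [Fin.forall_fin_two]
        have h3 (p : MvPolynomial (Fin 2) ℂ) : algebraMap (MvPolynomial (Fin 2) ℂ) K p = θ p := rfl
        constructor
        · simp only [Derivation.compAlgebraMap_apply, Derivation.add_apply, Derivation.smul_apply,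
            h3, hDw, hDy, MvPolynomial.pderiv_X]
          simp [hθX0]
        · simp only [Derivation.compAlgebraMap_apply, Derivation.add_apply, Derivation.smul_apply,
            h3, hDw, hDy, MvPolynomial.pderiv_X]
          simp [hθX1]
      exact DFunLike.congr_fun h2 p
    conv_lhs => rw [this]
    simp only [Derivation.add_apply, Derivation.smul_apply, smul_eq_mul]
    ring
  haveI : Algebra.FormallyEtale O K := Algebra.FormallyEtale.of_isLocalization (nonZeroDivisors O)
  let Ds : Derivation ℂ K K := derExtend O K (nonZeroDivisors O) c.ds
  let Dt : Derivation ℂ K K := derExtend O K (nonZeroDivisors O) c.dt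
  have hDs (f : O) : Ds (algebraMap O K f) = algebraMap O K (c.ds f) := derExtend_apply _ _ _
  have hDt (f : O) : Dt (algebraMap O K f) = algebraMap O K (c.dt f) := derExtend_apply _ _ _
  -- the local ring `{p / q | q prime to y}` is stable under `Dw`, `Dy`
  obtain ⟨a, b, hb, hsa⟩ := hfrac' c.s c.s_mem
  obtain ⟨a', b', hb', hsa'⟩ := hfrac' c.t c.t_mem
  obtain ⟨h, hh⟩ := dvd_jacobian c.ds c.dt x y hxy
  obtain ⟨p, q, hq, hpq⟩ := hfrac h
  have hDwy : Dw (algebraMap O K y) = 0 := by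
    rw [← hθX1, hDw, MvPolynomial.pderiv_X_of_ne (by decide), map_zero]
  have hDyy : Dy (algebraMap O K y) = 1 := by
    rw [← hθX1, hDy, MvPolynomial.pderiv_X_self, map_one]
  -- The quotient rule for `f = ya/b`: the derivative along `w` keeps the factor `y`, the one along
  -- `y` merely stays regular.
  have quot (f : O) (a b : MvPolynomial (Fin 2) ℂ)
      (hf : algebraMap O K f * θ b = algebraMap O K y * θ a) :
      ∃ A B : MvPolynomial (Fin 2) ℂ,
        Dw (algebraMap O K f) * θ (b ^ 2) = algebraMap O K y * θ A ∧
        Dy (algebraMap O K f) * θ (b ^ 2) = θ B := by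
    have h1 := congrArg Dw hf
    have h2 := congrArg Dy hf
    simp only [Derivation.leibniz, smul_eq_mul, hDw, hDy, hDwy, hDyy] at h1 h2
    refine ⟨MvPolynomial.pderiv 0 a * b - a * MvPolynomial.pderiv 0 b,
      MvPolynomial.X 1 * MvPolynomial.pderiv 1 a * b + a * b -
        MvPolynomial.X 1 * a * MvPolynomial.pderiv 1 b, ?_, ?_⟩
    · simp only [map_sub, map_mul, map_pow]
      linear_combination θ b * h1 - θ (MvPolynomial.pderiv 0 b) * hf
    · simp only [map_sub, map_add, map_mul, map_pow, hθX1]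
      linear_combination θ b * h2 - θ (MvPolynomial.pderiv 1 b) * hf
  obtain ⟨A, B, hA, hB⟩ := quot c.s a b hsa
  obtain ⟨A', B', hA', hB'⟩ := quot c.t a' b' hsa'
  have e1 := chain Ds (algebraMap O K c.s)
  have e2 := chain Ds (algebraMap O K c.t)
  have e3 := chain Dt (algebraMap O K c.s)
  have e4 := chain Dt (algebraMap O K c.t)
  rw [hDs, c.ds_s, map_one] at e1
  rw [hDs, c.ds_t, map_zero] at e2
  rw [hDt, c.dt_s, map_zero] at e3
  rw [hDt, c.dt_t, map_one] at e4
  have e5 := congrArg (algebraMap O K) hh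
  simp only [map_sub, map_mul, ← hDs, ← hDt, ← hwy, Derivation.leibniz, smul_eq_mul] at e5
  -- With `x = wy` the Jacobian of `(x, y)` is `y` times that of `(w, y)`, and it equals `xh = wyh`;
  -- cancel `y`.
  have e6 : Ds w * Dt (algebraMap O K y) - Dt w * Ds (algebraMap O K y) = w * algebraMap O K h := by
    apply mul_left_cancel₀ hyK
    linear_combination e5
  -- The Jacobians of `(s, t)` in `(w, y)` and of `(w, y)` in `(s, t)` are inverse to each other.
  have e7 : (Dw (algebraMap O K c.s) * Dy (algebraMap O K c.t) -
      Dw (algebraMap O K c.t) * Dy (algebraMap O K c.s)) * (w * algebraMap O K h) = 1 := by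
    rw [← e6]
    generalize Dw (algebraMap O K c.s) = s1 at *
    generalize Dw (algebraMap O K c.t) = t1 at *
    generalize Dy (algebraMap O K c.s) = s2 at *
    generalize Dy (algebraMap O K c.t) = t2 at *
    generalize Ds w = u1 at *
    generalize Dt w = v1 at *
    generalize Ds (algebraMap O K y) = u2 at *
    generalize Dt (algebraMap O K y) = v2 at *
    have : (s1 * t2 - t1 * s2) * (u1 * v2 - v1 * u2) =
      (s1 * u1 + s2 * u2) * (t1 * v1 + t2 * v2) - (t1 * u1 + t2 * u2) * (s1 * v1 + s2 * v2) := by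
      ring
    rw [this, ← e1, ← e2, ← e4]
    ring
  -- Denominators are cleared. The right side carries a factor `y`, the left side is prime to `y`;
  -- restriction to the curve gives the contradiction.
  have e8 : algebraMap O K 1 * θ (b ^ 2 * b' ^ 2 * q) =
      θ (MvPolynomial.X 1 * (A * B' - A' * B) * MvPolynomial.X 0 * p) := by
    simp only [map_mul, map_sub, hθX0, hθX1, ← hpq, ← hB, ← hB', map_one, one_mul] at hA hA' ⊢
    linear_combination (-θ (b ^ 2) * θ (b' ^ 2) * θ q) * e7 +
      (Dy (algebraMap O K c.t) * θ (b' ^ 2) * w * algebraMap O K h * θ q) * hA -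
      (Dy (algebraMap O K c.s) * θ (b ^ 2) * w * algebraMap O K h * θ q) * hA'
  have e9 := hρ' _ _ _ e8
  have hX1 : ρ (MvPolynomial.X 1) = 0 := by simp [ρ]
  rw [map_one, map_one, one_mul, map_mul ρ _ p, map_mul ρ _ (MvPolynomial.X 0),
    map_mul ρ (MvPolynomial.X 1), hX1, zero_mul, zero_mul, zero_mul, map_mul, map_mul, map_pow,
    map_pow] at e9
  exact mul_ne_zero (mul_ne_zero (pow_ne_zero 2 hb) (pow_ne_zero 2 hb')) hq e9

end Domination

end DerBlowup

namespace DerBlowup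

/-! ### Smooth surfaces birational to `A_m` -/

section SmoothSurface

instance (n : ℕ) : Algebra.FiniteType ℂ (AnR n) := .of_surjective (anMk n) (anMk_surjective n)

variable {B : Type} [CommRing B] [IsDomain B] [Algebra ℂ B] {m : ℕ} (φ : AnR m →ₐ[ℂ] B)

/-- `B` and `A_m` have the same fraction field, and the rank can be computed there. -/
lemma finrank_derivation_of_birational [Algebra.FiniteType ℂ B] (hφ : Function.Injective φ)
    (hgen : ∀ b : B, ∃ r s : AnR m, φ s ≠ 0 ∧ φ s * b = φ r) :
    Module.finrank B (Derivation ℂ B B) = 2 := by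
  let K := FractionRing B
  letI : Algebra (AnR m) B := φ.toRingHom.toAlgebra
  haveI : IsScalarTower ℂ (AnR m) B := .of_algebraMap_eq fun r ↦ (φ.commutes r).symm
  have hK (r : AnR m) : algebraMap (AnR m) K r = algebraMap B K (φ r) :=
    IsScalarTower.algebraMap_apply (AnR m) B K r
  haveI : IsScalarTower ℂ (AnR m) K := .of_algebraMap_eq fun r ↦ by
    rw [hK, φ.commutes, ← IsScalarTower.algebraMap_apply]
  have hinj : Function.Injective (algebraMap B K) := IsFractionRing.injective B K
  haveI : FaithfulSMul (AnR m) K :=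
    (faithfulSMul_iff_algebraMap_injective (AnR m) K).mpr (hinj.comp hφ)
  haveI : IsFractionRing (AnR m) K := by
    refine IsFractionRing.of_field (AnR m) K fun z ↦ ?_
    obtain ⟨f, g, hg, rfl⟩ := IsFractionRing.div_surjective (A := B) z
    have hgK : algebraMap B K g ≠ 0 := by simpa using nonZeroDivisors.ne_zero hg
    obtain ⟨p, q, hq, h⟩ := hgen f
    obtain ⟨p', q', hq', h'⟩ := hgen g
    have hq0 : algebraMap B K (φ q) ≠ 0 := (map_ne_zero_iff _ hinj).mpr hq
    have hq0' : algebraMap B K (φ q') ≠ 0 := (map_ne_zero_iff _ hinj).mpr hq'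
    have h1 : algebraMap B K (φ p') ≠ 0 := by
      rw [← h', map_mul]; exact mul_ne_zero hq0' hgK
    refine ⟨p * q', q * p', ?_⟩
    rw [hK, hK, map_mul, map_mul, map_mul, map_mul, div_eq_div_iff hgK (mul_ne_zero hq0 h1), ← h,
      ← h', map_mul, map_mul]
    ring
  rw [← finrank_derivation_of_isLocalization (R := B) (R' := K) (nonZeroDivisors B) le_rfl,
    finrank_derivation_of_isLocalization (R := AnR m) (R' := K) (nonZeroDivisors (AnR m)) le_rfl,
    finrank_anDer]

/-- At a closed point of a smooth surface there are local coordinates. -/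
lemma nonempty_localCoord [Algebra.Smooth ℂ B] (hB : Module.finrank B (Derivation ℂ B B) = 2)
    (n : Ideal B) [n.IsMaximal] (O : Type) [CommRing O] [IsLocalRing O] [Algebra ℂ O] [Algebra B O]
    [IsScalarTower ℂ B O] [IsLocalization.AtPrime O n] : Nonempty (LocalCoord O) := by
  haveI : IsNoetherianRing B := Algebra.FiniteType.isNoetherianRing ℂ B
  haveI : IsNoetherianRing O := IsLocalization.isNoetherianRing n.primeCompl O inferInstance
  haveI : Algebra.FormallySmooth B O := Algebra.FormallySmooth.of_isLocalization n.primeCompl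
  haveI : Algebra.FormallySmooth ℂ O := Algebra.FormallySmooth.comp ℂ B O
  haveI : Algebra.EssFiniteType B O := Algebra.EssFiniteType.of_isLocalization O n.primeCompl
  haveI : Algebra.EssFiniteType ℂ O := Algebra.EssFiniteType.comp ℂ B O
  haveI : Module.Free O Ω[O⁄ℂ] := Module.free_of_flat_of_isLocalRing
  have hle : n.primeCompl ≤ nonZeroDivisors B := n.primeCompl_le_nonZeroDivisors
  have hr : Module.finrank O (Derivation ℂ O O) = 2 := by
    rw [finrank_derivation_of_isLocalization (R := B) (R' := O) n.primeCompl hle, hB]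
  have hr' : Module.finrank O Ω[O⁄ℂ] = 2 := by
    rw [← hr, ← (KaehlerDifferential.linearMapEquivDerivation ℂ O).finrank_eq,
      Module.finrank_linearMap_self]
  letI := Ideal.Quotient.field n
  -- Nullstellensatz: the residue field is `ℂ`, which provides evaluation at the point.
  haveI : Module.Finite ℂ (B ⧸ n) := finite_of_finite_type_of_isJacobsonRing _ _
  let e0 : ℂ ≃ₐ[ℂ] B ⧸ n := AlgEquiv.ofBijective (Algebra.ofId ℂ (B ⧸ n))
    (IsAlgClosed.algebraMap_bijective_of_isIntegral)
  let ε0 : B →ₐ[ℂ] ℂ := (e0.symm : B ⧸ n →ₐ[ℂ] ℂ).comp (Ideal.Quotient.mkₐ ℂ n)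
  let ε : O →ₐ[ℂ] ℂ := IsLocalization.liftAlgHom (M := n.primeCompl) (f := ε0) (by
    intro b
    rw [isUnit_iff_ne_zero]
    intro h
    have h1 : Ideal.Quotient.mk n b = 0 := e0.symm.injective (by rw [map_zero]; exact h)
    exact b.2 (Ideal.Quotient.eq_zero_iff_mem.mp h1))
  exact exists_localCoord ε ((Module.finBasisOfFinrankEq O _ hr').equivFun)

/-- Let `Spec B → A_m` be a birational morphism from a smooth surface. Then the ideal `(x, y)`
becomes principal on `Spec B`. -/
theorem exists_mul_eq_of_smooth [Algebra.Smooth ℂ B] (hφ : Function.Injective φ)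
    (hgen : ∀ b : B, ∃ r s : AnR m, φ s ≠ 0 ∧ φ s * b = φ r) (p : Ideal B) [hp : p.IsPrime] :
    ∃ f ∉ p, ∃ c, f * φ (cy m) = φ (cx m) * c ∨ f * φ (cx m) = φ (cy m) * c := by
  -- The local coordinates need a closed point; divisibility at a specialization of `p` implies it
  -- at `p`.
  obtain ⟨n, hn, hpn⟩ := p.exists_le_maximal hp.ne_top
  let O := Localization.AtPrime n
  obtain ⟨c⟩ := nonempty_localCoord (finrank_derivation_of_birational φ hφ hgen) n O
  haveI : IsDomain O := IsLocalization.isDomain_localization n.primeCompl_le_nonZeroDivisors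
  haveI : IsNoetherianRing B := Algebra.FiniteType.isNoetherianRing ℂ B
  have hinj : Function.Injective (algebraMap B O) :=
    IsLocalization.injective O n.primeCompl_le_nonZeroDivisors
  have hpoly (r : AnR m) : ∃ (N : ℕ) (g : MvPolynomial (Fin 2) ℂ),
      algebraMap B O (φ (cx m)) ^ N * algebraMap B O (φ r) =
        MvPolynomial.aeval ![algebraMap B O (φ (cx m)), algebraMap B O (φ (cy m))] g := by
    obtain ⟨N, g, h⟩ := exists_cx_pow_mul_eq m r
    refine ⟨N, g, ?_⟩
    rw [← map_pow, ← map_pow, ← map_mul, ← map_mul, h]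
    have : ((IsScalarTower.toAlgHom ℂ B O).comp φ).comp (MvPolynomial.aeval ![cx m, cy m]) =
        MvPolynomial.aeval ![algebraMap B O (φ (cx m)), algebraMap B O (φ (cy m))] := by
      apply MvPolynomial.algHom_ext
      rw [Fin.forall_fin_two]
      simp
    exact DFunLike.congr_fun this g
  have hx0 : algebraMap B O (φ (cx m)) ≠ 0 :=
    (map_ne_zero_iff _ hinj).mpr ((map_ne_zero_iff _ hφ).mpr (cx_ne_zero m))
  have key := dvd_or_dvd_of_localCoord c (algebraMap B O (φ (cx m))) (algebraMap B O (φ (cy m)))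
    -- A prime dividing `x` divides `xz = y^(m+1)`.
    (fun q hq hqx ↦ hq.dvd_of_dvd_pow (n := m + 1) (by
      rw [← map_pow, ← map_pow, ← cx_mul_cz, map_mul, map_mul]
      exact hqx.mul_right _)) (fun f ↦ by
    obtain ⟨⟨b, s⟩, hs⟩ := IsLocalization.surj n.primeCompl f
    obtain ⟨r1, r2, hr2, h12⟩ := hgen b
    obtain ⟨r3, r4, hr4, h34⟩ := hgen s
    obtain ⟨N, g, hg⟩ := hpoly (r1 * r4)
    obtain ⟨N', g', hg'⟩ := hpoly (r2 * r3)
    have hs0 : algebraMap B O s ≠ 0 :=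
      (map_ne_zero_iff _ hinj).mpr fun h ↦ s.2 (by rw [h]; exact zero_mem _)
    refine ⟨MvPolynomial.X 0 ^ N' * g, MvPolynomial.X 0 ^ N * g', ?_, ?_⟩
    · rw [map_mul, ← hg', map_mul φ, ← h34]
      simp only [map_mul, map_pow, MvPolynomial.aeval_X, Matrix.cons_val_zero]
      exact mul_ne_zero (pow_ne_zero _ hx0) (mul_ne_zero (pow_ne_zero _ hx0) (mul_ne_zero
        ((map_ne_zero_iff _ hinj).mpr hr2) (mul_ne_zero ((map_ne_zero_iff _ hinj).mpr hr4) hs0)))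
    · rw [map_mul, map_mul, ← hg', ← hg, map_mul φ, map_mul φ, ← h34, ← h12]
      simp only [map_mul, map_pow, MvPolynomial.aeval_X, Matrix.cons_val_zero]
      simp only at hs
      rw [← hs]; ring)
  have conv {u v : B} (h : algebraMap B O u ∣ algebraMap B O v) : ∃ f ∉ p, ∃ c, f * v = u * c := by
    obtain ⟨g, hg⟩ := h
    obtain ⟨⟨b, s⟩, hs⟩ := IsLocalization.surj n.primeCompl g
    refine ⟨s, fun h ↦ s.2 (hpn h), b, hinj ?_⟩
    rw [map_mul, map_mul, ← hs, hg]; ring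
  rcases key with h | h
  · obtain ⟨f, hf, c, h⟩ := conv h
    exact ⟨f, hf, c, .inl h⟩
  · obtain ⟨f, hf, c, h⟩ := conv h
    exact ⟨f, hf, c, .inr h⟩

/-- The surface `A_m` is singular for `m ≥ 1`. -/
theorem not_smooth_anR (hm : 1 ≤ m) : ¬ Algebra.Smooth ℂ (AnR m) := by
  intro h
  haveI : (RingHom.ker (evalO m)).IsPrime := RingHom.ker_isPrime _
  obtain ⟨f, hf, c, h⟩ := exists_mul_eq_of_smooth (AlgHom.id ℂ (AnR m)) Function.injective_id
    (fun b ↦ ⟨b, 1, by simp, by simp⟩) (RingHom.ker (evalO m))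
  rw [RingHom.mem_ker] at hf
  rcases h with h | h
  -- Differentiating `fy = xc` at the origin in the `y` direction gives `f(0) = 0`. The other case
  -- uses the `x` direction.
  · have := congrArg (fun r ↦ (toDual hm 0 1 0 r).snd) h
    simp only [AlgHom.id_apply, snd_toDual_mul] at this
    simp [toDual, evalO_cx, evalO_cy, hf] at this
  · have := congrArg (fun r ↦ (toDual hm 1 0 0 r).snd) h
    simp only [AlgHom.id_apply, snd_toDual_mul] at this
    simp [toDual, evalO_cx, evalO_cy, hf] at this

end SmoothSurface

end DerBlowup

namespace DerBlowup

/-! ### Morphisms to affine schemes -/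

section Pull

variable {R S : Type} [CommRing R] [CommRing S] {W W' : Scheme.{0}}

/-- Pullback of functions along a morphism to an affine scheme. -/
def pull (τ : W ⟶ Spec (CommRingCat.of R)) : R →+* Γ(W, ⊤) :=
  ((Scheme.ΓSpecIso (CommRingCat.of R)).inv ≫ τ.appTop).hom

/-- The morphism to an affine scheme given by a homomorphism to the ring of global functions. -/
def ofPull (φ : R →+* Γ(W, ⊤)) : W ⟶ Spec (CommRingCat.of R) :=
  W.toSpecΓ ≫ Spec.map (CommRingCat.ofHom φ)

@[simp]
lemma pull_ofPull (φ : R →+* Γ(W, ⊤)) : pull (ofPull φ) = φ := by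
  have : (Scheme.ΓSpecIso (CommRingCat.of R)).inv ≫ (ofPull φ).appTop = CommRingCat.ofHom φ := by
    rw [ofPull, Scheme.Hom.comp_appTop, ← Scheme.ΓSpecIso_inv_naturality_assoc,
      Scheme.toSpecΓ_appTop, Iso.inv_hom_id, Category.comp_id]
  rw [pull, this]; rfl

lemma pull_injective {τ τ' : W ⟶ Spec (CommRingCat.of R)} (h : pull τ = pull τ') : τ = τ' := by
  have key (τ : W ⟶ Spec (CommRingCat.of R)) : ofPull (pull τ) = τ := by
    rw [ofPull, pull, CommRingCat.ofHom_hom, Spec.map_comp, ← Scheme.toSpecΓ_naturality_assoc,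
      toSpecΓ_SpecMap_ΓSpecIso_inv, Category.comp_id]
  rw [← key τ, h, key]

lemma pull_comp (h : W' ⟶ W) (τ : W ⟶ Spec (CommRingCat.of R)) (r : R) :
    pull (h ≫ τ) r = h.appTop.hom (pull τ r) := by
  rw [pull, Scheme.Hom.comp_appTop]; rfl

lemma pull_comp_specMap (τ : W ⟶ Spec (CommRingCat.of S)) (ψ : R →+* S) :
    pull (τ ≫ Spec.map (CommRingCat.ofHom ψ)) = (pull τ).comp ψ := by
  have : (Scheme.ΓSpecIso (CommRingCat.of R)).inv ≫
      (τ ≫ Spec.map (CommRingCat.ofHom ψ)).appTop =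
      CommRingCat.ofHom ψ ≫ (Scheme.ΓSpecIso (CommRingCat.of S)).inv ≫ τ.appTop := by
    rw [Scheme.Hom.comp_appTop, ← Scheme.ΓSpecIso_inv_naturality_assoc]
  rw [pull, this]; rfl

lemma mem_asIdeal_iff (τ : W ⟶ Spec (CommRingCat.of R)) (w : W) (r : R) :
    r ∉ (show PrimeSpectrum R from τ w).asIdeal ↔ w ∈ W.basicOpen (pull τ r) := by
  have h1 : W.basicOpen (pull τ r) = τ ⁻¹ᵁ (PrimeSpectrum.basicOpen r) := by
    rw [pull]
    change W.basicOpen (τ.appTop ((Scheme.ΓSpecIso (CommRingCat.of R)).inv r)) = _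
    rw [← Scheme.preimage_basicOpen_top]
    exact congrArg (τ ⁻¹ᵁ ·) (basicOpen_eq_of_affine (R := CommRingCat.of R) r)
  rw [h1]; rfl

lemma isUnit_pull_iff (τ : W ⟶ Spec (CommRingCat.of R)) (r : R) :
    IsUnit (pull τ r) ↔ ∀ w, r ∉ (show PrimeSpectrum R from τ w).asIdeal := by
  simp_rw [mem_asIdeal_iff]
  constructor
  · intro h w
    rw [Scheme.basicOpen_of_isUnit _ h]
    trivial
  · intro h
    refine RingedSpace.isUnit_of_isUnit_germ W.toRingedSpace ⊤ _ fun w hw ↦ ?_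
    exact (Scheme.mem_basicOpen _ _ w hw).mp (h w)

end Pull

/-! ### Gluing -/

section Gluing

open Limits

variable {U X Y Z : Scheme.{0}}

/-- A span of open immersions is locally directed, so its colimit is a gluing with open charts. -/
lemma exists_glue (i : U ⟶ X) (j : U ⟶ Y) [IsOpenImmersion i] [IsOpenImmersion j] :
    ∃ (P : Scheme.{0}) (inl : X ⟶ P) (inr : Y ⟶ P), IsOpenImmersion inl ∧ IsOpenImmersion inr ∧
      IsPushout i j inl inr ∧ (∀ p : P, (∃ x, inl x = p) ∨ ∃ y, inr y = p) ∧
      ∀ x y, inl x = inr y → ∃ u, i u = x ∧ j u = y := by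
  let F := span i j
  haveI hF : ∀ {a b : WalkingSpan} (f : a ⟶ b), IsOpenImmersion (F.map f) := by
    rintro a b (_ | ⟨_ | _⟩)
    · exact (F.map_id _).symm ▸ (inferInstance : IsOpenImmersion (𝟙 (F.obj a)))
    · exact ‹IsOpenImmersion i›
    · exact ‹IsOpenImmersion j›
  haveI : ∀ k, Mono ((F ⋙ Scheme.forget).map (WidePushoutShape.Hom.init k)) := by
    intro k
    rw [mono_iff_injective]
    exact (F.map (WidePushoutShape.Hom.init k)).isOpenEmbedding.injective
  haveI : (F ⋙ Scheme.forget).IsLocallyDirected :=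
    inferInstanceAs (Functor.IsLocallyDirected (J := WidePushoutShape WalkingPair) _)
  haveI : HasPushout i j := inferInstanceAs (HasColimit F)
  refine ⟨pushout i j, pushout.inl i j, pushout.inr i j,
    inferInstanceAs (IsOpenImmersion (colimit.ι F WalkingSpan.left)),
    inferInstanceAs (IsOpenImmersion (colimit.ι F WalkingSpan.right)),
    IsPushout.of_hasPushout i j, fun p ↦ ?_, fun x y h ↦ ?_⟩
  · obtain ⟨(_ | ⟨_ | _⟩), x, hx⟩ := Scheme.IsLocallyDirected.ι_jointly_surjective F p
    · left
      refine ⟨i x, ?_⟩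
      rw [← hx, ← colimit.w F WalkingSpan.Hom.fst]
      rfl
    · exact .inl ⟨x, hx⟩
    · exact .inr ⟨x, hx⟩
  · obtain ⟨k, f, g, u, h1, h2⟩ := (Scheme.IsLocallyDirected.ι_eq_ι_iff F
      (i := WalkingSpan.left) (j := WalkingSpan.right)).mp h
    rcases k with (_ | ⟨_ | _⟩)
    · obtain rfl : f = WalkingSpan.Hom.fst := Subsingleton.elim _ _
      obtain rfl : g = WalkingSpan.Hom.snd := Subsingleton.elim _ _
      exact ⟨u, h1, h2⟩
    · exact nomatch (g : WidePushoutShape.Hom _ _)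
    · exact nomatch (f : WidePushoutShape.Hom _ _)

/-- Uniqueness on every open piece makes the local lifts agree on overlaps. -/
lemma exists_lift_of_local (g : Y ⟶ X) (σ : Z ⟶ X)
    (hloc : ∀ z : Z, ∃ V : Z.Opens, z ∈ V ∧ ∃ β : (V : Scheme) ⟶ Y, β ≫ g = V.ι ≫ σ)
    (huniq : ∀ (W : Scheme.{0}) (i : W ⟶ Z) [IsOpenImmersion i] (β β' : W ⟶ Y),
      β ≫ g = i ≫ σ → β' ≫ g = i ≫ σ → β = β') :
    ∃ β : Z ⟶ Y, β ≫ g = σ := by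
  choose V hV β hβ using hloc
  let 𝒰 : Z.OpenCover := Z.openCoverOfIsOpenCover V (by
    rw [TopologicalSpace.IsOpenCover, eq_top_iff]
    exact fun z _ ↦ TopologicalSpace.Opens.mem_iSup.mpr ⟨z, hV z⟩)
  let β' : ∀ z : 𝒰.I₀, 𝒰.X z ⟶ Y := β
  have hβ' (z : 𝒰.I₀) : β' z ≫ g = 𝒰.f z ≫ σ := hβ z
  clear_value β' 𝒰
  refine ⟨𝒰.glueMorphisms β' fun z z' ↦ ?_, ?_⟩
  · refine huniq _ (pullback.fst (𝒰.f z) (𝒰.f z') ≫ 𝒰.f z) _ _ ?_ ?_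
    · rw [Category.assoc, hβ', Category.assoc]
    · rw [Category.assoc, hβ', pullback.condition, Category.assoc]
  · refine 𝒰.hom_ext _ _ fun z ↦ ?_
    rw [Scheme.Cover.ι_glueMorphisms_assoc, hβ']

/-- Two lifts of a morphism from an integral scheme that meets the locus where the target is an
isomorphism agree. -/
lemma lift_unique (g : Y ⟶ X) [IsSeparated g] [IsIntegral Z] (U : X.Opens) [IsIso (g ∣_ U)]
    {β β' : Z ⟶ Y} (h : β ≫ g = β' ≫ g) (z : Z) (hz : (β ≫ g) z ∈ U) : β = β' := by
  let W : Z.Opens := (β ≫ g) ⁻¹ᵁ U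
  haveI : Nonempty W := ⟨⟨z, hz⟩⟩
  haveI : IsDominant W.ι := by
    constructor
    rw [DenseRange, Scheme.Opens.range_ι]
    exact W.isOpen.dense ⟨z, hz⟩
  refine ext_of_isDominant_of_isSeparated g h W.ι ?_
  have hr (b : Z ⟶ Y) (hb : b ≫ g = β ≫ g) : Set.range (W.ι ≫ b) ⊆ Set.range (g ⁻¹ᵁ U).ι := by
    rintro _ ⟨w, rfl⟩
    rw [Scheme.Opens.range_ι]
    change g (b (W.ι w)) ∈ U
    rw [← Scheme.Hom.comp_apply, hb]
    exact w.2
  rw [← IsOpenImmersion.lift_fac (g ⁻¹ᵁ U).ι (W.ι ≫ β) (hr β rfl),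
    ← IsOpenImmersion.lift_fac (g ⁻¹ᵁ U).ι (W.ι ≫ β') (hr β' h.symm)]
  congr 1
  rw [← cancel_mono (g ∣_ U), ← cancel_mono U.ι, Category.assoc, Category.assoc,
    morphismRestrict_ι, IsOpenImmersion.lift_fac_assoc, IsOpenImmersion.lift_fac_assoc,
    Category.assoc, Category.assoc, h]

lemma isIso_morphismRestrict_of_existsUnique (g : Y ⟶ X) (U : X.Opens)
    (h : ∀ (W : Scheme.{0}) (τ : W ⟶ X), (∀ w, τ w ∈ U) → ∃! β : W ⟶ Y, β ≫ g = τ) :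
    IsIso (g ∣_ U) := by
  obtain ⟨s, hs, -⟩ := h U U.ι fun w ↦ w.2
  have hr : Set.range s ⊆ Set.range (g ⁻¹ᵁ U).ι := by
    rintro _ ⟨w, rfl⟩
    rw [Scheme.Opens.range_ι]
    change g (s w) ∈ U
    rw [← Scheme.Hom.comp_apply, hs]
    exact w.2
  refine ⟨IsOpenImmersion.lift (g ⁻¹ᵁ U).ι s hr, ?_, ?_⟩
  · rw [← cancel_mono (g ⁻¹ᵁ U).ι, Category.assoc, IsOpenImmersion.lift_fac, Category.id_comp]
    refine (h _ ((g ⁻¹ᵁ U).ι ≫ g) fun w ↦ w.2).unique ?_ rfl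
    rw [Category.assoc, hs, morphismRestrict_ι]
  · rw [← cancel_mono U.ι, Category.assoc, morphismRestrict_ι, IsOpenImmersion.lift_fac_assoc, hs,
      Category.id_comp]

/-- A morphism is an isomorphism over an open set that lifts to a full preimage. -/
lemma isIso_morphismRestrict_of_opensRange_eq (g : Y ⟶ X) (U : X.Opens) (i : (U : Scheme) ⟶ Y)
    [IsOpenImmersion i] (hi : i ≫ g = U.ι) (h : g ⁻¹ᵁ U = i.opensRange) : IsIso (g ∣_ U) := by
  let e := IsOpenImmersion.isoOfRangeEq i (g ⁻¹ᵁ U).ι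
    (by rw [Scheme.Opens.range_ι, h, Scheme.Hom.coe_opensRange])
  have he : e.hom ≫ g ∣_ U = 𝟙 _ := by
    rw [← cancel_mono U.ι, Category.assoc, morphismRestrict_ι, Category.id_comp,
      IsOpenImmersion.isoOfRangeEq_hom_fac_assoc, hi]
  have : g ∣_ U = e.inv := by rw [← cancel_epi e.hom, he, Iso.hom_inv_id]
  rw [this]
  infer_instance

end Gluing

end DerBlowup

namespace DerBlowup

/-! ### The blow-up of `A_{k+1}` at `(x, y)` -/

section Nonvanishing

variable {R S : Type} [CommRing R] [CommRing S] {W : Scheme.{0}}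

/-- The function `r` does not vanish at the point `p`. -/
def NonvanishingAt (r : R) (p : Spec (CommRingCat.of R)) : Prop :=
  r ∉ (show PrimeSpectrum R from p).asIdeal

lemma nonvanishingAt_mul {r s : R} {p : Spec (CommRingCat.of R)} :
    NonvanishingAt (r * s) p ↔ NonvanishingAt r p ∧ NonvanishingAt s p := by
  rw [NonvanishingAt, (show PrimeSpectrum R from p).isPrime.mul_mem_iff_mem_or_mem, not_or]; rfl

lemma NonvanishingAt.of_pow {r : R} {n : ℕ} {p : Spec (CommRingCat.of R)}
    (h : NonvanishingAt (r ^ n) p) (hn : n ≠ 0) : NonvanishingAt r p :=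
  fun h' ↦ h (Ideal.pow_mem_of_mem _ h' n (Nat.pos_of_ne_zero hn))

lemma nonvanishingAt_specMap (ψ : R →+* S) (r : R) (p : Spec (CommRingCat.of S)) :
    NonvanishingAt r (Spec.map (CommRingCat.ofHom ψ) p) ↔ NonvanishingAt (ψ r) p := Iff.rfl

lemma nonvanishingAt_iff (τ : W ⟶ Spec (CommRingCat.of R)) (w : W) (r : R) :
    NonvanishingAt r (τ w) ↔ w ∈ W.basicOpen (pull τ r) := mem_asIdeal_iff τ w r

lemma isUnit_pull_iff_nonvanishingAt (τ : W ⟶ Spec (CommRingCat.of R)) (r : R) :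
    IsUnit (pull τ r) ↔ ∀ w, NonvanishingAt r (τ w) := isUnit_pull_iff τ r

end Nonvanishing

/-- The surface `A_n`, as the spectrum of `AnR n`. -/
abbrev SpecAn (n : ℕ) : Scheme.{0} := Spec (CommRingCat.of (AnR n))

instance (n : ℕ) : IsIntegral (SpecAn n) :=
  inferInstanceAs (IsIntegral (Spec (CommRingCat.of (AnR n))))

/-- `f : B → A_{k+1}` is the blow-up at `(x, y)`, with charts `A_0` and `A_k`. -/
structure IsChartBlowup (k : ℕ) {B : Scheme.{0}} (f : B ⟶ SpecAn (k + 1)) (inl : SpecAn 0 ⟶ B)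
    (inr : SpecAn k ⟶ B) : Prop where
  isOpenImmersion_inl : IsOpenImmersion inl
  isOpenImmersion_inr : IsOpenImmersion inr
  inl_comp : inl ≫ f = Spec.map (CommRingCat.ofHom (chartOne (k + 1)))
  inr_comp : inr ≫ f = Spec.map (CommRingCat.ofHom (chartTwo k))
  cover : ∀ b : B, (∃ p, inl p = b) ∨ ∃ q, inr q = b
  -- The coordinate `z` of the first chart is `y/x` and the coordinate `x` of the second is `x/y`;
  -- they are inverse on the overlap.
  transit : ∀ {W : Scheme.{0}} (ψ : W ⟶ SpecAn 0) (ψ' : W ⟶ SpecAn k),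
    pull ψ (cz 0) * pull ψ' (cx k) = 1 → ψ ≫ inl ≫ f = ψ' ≫ inr ≫ f → ψ ≫ inl = ψ' ≫ inr
  inl_mem : ∀ p, NonvanishingAt (cz 0) p → ∃ q, inr q = inl p
  inr_mem : ∀ q, NonvanishingAt (cx k) q → ∃ p, inl p = inr q
  overlap : ∀ p q, inl p = inr q → NonvanishingAt (cz 0) p ∧ NonvanishingAt (cx k) q

/-! ### Gluing the blow-up from its two charts -/

section Existence

variable (k : ℕ)

lemma exists_nonvanishing_localization {R : Type} [CommRing R] (r : R) (p : Spec (CommRingCat.of R))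
    (hp : NonvanishingAt r p) :
    ∃ u, Spec.map (CommRingCat.ofHom (algebraMap R (Localization.Away r))) u = p := by
  have := PrimeSpectrum.localization_away_comap_range (Localization.Away r) r
  have h : (show PrimeSpectrum R from p) ∈ (PrimeSpectrum.basicOpen r : Set (PrimeSpectrum R)) := hp
  rw [← this] at h
  exact h

lemma nonvanishing_specMap_localization {R : Type} [CommRing R] (r : R)
    (u : Spec (CommRingCat.of (Localization.Away r))) :
    NonvanishingAt r (Spec.map (CommRingCat.ofHom (algebraMap R (Localization.Away r))) u) := by
  rw [nonvanishingAt_specMap]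
  exact fun h ↦ (show PrimeSpectrum _ from u).isPrime.ne_top
    (Ideal.eq_top_of_isUnit_mem _ h (IsLocalization.Away.algebraMap_isUnit r))

/-- The overlap of the two charts, as an open subset of the second one. -/
def overlapHom : AnR k →+* Localization.Away (cz 0) :=
  liftAn k (algebraMap ℂ _) (IsLocalization.Away.invSelf (cz 0)) (algebraMap (AnR 0) _ (cy 0))
    (algebraMap (AnR 0) _ (cx 0 ^ (k + 1) * cz 0 ^ (k + 2))) (by
      have h := cx_mul_cz 0
      simp only [zero_add, pow_one] at h
      have h2 := IsLocalization.Away.mul_invSelf (S := Localization.Away (cz 0)) (cz 0)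
      rw [← h]
      simp only [map_mul, map_pow]
      linear_combination (algebraMap (AnR 0) (Localization.Away (cz 0)) (cx 0) ^ (k + 1) *
        algebraMap (AnR 0) (Localization.Away (cz 0)) (cz 0) ^ (k + 1)) * h2)

/-- The overlap of the two charts, as an open subset of the first one. -/
def overlapHom' : AnR 0 →+* Localization.Away (cx k) :=
  liftAn 0 (algebraMap ℂ _) (algebraMap (AnR k) _ (cx k * cy k)) (algebraMap (AnR k) _ (cy k))
    (IsLocalization.Away.invSelf (cx k)) (by
      have h2 := IsLocalization.Away.mul_invSelf (S := Localization.Away (cx k)) (cx k)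
      simp only [map_mul, zero_add, pow_one]
      linear_combination (algebraMap (AnR k) (Localization.Away (cx k)) (cy k)) * h2)

lemma isUnit_overlapHom_cx : IsUnit (overlapHom k (cx k)) := by
  rw [overlapHom, liftAn_cx]
  exact .of_mul_eq_one_right _ (IsLocalization.Away.mul_invSelf (S := Localization.Away (cz 0)) (cz 0))

lemma isUnit_overlapHom'_cz : IsUnit (overlapHom' k (cz 0)) := by
  rw [overlapHom', liftAn_cz]
  exact .of_mul_eq_one_right _ (IsLocalization.Away.mul_invSelf (S := Localization.Away (cx k)) (cx k))

lemma hom_ext_away {R S : Type} [CommRing R] [CommRing S] (r : R)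
    {a b : Localization.Away r →+* S}
    (h : a.comp (algebraMap R _) = b.comp (algebraMap R _)) : a = b :=
  IsLocalization.ringHom_ext (Submonoid.powers r) h

lemma mul_lift_invSelf {R S : Type} [CommRing R] [CommRing S] (r : R) (g : R →+* S)
    (hg : IsUnit (g r)) : g r * IsLocalization.Away.lift (S := Localization.Away r) r hg
      (IsLocalization.Away.invSelf r) = 1 := by
  have := congrArg (IsLocalization.Away.lift (S := Localization.Away r) r hg)
    (IsLocalization.Away.mul_invSelf (S := Localization.Away r) r)
  rwa [map_mul, map_one, IsLocalization.Away.lift_eq] at this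

lemma lift_algebraMap_complex {R S : Type} [CommRing R] [CommRing S] [Algebra ℂ R] (r : R)
    (g : R →+* S) (hg : IsUnit (g r)) (a : ℂ) :
    IsLocalization.Away.lift (S := Localization.Away r) r hg (algebraMap ℂ _ a) =
      g (algebraMap ℂ _ a) := by
  rw [IsScalarTower.algebraMap_apply ℂ R, IsLocalization.Away.lift_eq]

/-- The identification of the two descriptions of the overlap. -/
def overlapEquiv : Localization.Away (cx k) ≃+* Localization.Away (cz 0) :=
  RingEquiv.ofRingHom (IsLocalization.Away.lift (cx k) (isUnit_overlapHom_cx k))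
    (IsLocalization.Away.lift (cz 0) (isUnit_overlapHom'_cz k))
    (by
      have h := cx_mul_cz 0
      simp only [zero_add, pow_one] at h
      have h2 := IsLocalization.Away.mul_invSelf (S := Localization.Away (cz 0)) (cz 0)
      have h3 := mul_lift_invSelf (cx k) (overlapHom k) (isUnit_overlapHom_cx k)
      apply hom_ext_away
      rw [RingHom.comp_assoc, IsLocalization.Away.lift_comp]
      apply anRing_hom_ext
      · ext r
        simp only [RingHom.comp_apply, overlapHom', liftAn_algebraMap, lift_algebraMap_complex,
          RingHom.id_apply, overlapHom, ← IsScalarTower.algebraMap_apply]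
      · simp only [RingHom.comp_apply, overlapHom', liftAn_cx, IsLocalization.Away.lift_eq,
          RingHom.id_apply, overlapHom, map_mul, liftAn_cy, ← h]
        linear_combination (algebraMap (AnR 0) (Localization.Away (cz 0)) (cx 0)) * h2
      · simp [overlapHom', overlapHom]
      · simp only [RingHom.comp_apply, overlapHom', liftAn_cz, RingHom.id_apply]
        simp only [overlapHom, liftAn_cx] at h3 ⊢
        exact left_inv_eq_right_inv h2 h3 |>.symm)
    (by
      have h := cx_mul_cz k
      have h2 := IsLocalization.Away.mul_invSelf (S := Localization.Away (cx k)) (cx k)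
      have h3 := mul_lift_invSelf (cz 0) (overlapHom' k) (isUnit_overlapHom'_cz k)
      apply hom_ext_away
      rw [RingHom.comp_assoc, IsLocalization.Away.lift_comp]
      apply anRing_hom_ext
      · ext r
        simp only [RingHom.comp_apply, overlapHom', liftAn_algebraMap, lift_algebraMap_complex,
          RingHom.id_apply, overlapHom, ← IsScalarTower.algebraMap_apply]
      · simp only [RingHom.comp_apply, overlapHom, liftAn_cx, RingHom.id_apply]
        simp only [overlapHom', liftAn_cz] at h3 ⊢
        exact left_inv_eq_right_inv h2 h3 |>.symm
      · simp [overlapHom', overlapHom]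
      · simp only [RingHom.comp_apply, overlapHom', liftAn_cz, IsLocalization.Away.lift_eq,
          RingHom.id_apply, overlapHom, map_mul, map_pow, liftAn_cx]
        have h4 := congrArg (algebraMap (AnR k) (Localization.Away (cx k))) h
        simp only [map_mul, map_pow] at h4
        rw [mul_pow, ← h4]
        generalize algebraMap (AnR k) (Localization.Away (cx k)) (cx k) = X at *
        generalize algebraMap (AnR k) (Localization.Away (cx k)) (cz k) = Z at *
        generalize (IsLocalization.Away.invSelf (cx k) : Localization.Away (cx k)) = I at *
        calc X ^ (k + 1) * (X * Z) * I ^ (k + 2) = (X * I) ^ (k + 2) * Z := by ring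
          _ = Z := by rw [h2, one_pow, one_mul])

lemma isOpenImmersion_overlapHom : IsOpenImmersion (Spec.map (CommRingCat.ofHom (overlapHom k))) := by
  have : overlapHom k = ((overlapEquiv k : _ →+* Localization.Away (cz 0))).comp
      (algebraMap (AnR k) (Localization.Away (cx k))) := by
    exact (IsLocalization.Away.lift_comp (cx k) (isUnit_overlapHom_cx k)).symm
  rw [this, CommRingCat.ofHom_comp, Spec.map_comp]
  haveI : IsIso (CommRingCat.ofHom
      (overlapEquiv k : Localization.Away (cx k) →+* Localization.Away (cz 0))) :=
    (overlapEquiv k).toCommRingCatIso.isIso_hom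
  infer_instance

theorem exists_isChartBlowup : ∃ (B : Scheme.{0}) (f : B ⟶ SpecAn (k + 1)) (inl : SpecAn 0 ⟶ B)
    (inr : SpecAn k ⟶ B), IsChartBlowup k f inl inr := by
  let i : Spec (CommRingCat.of (Localization.Away (cz 0))) ⟶ SpecAn 0 :=
    Spec.map (CommRingCat.ofHom (algebraMap (AnR 0) (Localization.Away (cz 0))))
  let j : Spec (CommRingCat.of (Localization.Away (cz 0))) ⟶ SpecAn k :=
    Spec.map (CommRingCat.ofHom (overlapHom k))
  haveI : IsOpenImmersion j := isOpenImmersion_overlapHom k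
  obtain ⟨B, inl, inr, hl, hr, hp, hc, ho⟩ := exists_glue i j
  have hw : i ≫ Spec.map (CommRingCat.ofHom (chartOne (k + 1))) =
      j ≫ Spec.map (CommRingCat.ofHom (chartTwo k)) := by
    rw [← Spec.map_comp, ← Spec.map_comp, ← CommRingCat.ofHom_comp, ← CommRingCat.ofHom_comp]
    congr 2
    apply anRing_hom_ext
    · ext r
      simp [chartOne, chartTwo, overlapHom, ← IsScalarTower.algebraMap_apply]
    · have h := cx_mul_cz 0
      simp only [zero_add, pow_one] at h
      have h2 := IsLocalization.Away.mul_invSelf (S := Localization.Away (cz 0)) (cz 0)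
      simp only [chartOne, chartTwo, overlapHom, RingHom.comp_apply, liftAn_cx, map_mul, liftAn_cy,
        ← h]
      linear_combination (-algebraMap (AnR 0) (Localization.Away (cz 0)) (cx 0)) * h2
    · simp [chartOne, chartTwo, overlapHom]
    · simp [chartOne, chartTwo, overlapHom]
  have hinv : algebraMap (AnR 0) (Localization.Away (cz 0)) (cz 0) * overlapHom k (cx k) = 1 := by
    rw [overlapHom, liftAn_cx, IsLocalization.Away.mul_invSelf]
  refine ⟨B, hp.desc _ _ hw, inl, inr, hl, hr, hp.inl_desc _ _ _, hp.inr_desc _ _ _, hc, ?_, ?_, ?_,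
    ?_⟩
  · intro W ψ ψ' h1 h2
    rw [hp.inl_desc, hp.inr_desc] at h2
    -- The relation makes `y/x` invertible on `W`, so `ψ` factors through the overlap.
    let u : W ⟶ Spec (CommRingCat.of (Localization.Away (cz 0))) :=
      ofPull (IsLocalization.Away.lift (cz 0) (g := pull ψ) (.of_mul_eq_one _ h1))
    have hu1 : u ≫ i = ψ := by
      apply pull_injective
      rw [pull_comp_specMap, pull_ofPull, IsLocalization.Away.lift_comp]
    have hu2 : u ≫ j = ψ' := by
      have h3 : pull (u ≫ j) = (pull u).comp (overlapHom k) := pull_comp_specMap _ _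
      have h4 := congrArg pull hu1
      have h5 : pull (u ≫ i) = (pull u).comp (algebraMap _ _) := pull_comp_specMap _ _
      have h6 := congrArg pull h2
      rw [← h4, h5] at h1
      rw [pull_comp_specMap, pull_comp_specMap, ← h4, h5] at h6
      apply pull_injective
      rw [h3]
      have hx : pull u (overlapHom k (cx k)) = pull ψ' (cx k) := by
        have h8 := congrArg (pull u) hinv
        rw [map_mul, map_one] at h8
        rw [RingHom.comp_apply] at h1
        have := IsUnit.of_mul_eq_one _ h1
        exact this.mul_left_cancel (h8.trans h1.symm)
      apply anRing_hom_ext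
      · ext r
        have := RingHom.congr_fun h6 (algebraMap ℂ _ r)
        simpa [chartOne, chartTwo, overlapHom, ← IsScalarTower.algebraMap_apply] using this
      · exact hx
      · have := RingHom.congr_fun h6 (cy (k + 1))
        simpa [chartOne, chartTwo, overlapHom] using this
      · have := RingHom.congr_fun h6 (cz (k + 1))
        simpa [chartOne, chartTwo, overlapHom] using this
    rw [← hu1, ← hu2, Category.assoc, Category.assoc, hp.w]
  · intro p hp'
    obtain ⟨u, rfl⟩ := exists_nonvanishing_localization _ p hp'
    exact ⟨j u, by
      change inr (j u) = inl (i u)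
      rw [← Scheme.Hom.comp_apply, ← hp.w, Scheme.Hom.comp_apply]⟩
  · intro q hq
    obtain ⟨u, rfl⟩ := exists_nonvanishing_localization _ q hq
    let e : Spec (CommRingCat.of (Localization.Away (cx k))) ⟶
      Spec (CommRingCat.of (Localization.Away (cz 0))) :=
      Spec.map (CommRingCat.ofHom ((overlapEquiv k).symm : _ →+* Localization.Away (cx k)))
    have he : e ≫ j = Spec.map (CommRingCat.ofHom (algebraMap (AnR k) _)) := by
      rw [← Spec.map_comp, ← CommRingCat.ofHom_comp]
      congr 2
      have : overlapHom k = ((overlapEquiv k : _ →+* Localization.Away (cz 0))).comp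
          (algebraMap (AnR k) (Localization.Away (cx k))) :=
        (IsLocalization.Away.lift_comp (cx k) (isUnit_overlapHom_cx k)).symm
      rw [this, ← RingHom.comp_assoc]
      ext r
      simp
    exact ⟨i (e u), by
      rw [← Scheme.Hom.comp_apply, hp.w, ← he]; rfl⟩
  · intro p q h
    obtain ⟨u, rfl, rfl⟩ := ho p q h
    refine ⟨nonvanishing_specMap_localization _ u, ?_⟩
    rw [nonvanishingAt_specMap]
    exact fun h ↦ (show PrimeSpectrum _ from u).isPrime.ne_top
      (Ideal.eq_top_of_isUnit_mem _ h (isUnit_overlapHom_cx k))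

end Existence

end DerBlowup

namespace DerBlowup

/-! ### Morphisms into the blow-up of `(x, y)` -/

section ChartBlowup

variable {k : ℕ} {B W : Scheme.{0}} {f : B ⟶ SpecAn (k + 1)} {inl : SpecAn 0 ⟶ B}
  {inr : SpecAn k ⟶ B}

lemma exists_factor {X Y Z : Scheme.{0}} (i : X ⟶ Y) [IsOpenImmersion i] (β : Z ⟶ Y)
    (h : ∀ z, ∃ x, i x = β z) : ∃ ψ : Z ⟶ X, ψ ≫ i = β :=
  ⟨IsOpenImmersion.lift i β (by rintro _ ⟨z, rfl⟩; exact h z), IsOpenImmersion.lift_fac _ _ _⟩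

/-- At most one of the coordinates of a point of `A_n` outside the origin vanishes. -/
lemma nonvanishingAt_of_ne_origin {n : ℕ} (p : SpecAn n) (hp : p ≠ origin n) :
    NonvanishingAt (cx n) p ∨ NonvanishingAt (cy n) p ∨ NonvanishingAt (cz n) p := by
  by_contra! H
  simp only [NonvanishingAt, not_not] at H
  apply hp
  apply PrimeSpectrum.ext
  symm
  refine Ideal.IsMaximal.eq_of_le ?_ (show PrimeSpectrum (AnR n) from p).isPrime.ne_top ?_
  · exact RingHom.ker_isMaximal_of_surjective (evalO n) fun c ↦ ⟨algebraMap ℂ _ c, by simp⟩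
  · intro r hr
    have : r ∈ Ideal.span {cx n, cy n, cz n} := (mem_span_iff_evalO n r).mpr hr
    refine (Ideal.span_le.mpr ?_) this
    rintro _ (rfl | rfl | rfl)
    exacts [H.1, H.2.1, H.2.2]

lemma not_nonvanishingAt_origin (n : ℕ) : ¬ NonvanishingAt (cx n) (origin n) ∧
    ¬ NonvanishingAt (cy n) (origin n) ∧ ¬ NonvanishingAt (cz n) (origin n) :=
  ⟨fun h ↦ h (evalO_cx n), fun h ↦ h (evalO_cy n), fun h ↦ h (evalO_cz n)⟩

lemma pull_cx_mul_cz {n : ℕ} (τ : W ⟶ SpecAn n) :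
    pull τ (cx n) * pull τ (cz n) = pull τ (cy n) ^ (n + 1) := by
  rw [← map_mul, cx_mul_cz, map_pow]

/-- A morphism to the first chart from functions `x` and `y / x`. -/
lemma exists_chartOne (τ : W ⟶ SpecAn (k + 1)) (c : Γ(W, ⊤))
    (hy : pull τ (cy (k + 1)) = pull τ (cx (k + 1)) * c)
    (hz : pull τ (cz (k + 1)) = pull τ (cx (k + 1)) ^ (k + 1) * c ^ (k + 2)) :
    ∃ ψ : W ⟶ SpecAn 0, ψ ≫ Spec.map (CommRingCat.ofHom (chartOne (k + 1))) = τ ∧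
      pull ψ (cz 0) = c ∧ pull ψ (cx 0) = pull τ (cx (k + 1)) := by
  let φ : AnR 0 →+* Γ(W, ⊤) := liftAn 0 ((pull τ).comp (algebraMap ℂ _)) (pull τ (cx (k + 1)))
    (pull τ (cy (k + 1))) c (by rw [hy, zero_add, pow_one])
  refine ⟨ofPull φ, ?_, by simp [φ], by simp [φ]⟩
  apply pull_injective
  rw [pull_comp_specMap, pull_ofPull]
  apply anRing_hom_ext
  · ext r; simp [φ, chartOne]
  · simp [φ, chartOne]
  · simp [φ, chartOne]
  · simp [φ, chartOne, hz]

/-- A morphism to the second chart from functions `x / y`, `y` and `z`. -/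
lemma exists_chartTwo (τ : W ⟶ SpecAn (k + 1)) (c : Γ(W, ⊤))
    (hx : pull τ (cx (k + 1)) = pull τ (cy (k + 1)) * c)
    (hz : c * pull τ (cz (k + 1)) = pull τ (cy (k + 1)) ^ (k + 1)) :
    ∃ ψ : W ⟶ SpecAn k, ψ ≫ Spec.map (CommRingCat.ofHom (chartTwo k)) = τ ∧
      pull ψ (cx k) = c := by
  let φ : AnR k →+* Γ(W, ⊤) := liftAn k ((pull τ).comp (algebraMap ℂ _)) c
    (pull τ (cy (k + 1))) (pull τ (cz (k + 1))) hz
  refine ⟨ofPull φ, ?_, by simp [φ]⟩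
  apply pull_injective
  rw [pull_comp_specMap, pull_ofPull]
  apply anRing_hom_ext
  · ext r; simp [φ, chartTwo]
  · simp [φ, chartTwo, hx, mul_comm]
  · simp [φ, chartTwo]
  · simp [φ, chartTwo]

/-- `x` divides `y` or `y` divides `x` on `W`. -/
def PrincipalXY {n : ℕ} (τ : W ⟶ SpecAn n) : Prop :=
  pull τ (cx n) ∣ pull τ (cy n) ∨ pull τ (cy n) ∣ pull τ (cx n)

lemma principalXY_chartOne {n : ℕ} (ψ : W ⟶ SpecAn 0) :
    PrincipalXY (ψ ≫ Spec.map (CommRingCat.ofHom (chartOne n))) := by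
  left
  have h := cx_mul_cz 0
  simp only [zero_add, pow_one] at h
  rw [pull_comp_specMap, RingHom.comp_apply, RingHom.comp_apply, chartOne, liftAn_cx, liftAn_cy,
    ← h, map_mul]
  exact dvd_mul_right _ _

lemma principalXY_chartTwo (ψ : W ⟶ SpecAn k) :
    PrincipalXY (ψ ≫ Spec.map (CommRingCat.ofHom (chartTwo k))) := by
  right
  rw [pull_comp_specMap, RingHom.comp_apply, RingHom.comp_apply, chartTwo, liftAn_cx, liftAn_cy,
    map_mul]
  exact dvd_mul_left _ _

namespace IsChartBlowup

variable (hB : IsChartBlowup k f inl inr)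
include hB

/-- Integrality allows cancelling the generator in `xz = y^(k+2)`, which gives the equation of the
chart. -/
lemma exists_lift_of_principalXY [IsIntegral W] (τ : W ⟶ SpecAn (k + 1)) (h : PrincipalXY τ) :
    ∃ β : W ⟶ B, β ≫ f = τ := by
  have hxz := pull_cx_mul_cz τ
  rcases h with ⟨c, hc⟩ | ⟨c, hc⟩
  · by_cases hx : pull τ (cx (k + 1)) = 0
    · obtain ⟨ψ, h, -⟩ := exists_chartTwo τ 0 (by rw [hx, mul_zero])
        (by rw [hc, hx, zero_mul, zero_mul, zero_pow (Nat.succ_ne_zero _)])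
      exact ⟨ψ ≫ inr, by rw [Category.assoc, hB.inr_comp, h]⟩
    · obtain ⟨ψ, h, -⟩ := exists_chartOne τ c hc (by
        apply mul_left_cancel₀ hx
        rw [hxz, hc]; ring)
      exact ⟨ψ ≫ inl, by rw [Category.assoc, hB.inl_comp, h]⟩
  · by_cases hy : pull τ (cy (k + 1)) = 0
    · obtain ⟨ψ, h, -⟩ := exists_chartTwo τ 0 (by rw [hc, hy, zero_mul, zero_mul])
        (by rw [hy, zero_mul, zero_pow (Nat.succ_ne_zero _)])
      exact ⟨ψ ≫ inr, by rw [Category.assoc, hB.inr_comp, h]⟩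
    · obtain ⟨ψ, h, -⟩ := exists_chartTwo τ c hc (by
        apply mul_left_cancel₀ hy
        rw [← mul_assoc, ← hc, hxz]; ring)
      exact ⟨ψ ≫ inr, by rw [Category.assoc, hB.inr_comp, h]⟩

lemma factor_inl (β : W ⟶ B)
    (h : ∀ w q, inr q = β w → NonvanishingAt (cx k) q) : ∃ ψ, ψ ≫ inl = β := by
  haveI := hB.isOpenImmersion_inl
  refine exists_factor inl β fun w ↦ ?_
  obtain ⟨p, hp⟩ | ⟨q, hq⟩ := hB.cover (β w)
  · exact ⟨p, hp⟩
  · obtain ⟨p, hp⟩ := hB.inr_mem q (h w q hq)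
    exact ⟨p, hp.trans hq⟩

lemma factor_inr (β : W ⟶ B)
    (h : ∀ w p, inl p = β w → NonvanishingAt (cz 0) p) : ∃ ψ, ψ ≫ inr = β := by
  haveI := hB.isOpenImmersion_inr
  refine exists_factor inr β fun w ↦ ?_
  obtain ⟨p, hp⟩ | ⟨q, hq⟩ := hB.cover (β w)
  · obtain ⟨q, hq⟩ := hB.inl_mem p (h w p hp)
    exact ⟨q, hq.trans hp⟩
  · exact ⟨q, hq⟩

lemma nonvanishingAt_inl_iff (p : SpecAn 0) (r : AnR (k + 1)) :
    NonvanishingAt r (f (inl p)) ↔ NonvanishingAt (chartOne (k + 1) r) p := by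
  rw [← nonvanishingAt_specMap, ← hB.inl_comp, Scheme.Hom.comp_apply]

lemma nonvanishingAt_inr_iff (q : SpecAn k) (r : AnR (k + 1)) :
    NonvanishingAt r (f (inr q)) ↔ NonvanishingAt (chartTwo k r) q := by
  rw [← nonvanishingAt_specMap, ← hB.inr_comp, Scheme.Hom.comp_apply]

/-- The blow-up is an isomorphism where one of the coordinates does not vanish. -/
lemma existsUnique_lift (τ : W ⟶ SpecAn (k + 1))
    (h : IsUnit (pull τ (cx (k + 1))) ∨ IsUnit (pull τ (cy (k + 1))) ∨
      IsUnit (pull τ (cz (k + 1)))) : ∃! β : W ⟶ B, β ≫ f = τ := by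
  have hxz := pull_cx_mul_cz τ
  rcases h with hx | hyz
  · obtain ⟨u, hu⟩ := hx
    have huu : (u : Γ(W, ⊤)) * (u⁻¹ : Γ(W, ⊤)ˣ) = 1 := by simp
    obtain ⟨ψ, hψ, hψz, hψx⟩ := exists_chartOne τ ((u⁻¹ : Γ(W, ⊤)ˣ) * pull τ (cy (k + 1)))
      (by rw [← hu, ← mul_assoc, huu, one_mul]) (by
        apply u.isUnit.mul_left_cancel
        rw [hu, hxz, ← hu]
        calc pull τ (cy (k + 1)) ^ (k + 1 + 1) = ((u : Γ(W, ⊤)) * (u⁻¹ : Γ(W, ⊤)ˣ)) ^ (k + 2) *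
            pull τ (cy (k + 1)) ^ (k + 2) := by rw [huu, one_pow, one_mul]
          _ = _ := by ring)
    refine ⟨ψ ≫ inl, by simp only [Category.assoc, hB.inl_comp, hψ], fun β hβ ↦ ?_⟩
    obtain ⟨ψ', rfl⟩ := hB.factor_inl β fun w q hq ↦ by
      have h1 := (isUnit_pull_iff_nonvanishingAt τ (cx (k + 1))).mp ⟨u, hu⟩ w
      rw [← hβ, Scheme.Hom.comp_apply, ← hq, hB.nonvanishingAt_inr_iff, chartTwo, liftAn_cx,
        nonvanishingAt_mul] at h1
      exact h1.1
    congr 1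
    rw [Category.assoc, hB.inl_comp, ← hψ] at hβ
    have h1 := congrArg pull hβ
    rw [pull_comp_specMap, pull_comp_specMap] at h1
    have h2 : pull ψ' (cx 0) = pull ψ (cx 0) := by
      simpa [chartOne] using RingHom.congr_fun h1 (cx (k + 1))
    have h3 : pull ψ' (cy 0) = pull ψ (cy 0) := by
      simpa [chartOne] using RingHom.congr_fun h1 (cy (k + 1))
    apply pull_injective
    apply anRing_hom_ext
    · ext r
      simpa [chartOne] using RingHom.congr_fun h1 (algebraMap ℂ _ r)
    · exact h2
    · exact h3
    · have h4 := pull_cx_mul_cz ψ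
      have h5 := pull_cx_mul_cz ψ'
      rw [h2, h3, ← h4] at h5
      rw [hψx, ← hu] at h5
      exact u.isUnit.mul_left_cancel h5
  -- The quotient `x/y` also equals `y^(k+1)/z`, so it is defined if `y` or `z` is invertible.
  · obtain ⟨c, hc, hcz⟩ : ∃ c, pull τ (cx (k + 1)) = pull τ (cy (k + 1)) * c ∧
        c * pull τ (cz (k + 1)) = pull τ (cy (k + 1)) ^ (k + 1) := by
      rcases hyz with ⟨u, hu⟩ | ⟨u, hu⟩
      · have huu : (u : Γ(W, ⊤)) * (u⁻¹ : Γ(W, ⊤)ˣ) = 1 := by simp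
        refine ⟨(u⁻¹ : Γ(W, ⊤)ˣ) * pull τ (cx (k + 1)), ?_, ?_⟩
        · rw [← hu, ← mul_assoc, huu, one_mul]
        · rw [mul_assoc, hxz, ← hu, pow_succ' _ (k + 1), ← mul_assoc, mul_comm _ (u : Γ(W, ⊤)), huu,
            one_mul]
      · have huu : (u : Γ(W, ⊤)) * (u⁻¹ : Γ(W, ⊤)ˣ) = 1 := by simp
        refine ⟨(u⁻¹ : Γ(W, ⊤)ˣ) * pull τ (cy (k + 1)) ^ (k + 1), ?_, ?_⟩
        · apply u.isUnit.mul_right_cancel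
          rw [hu, hxz, ← hu]
          linear_combination (-pull τ (cy (k + 1)) ^ (k + 1 + 1)) * huu
        · rw [← hu]
          linear_combination (pull τ (cy (k + 1)) ^ (k + 1)) * huu
    obtain ⟨ψ, hψ, hψx⟩ := exists_chartTwo τ c hc hcz
    refine ⟨ψ ≫ inr, by simp only [Category.assoc, hB.inr_comp, hψ], fun β hβ ↦ ?_⟩
    obtain ⟨ψ', rfl⟩ := hB.factor_inr β fun w p hp ↦ by
      have hz0 := cx_mul_cz 0
      simp only [zero_add, pow_one] at hz0
      rcases hyz with hu | hu
      · have h1 := (isUnit_pull_iff_nonvanishingAt τ _).mp hu w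
        rw [← hβ, Scheme.Hom.comp_apply, ← hp, hB.nonvanishingAt_inl_iff, chartOne, liftAn_cy,
          ← hz0, nonvanishingAt_mul] at h1
        exact h1.2
      · have h1 := (isUnit_pull_iff_nonvanishingAt τ _).mp hu w
        rw [← hβ, Scheme.Hom.comp_apply, ← hp, hB.nonvanishingAt_inl_iff, chartOne, liftAn_cz,
          nonvanishingAt_mul] at h1
        exact h1.2.of_pow (Nat.succ_ne_zero _)
    congr 1
    rw [Category.assoc, hB.inr_comp, ← hψ] at hβ
    have h1 := congrArg pull hβ
    rw [pull_comp_specMap, pull_comp_specMap] at h1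
    have h2 : pull ψ' (cy k) = pull ψ (cy k) := by
      simpa [chartTwo] using RingHom.congr_fun h1 (cy (k + 1))
    have h3 : pull ψ' (cz k) = pull ψ (cz k) := by
      simpa [chartTwo] using RingHom.congr_fun h1 (cz (k + 1))
    have h4 : pull ψ' (cx k) * pull ψ' (cy k) = pull ψ (cx k) * pull ψ (cy k) := by
      simpa [chartTwo] using RingHom.congr_fun h1 (cx (k + 1))
    have h5 := RingHom.congr_fun (congrArg pull hψ) (cy (k + 1))
    have h6 := RingHom.congr_fun (congrArg pull hψ) (cz (k + 1))
    rw [pull_comp_specMap] at h5 h6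
    simp only [chartTwo, RingHom.comp_apply, liftAn_cy, liftAn_cz] at h5 h6
    apply pull_injective
    apply anRing_hom_ext
    · ext r
      simpa [chartTwo] using RingHom.congr_fun h1 (algebraMap ℂ _ r)
    · rcases hyz with hu | hu
      · rw [h2, h5] at h4
        exact hu.mul_right_cancel h4
      · have h7 := pull_cx_mul_cz ψ
        have h8 := pull_cx_mul_cz ψ'
        rw [h2, ← h7, h3, h6] at h8
        exact hu.mul_right_cancel h8
    · exact h2
    · exact h3

lemma existsUnique_lift_of_ne_origin (τ : W ⟶ SpecAn (k + 1)) (h : ∀ w, τ w ≠ origin (k + 1)) :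
    ∃! β : W ⟶ B, β ≫ f = τ := by
  have key (w : W) : ∃ V : W.Opens, w ∈ V ∧ ∀ (U : Scheme.{0}) (i : U ⟶ W),
      (∀ u, i u ∈ V) → ∃! β : U ⟶ B, β ≫ f = i ≫ τ := by
    have h1 := nonvanishingAt_of_ne_origin _ (h w)
    simp only [nonvanishingAt_iff] at h1
    have h2 (r : AnR (k + 1)) (U : Scheme.{0}) (i : U ⟶ W)
        (hi : ∀ u, i u ∈ W.basicOpen (pull τ r)) : IsUnit (pull (i ≫ τ) r) := by
      rw [isUnit_pull_iff_nonvanishingAt]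
      intro u
      rw [Scheme.Hom.comp_apply, nonvanishingAt_iff]
      exact hi u
    rcases h1 with hw | hw | hw
    · exact ⟨_, hw, fun U i hi ↦ hB.existsUnique_lift _ (.inl (h2 _ U i hi))⟩
    · exact ⟨_, hw, fun U i hi ↦ hB.existsUnique_lift _ (.inr (.inl (h2 _ U i hi)))⟩
    · exact ⟨_, hw, fun U i hi ↦ hB.existsUnique_lift _ (.inr (.inr (h2 _ U i hi)))⟩
  have huniq (U : Scheme.{0}) (i : U ⟶ W) (β β' : U ⟶ B) (hβ : β ≫ f = i ≫ τ)
      (hβ' : β' ≫ f = i ≫ τ) : β = β' := by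
    refine Scheme.hom_ext_of_forall _ _ fun u ↦ ?_
    obtain ⟨V, hV, hV'⟩ := key (i u)
    refine ⟨i ⁻¹ᵁ V, hV, (hV' _ ((i ⁻¹ᵁ V).ι ≫ i) fun v ↦ v.2).unique ?_ ?_⟩
    · rw [Category.assoc, hβ, Category.assoc]
    · rw [Category.assoc, hβ', Category.assoc]
  obtain ⟨β, hβ⟩ := exists_lift_of_local f τ (fun w ↦ by
    obtain ⟨V, hV, hV'⟩ := key w
    obtain ⟨β, hβ, -⟩ := hV' _ V.ι fun v ↦ v.2
    exact ⟨V, hV, β, hβ⟩) (fun U i _ β β' ↦ huniq U i β β')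
  exact ⟨β, hβ, fun β' hβ' ↦ huniq W (𝟙 W) _ _ (by simpa using hβ') (by simpa using hβ)⟩

end IsChartBlowup

end ChartBlowup

end DerBlowup

namespace DerBlowup

/-! ### Schemes covered by two open charts -/

section TwoCover

variable {P X Y S : Scheme.{0}} (i : X ⟶ P) (j : Y ⟶ P) [IsOpenImmersion i] [IsOpenImmersion j]

/-- The open cover of a scheme by two open immersions. -/
def twoCover (h : ∀ p : P, (∃ x, i x = p) ∨ ∃ y, j y = p) : P.OpenCover where
  I₀ := Bool
  X b := match b with
    | true => X
    | false => Y
  f b := match b with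
    | true => i
    | false => j
  mem₀ := by
    rw [Scheme.presieve₀_mem_precoverage_iff]
    refine ⟨fun p ↦ ?_, fun b ↦ ?_⟩
    · rcases h p with h | h
      · exact ⟨true, h⟩
      · exact ⟨false, h⟩
    · cases b <;> assumption

variable {i j}

/-- A scheme covered by two integral open subschemes with a common point is integral. -/
lemma isIntegral_of_cover [IsIntegral X] [IsIntegral Y]
    (h : ∀ p : P, (∃ x, i x = p) ∨ ∃ y, j y = p) {x : X} {y : Y} (hxy : i x = j y) :
    IsIntegral P := by
  haveI : IsReduced P := by
    haveI : ∀ p : P, _root_.IsReduced (P.presheaf.stalk p) := by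
      intro p
      rcases h p with ⟨x, rfl⟩ | ⟨y, rfl⟩
      · exact isReduced_of_injective (i.stalkMap x).hom
          (asIso (i.stalkMap x)).commRingCatIsoToRingEquiv.injective
      · exact isReduced_of_injective (j.stalkMap y).hom
          (asIso (j.stalkMap y)).commRingCatIsoToRingEquiv.injective
    exact isReduced_of_isReduced_stalk P
  have hi := i.isOpenEmbedding
  have hj := j.isOpenEmbedding
  have hne : ((Set.range i) ∩ Set.range j).Nonempty := ⟨i x, ⟨x, rfl⟩, ⟨y, hxy.symm⟩⟩
  have hiirr : IsPreirreducible (Set.range i) := by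
    rw [← Set.image_univ]
    exact (PreirreducibleSpace.isPreirreducible_univ).image _ hi.continuous.continuousOn
  have hjirr : IsPreirreducible (Set.range j) := by
    rw [← Set.image_univ]
    exact (PreirreducibleSpace.isPreirreducible_univ).image _ hj.continuous.continuousOn
  haveI : Nonempty P := ⟨i x⟩
  have key (U : Set P) (hU : IsOpen U) (hU' : U.Nonempty) : (Set.range i ∩ U).Nonempty := by
    obtain ⟨p, hp⟩ := hU'
    rcases h p with ⟨x, rfl⟩ | ⟨y, rfl⟩
    · exact ⟨_, ⟨x, rfl⟩, hp⟩
    · obtain ⟨q, hq, hq', hq''⟩ := hjirr U (Set.range i) hU hi.isOpen_range ⟨_, ⟨y, rfl⟩, hp⟩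
        (by rwa [Set.inter_comm])
      exact ⟨q, hq'', hq'⟩
  haveI : IrreducibleSpace P := by
    haveI : PreirreducibleSpace P := ⟨fun U V hU hV hU' hV' ↦ by
      rw [Set.univ_inter] at hU' hV' ⊢
      obtain ⟨q, -, hq⟩ := hiirr U V hU hV (key U hU hU') (key V hV hV')
      exact ⟨q, hq⟩⟩
    exact ⟨inferInstance⟩
  exact isIntegral_of_irreducibleSpace_of_isReduced P

end TwoCover

instance (n : ℕ) : IsNoetherianRing (AnR n) := Algebra.FiniteType.isNoetherianRing ℂ _

/-! ### Properness of the blow-up by the valuative criterion -/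

section ValuationRing

variable (R K : Type) [CommRing R] [IsDomain R] [ValuationRing R] [Field K] [Algebra R K]
  [IsFractionRing R K]

lemma appTop_specMap_fractionRing_injective : Function.Injective
    (Spec.map (CommRingCat.ofHom (algebraMap R K))).appTop.hom := by
  have h := Scheme.ΓSpecIso_inv_naturality (CommRingCat.ofHom (algebraMap R K))
  have h2 : (Spec.map (CommRingCat.ofHom (algebraMap R K))).appTop =
      (Scheme.ΓSpecIso (CommRingCat.of R)).hom ≫ CommRingCat.ofHom (algebraMap R K) ≫
        (Scheme.ΓSpecIso (CommRingCat.of K)).inv := by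
    rw [h, Iso.hom_inv_id_assoc]
  rw [h2]
  exact ((Scheme.ΓSpecIso (CommRingCat.of K)).symm.commRingCatIsoToRingEquiv.injective.comp
    (IsFractionRing.injective R K)).comp
    (Scheme.ΓSpecIso (CommRingCat.of R)).commRingCatIsoToRingEquiv.injective

lemma exists_appTop_specMap_fractionRing (a : Γ(Spec (CommRingCat.of K), ⊤)) :
    (∃ b, (Spec.map (CommRingCat.ofHom (algebraMap R K))).appTop.hom b = a) ∨
      ∃ b, (Spec.map (CommRingCat.ofHom (algebraMap R K))).appTop.hom b * a = 1 := by
  have h := Scheme.ΓSpecIso_inv_naturality (CommRingCat.ofHom (algebraMap R K))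
  have h' (r : R) : (Spec.map (CommRingCat.ofHom (algebraMap R K))).appTop.hom
      ((Scheme.ΓSpecIso (CommRingCat.of R)).inv.hom r) =
      (Scheme.ΓSpecIso (CommRingCat.of K)).inv.hom (algebraMap R K r) :=
    (RingHom.congr_fun (congrArg CommRingCat.Hom.hom h) r).symm
  obtain ⟨c, rfl⟩ : ∃ c : K, (Scheme.ΓSpecIso (CommRingCat.of K)).inv.hom c = a :=
    (Scheme.ΓSpecIso (CommRingCat.of K)).symm.commRingCatIsoToRingEquiv.surjective a
  rcases (ValuationRing.iff_isInteger_or_isInteger R K).mp inferInstance c with ⟨b, hb⟩ | ⟨b, hb⟩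
  · exact .inl ⟨_, (h' b).trans (by rw [hb])⟩
  · by_cases hc : c = 0
    · exact .inl ⟨_, (h' 0).trans (by rw [hc, map_zero])⟩
    · right
      refine ⟨(Scheme.ΓSpecIso (CommRingCat.of R)).inv.hom b, ?_⟩
      · rw [h', hb, ← map_mul, inv_mul_cancel₀ hc, map_one]

end ValuationRing

namespace IsChartBlowup

variable {k : ℕ} {B W : Scheme.{0}} {f : B ⟶ SpecAn (k + 1)} {inl : SpecAn 0 ⟶ B}
  {inr : SpecAn k ⟶ B} (hB : IsChartBlowup k f inl inr)
include hB

/-- The converse to `transit`. From `ψ` one builds a map to the second chart whose coordinate is the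
inverse of `y/x`; it must be `ψ'`, as `inr` is a monomorphism. -/
lemma mul_eq_one (ψ : W ⟶ SpecAn 0) (ψ' : W ⟶ SpecAn k) (h : ψ ≫ inl = ψ' ≫ inr) :
    pull ψ (cz 0) * pull ψ' (cx k) = 1 := by
  haveI := hB.isOpenImmersion_inr
  have hz0 := cx_mul_cz 0
  simp only [zero_add, pow_one] at hz0
  obtain ⟨u, hu⟩ := (isUnit_pull_iff_nonvanishingAt ψ (cz 0)).mpr fun w ↦ by
    have := congrArg (fun g : W ⟶ B ↦ g w) h
    simp only [Scheme.Hom.comp_apply] at this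
    exact (hB.overlap _ _ this).1
  have huu : (u : Γ(W, ⊤)) * (u⁻¹ : Γ(W, ⊤)ˣ) = 1 := by simp
  let τ := ψ ≫ Spec.map (CommRingCat.ofHom (chartOne (k + 1)))
  have hx : pull τ (cx (k + 1)) = pull ψ (cx 0) := by simp [τ, pull_comp_specMap, chartOne]
  have hy : pull τ (cy (k + 1)) = pull ψ (cx 0) * u := by
    rw [hu, ← map_mul, hz0]; simp [τ, pull_comp_specMap, chartOne]
  have hz : pull τ (cz (k + 1)) = pull ψ (cx 0) ^ (k + 1) * (u : Γ(W, ⊤)) ^ (k + 2) := by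
    rw [hu, ← map_pow, ← map_pow, ← map_mul]; simp [τ, pull_comp_specMap, chartOne]
  obtain ⟨χ, hχ, hχx⟩ := exists_chartTwo τ (u⁻¹ : Γ(W, ⊤)ˣ)
    (by rw [hx, hy, mul_assoc, huu, mul_one])
    (by
      rw [hz, hy]
      linear_combination (pull ψ (cx 0) ^ (k + 1) * (u : Γ(W, ⊤)) ^ (k + 1)) * huu)
  have h1 := hB.transit ψ χ (by rw [← hu, hχx, huu])
    (by rw [hB.inl_comp, hB.inr_comp, hχ])
  rw [h, cancel_mono] at h1
  rw [h1, ← hu, hχx, huu]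

/-- All points of a local spectrum specialize to the closed point, so the chart containing its image
contains everything. -/
lemma factor_of_isLocalRing {R : Type} [CommRing R] [IsLocalRing R]
    (β : Spec (CommRingCat.of R) ⟶ B) : (∃ ψ, ψ ≫ inl = β) ∨ ∃ ψ, ψ ≫ inr = β := by
  haveI := hB.isOpenImmersion_inl
  haveI := hB.isOpenImmersion_inr
  have key {X : Scheme.{0}} (i : X ⟶ B) [IsOpenImmersion i]
      (hx : ∃ x, i x = β (IsLocalRing.closedPoint R)) : ∃ ψ, ψ ≫ i = β := by
    refine exists_factor i β fun z ↦ ?_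
    have h1 : z ⤳ (IsLocalRing.closedPoint R : Spec (CommRingCat.of R)) :=
      IsLocalRing.specializes_closedPoint (R := R) z
    exact (h1.map β.continuous).mem_open i.isOpenEmbedding.isOpen_range hx
  rcases hB.cover (β (IsLocalRing.closedPoint R)) with h | h
  · exact .inl (key inl h)
  · exact .inr (key inr h)

/-- In a valuation ring `y/x` or its inverse is integral, and this decides which chart receives the
extension. If that is not the chart of the given `K`-point, `transit` compares the two. -/
lemma existence : ValuativeCriterion.Existence f := by
  rintro ⟨R, K, i₁, τ, ⟨hsq⟩⟩
  rw [CommSq.HasLift.iff]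
  set g : Spec (CommRingCat.of K) ⟶ Spec (CommRingCat.of R) :=
    Spec.map (CommRingCat.ofHom (algebraMap R K))
  have hinj : Function.Injective g.appTop.hom := appTop_specMap_fractionRing_injective R K
  have hval := exists_appTop_specMap_fractionRing R K
  have hz0 := cx_mul_cz 0
  simp only [zero_add, pow_one] at hz0
  rcases hB.factor_of_isLocalRing i₁ with ⟨ψ, rfl⟩ | ⟨ψ, rfl⟩
  · rw [Category.assoc, hB.inl_comp] at hsq
    have hp (r : AnR (k + 1)) : g.appTop.hom (pull τ r) = pull ψ (chartOne (k + 1) r) := by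
      rw [← pull_comp, ← hsq, pull_comp_specMap]; rfl
    have hx := hp (cx (k + 1))
    have hy := hp (cy (k + 1))
    have hz := hp (cz (k + 1))
    simp only [chartOne, liftAn_cx, liftAn_cy, liftAn_cz, map_mul, map_pow] at hx hy hz
    rw [← hz0, map_mul] at hy
    rcases hval (pull ψ (cz 0)) with ⟨b, hb⟩ | ⟨b, hb⟩
    · obtain ⟨ψ', h, hψz, hψx⟩ := exists_chartOne τ b
        (hinj (by rw [map_mul, hx, hy, hb]))
        (hinj (by rw [map_mul, map_pow, map_pow, hx, hz, hb]))
      refine ⟨ψ' ≫ inl, ?_, by rw [Category.assoc, hB.inl_comp, h]⟩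
      rw [← Category.assoc]
      congr 1
      apply pull_injective
      have hx' : pull (g ≫ ψ') (cx 0) = pull ψ (cx 0) := by rw [pull_comp, hψx, hx]
      have hz' : pull (g ≫ ψ') (cz 0) = pull ψ (cz 0) := by rw [pull_comp, hψz, hb]
      apply anRing_hom_ext
      · ext r
        have h1 := hp (algebraMap ℂ _ r)
        rw [← h, pull_comp_specMap] at h1
        simpa [chartOne, pull_comp] using h1
      · exact hx'
      · rw [← hz0, map_mul, map_mul, hx', hz']
      · exact hz'
    · obtain ⟨ψ', h, hψx⟩ := exists_chartTwo τ b
        (hinj (by rw [map_mul, hx, hy]; linear_combination (-pull ψ (cx 0)) * hb))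
        (hinj (by
          rw [map_mul, map_pow, hy, hz]
          linear_combination (pull ψ (cx 0) ^ (k + 1) * pull ψ (cz 0) ^ (k + 1)) * hb))
      refine ⟨ψ' ≫ inr, ?_, by rw [Category.assoc, hB.inr_comp, h]⟩
      rw [← Category.assoc]
      refine (hB.transit _ _ ?_ ?_).symm
      · rw [pull_comp, hψx, mul_comm, hb]
      · rw [hB.inl_comp, hB.inr_comp, hsq, Category.assoc, h]
  · rw [Category.assoc, hB.inr_comp] at hsq
    have hp (r : AnR (k + 1)) : g.appTop.hom (pull τ r) = pull ψ (chartTwo k r) := by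
      rw [← pull_comp, ← hsq, pull_comp_specMap]; rfl
    have hx := hp (cx (k + 1))
    have hy := hp (cy (k + 1))
    have hz := hp (cz (k + 1))
    simp only [chartTwo, liftAn_cx, liftAn_cy, liftAn_cz, map_mul] at hx hy hz
    have hxz := pull_cx_mul_cz ψ
    rcases hval (pull ψ (cx k)) with ⟨b, hb⟩ | ⟨b, hb⟩
    · obtain ⟨ψ', h, hψx⟩ := exists_chartTwo τ b
        (hinj (by rw [map_mul, hx, hy, hb, mul_comm]))
        (hinj (by rw [map_mul, map_pow, hy, hz, hb, hxz]))
      refine ⟨ψ' ≫ inr, ?_, by rw [Category.assoc, hB.inr_comp, h]⟩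
      rw [← Category.assoc]
      congr 1
      have h2 := congrArg (fun t ↦ pull (g ≫ t)) h
      apply pull_injective
      apply anRing_hom_ext
      · ext r
        have h1 := hp (algebraMap ℂ _ r)
        rw [← h, pull_comp_specMap] at h1
        simpa [chartTwo, pull_comp] using h1
      · rw [pull_comp, hψx, hb]
      · have h1 := hp (cy (k + 1))
        rw [← h, pull_comp_specMap] at h1
        simpa [chartTwo, pull_comp] using h1
      · have h1 := hp (cz (k + 1))
        rw [← h, pull_comp_specMap] at h1
        simpa [chartTwo, pull_comp] using h1
    · obtain ⟨ψ', h, hψz, -⟩ := exists_chartOne τ b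
        (hinj (by rw [map_mul, hx, hy]; linear_combination (-pull ψ (cy k)) * hb))
        (hinj (by
          rw [map_mul, map_pow, map_pow, hx, hz, mul_pow, ← hxz]
          have : (g.appTop.hom b * pull ψ (cx k)) ^ (k + 2) = 1 := by rw [hb, one_pow]
          linear_combination (-pull ψ (cz k)) * this))
      refine ⟨ψ' ≫ inl, ?_, by rw [Category.assoc, hB.inl_comp, h]⟩
      rw [← Category.assoc]
      refine hB.transit _ _ ?_ ?_
      · rw [pull_comp, hψz, hb]
      · rw [hB.inl_comp, hB.inr_comp, hsq, Category.assoc, h]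

lemma uniqueness : ValuativeCriterion.Uniqueness f := by
  rintro ⟨R, K, i₁, τ, hsq⟩
  haveI := hB.isOpenImmersion_inl
  haveI := hB.isOpenImmersion_inr
  set g : Spec (CommRingCat.of K) ⟶ Spec (CommRingCat.of R) :=
    Spec.map (CommRingCat.ofHom (algebraMap R K))
  have hinj : Function.Injective g.appTop.hom := appTop_specMap_fractionRing_injective R K
  have hepi {n : ℕ} (ψ ψ' : Spec (CommRingCat.of R) ⟶ SpecAn n) (h : g ≫ ψ = g ≫ ψ') : ψ = ψ' := by
    apply pull_injective
    ext r
    apply hinj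
    rw [← pull_comp, ← pull_comp, h]
  have hmix (ψ : Spec (CommRingCat.of R) ⟶ SpecAn 0) (ψ' : Spec (CommRingCat.of R) ⟶ SpecAn k)
      (h : g ≫ ψ ≫ inl = g ≫ ψ' ≫ inr) (h' : ψ ≫ inl ≫ f = ψ' ≫ inr ≫ f) :
      ψ ≫ inl = ψ' ≫ inr := by
    refine hB.transit _ _ (hinj ?_) h'
    rw [map_mul, map_one, ← pull_comp, ← pull_comp]
    exact hB.mul_eq_one _ _ (by simpa using h)
  constructor
  rintro ⟨l, h1, h2⟩ ⟨l', h1', h2'⟩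
  have h3 : g ≫ l = g ≫ l' := h1.trans h1'.symm
  have h4 : l ≫ f = l' ≫ f := h2.trans h2'.symm
  suffices l = l' by subst this; rfl
  clear h1 h2 h1' h2'
  rcases hB.factor_of_isLocalRing l with ⟨ψ, rfl⟩ | ⟨ψ, rfl⟩ <;>
  rcases hB.factor_of_isLocalRing l' with ⟨ψ', rfl⟩ | ⟨ψ', rfl⟩
  · rw [hepi ψ ψ' (by rwa [← Category.assoc, ← Category.assoc, cancel_mono] at h3)]
  · exact hmix ψ ψ' h3 (by simpa using h4)
  · exact (hmix ψ' ψ h3.symm (by simpa using h4.symm)).symm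
  · rw [hepi ψ ψ' (by rwa [← Category.assoc, ← Category.assoc, cancel_mono] at h3)]

lemma isIntegral : IsIntegral B := by
  haveI := hB.isOpenImmersion_inl
  haveI := hB.isOpenImmersion_inr
  have : (cz 0 : AnR 0) ∉ (⊥ : Ideal (AnR 0)) := by simpa using cz_ne_zero 0
  let p : SpecAn 0 := (⟨⊥, Ideal.isPrime_bot⟩ : PrimeSpectrum (AnR 0))
  obtain ⟨q, hq⟩ := hB.inl_mem p this
  exact isIntegral_of_cover hB.cover hq.symm

lemma isProper : IsProper f := by
  haveI := hB.isOpenImmersion_inl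
  haveI := hB.isOpenImmersion_inr
  let 𝒰 := twoCover inl inr hB.cover
  haveI : IsLocallyNoetherian B := by
    rw [isLocallyNoetherian_iff_openCover 𝒰]
    rintro (_ | _)
    · exact inferInstanceAs (IsLocallyNoetherian (SpecAn k))
    · exact inferInstanceAs (IsLocallyNoetherian (SpecAn 0))
  haveI : CompactSpace B := by
    constructor
    have : (Set.univ : Set B) = Set.range inl ∪ Set.range inr := by
      ext b; simpa using hB.cover b
    rw [this]
    exact (isCompact_range inl.continuous).union (isCompact_range inr.continuous)
  haveI : QuasiCompact f := inferInstance
  haveI : QuasiSeparated f := inferInstance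
  haveI : LocallyOfFiniteType f := by
    have hft {m n : ℕ} (ψ : AnR m →+* AnR n) (hψ : ψ.comp (algebraMap ℂ _) = algebraMap ℂ _) :
        LocallyOfFiniteType (Spec.map (CommRingCat.ofHom ψ)) := by
      rw [HasRingHomProperty.Spec_iff (P := @LocallyOfFiniteType)]
      refine RingHom.FiniteType.of_comp_finiteType (f := algebraMap ℂ (AnR m)) ?_
      rw [CommRingCat.hom_ofHom, hψ, RingHom.finiteType_algebraMap]
      infer_instance
    haveI : IsZariskiLocalAtSource @LocallyOfFiniteType.{0} :=
      HasRingHomProperty.instIsZariskiLocalAtSource (Q := RingHom.FiniteType)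
    refine IsZariskiLocalAtSource.of_openCover (P := @LocallyOfFiniteType.{0}) 𝒰 ?_
    rintro (_ | _)
    · change LocallyOfFiniteType (inr ≫ f)
      rw [hB.inr_comp]
      exact hft _ (liftAn_comp_algebraMap ..)
    · change LocallyOfFiniteType (inl ≫ f)
      rw [hB.inl_comp]
      exact hft _ (liftAn_comp_algebraMap ..)
  exact IsProper.of_valuativeCriterion f
    (ValuativeCriterion.iff.mpr ⟨hB.existence, hB.uniqueness⟩)

end IsChartBlowup

end DerBlowup

namespace DerBlowup

/-! ### Extending a modification of an open chart to the whole surface -/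

section Glued

open Limits

/-- A modification `f` of an open subscheme `A` of `X` which is an isomorphism over `A ∩ X₀` extends
to a modification of `X = A ∪ X₀`. -/
lemma exists_glued_modification {A B X : Scheme.{0}} (f : B ⟶ A) (j : A ⟶ X) [IsOpenImmersion j]
    (X₀ : X.Opens) (hcov : ∀ x, x ∈ X₀ ∨ ∃ p, j p = x) [IsIso (f ∣_ (j ⁻¹ᵁ X₀))] [IsProper f]
    [IsIntegral B] [IsIntegral X] (hne : ∃ p, j p ∈ X₀) :
    ∃ (X' : Scheme.{0}) (g : X' ⟶ X) (a : (X₀ : Scheme) ⟶ X') (b : B ⟶ X'),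
      IsOpenImmersion a ∧ IsOpenImmersion b ∧ a ≫ g = X₀.ι ∧ b ≫ g = f ≫ j ∧
      (∀ x, g x ∈ X₀ ↔ ∃ y, a y = x) ∧ (∀ x, (∃ p, j p = g x) ↔ ∃ y, b y = x) ∧
      IsIso (g ∣_ X₀) ∧ IsProper g ∧ IsIntegral X' := by
  let A₀ := j ⁻¹ᵁ X₀
  let B₀ := f ⁻¹ᵁ A₀
  let i : (B₀ : Scheme) ⟶ X₀ := f ∣_ A₀ ≫ j ∣_ X₀
  have hi : i ≫ X₀.ι = B₀.ι ≫ f ≫ j := by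
    simp only [i, Category.assoc, morphismRestrict_ι, A₀]
    rw [morphismRestrict_ι_assoc]
  obtain ⟨X', a, b, ha, hb, hp, hcov', hover⟩ := exists_glue i B₀.ι
  let g : X' ⟶ X := hp.desc X₀.ι (f ≫ j) hi
  have hag : a ≫ g = X₀.ι := hp.inl_desc _ _ _
  have hbg : b ≫ g = f ≫ j := hp.inr_desc _ _ _
  have hga (x : (X₀ : Scheme)) : g (a x) = X₀.ι x := by rw [← Scheme.Hom.comp_apply, hag]
  have hgb (x) : g (b x) = j (f x) := by
    rw [← Scheme.Hom.comp_apply, hbg, Scheme.Hom.comp_apply]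
  have hB₀ (u : (B₀ : Scheme)) : b (B₀.ι u) = a (i u) := by
    rw [← Scheme.Hom.comp_apply, ← Scheme.Hom.comp_apply, hp.w]
  have h1 (x) : g x ∈ X₀ ↔ ∃ y, a y = x := by
    constructor
    · intro hx
      rcases hcov' x with h | ⟨y, rfl⟩
      · exact h
      · rw [hgb] at hx
        exact ⟨_, (hB₀ ⟨y, hx⟩).symm⟩
    · rintro ⟨y, rfl⟩
      rw [hga]
      exact y.2
  have h2 (x) : (∃ p, j p = g x) ↔ ∃ y, b y = x := by
    constructor
    · rintro ⟨p, hpx⟩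
      rcases hcov' x with ⟨y, rfl⟩ | h
      · rw [hga] at hpx
        have hpA : p ∈ A₀ := by
          change j p ∈ X₀
          rw [hpx]
          exact y.2
        obtain ⟨u, hu⟩ := (f ∣_ A₀).homeomorph.surjective ⟨p, hpA⟩
        refine ⟨B₀.ι u, ?_⟩
        rw [hB₀]
        congr 1
        apply Subtype.ext
        change X₀.ι (i u) = _
        rw [← Scheme.Hom.comp_apply, hi]
        change j (f u.1) = _
        have h3 : f (B₀.ι u) = p := by
          rw [← Scheme.Hom.comp_apply, ← morphismRestrict_ι, Scheme.Hom.comp_apply]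
          exact congrArg A₀.ι hu
        exact (congrArg j h3).trans hpx
      · exact h
    · rintro ⟨y, rfl⟩
      exact ⟨f y, (hgb y).symm⟩
  have e1 : g ⁻¹ᵁ X₀ = a.opensRange := by
    ext x
    exact h1 x
  have e2 : g ⁻¹ᵁ j.opensRange = b.opensRange := by
    ext x
    exact h2 x
  refine ⟨X', g, a, b, ha, hb, hag, hbg, h1, h2,
    isIso_morphismRestrict_of_opensRange_eq g X₀ a hag e1, ?_, ?_⟩
  -- Over the chart the map is `f`, over `X₀` it is the identity.
  · refine IsZariskiLocalAtTarget.of_openCover (P := @IsProper) (twoCover X₀.ι j fun x ↦ ?_) ?_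
    · rcases hcov x with h | h
      · exact .inl ⟨⟨x, h⟩, rfl⟩
      · exact .inr h
    rintro (_ | _)
    · have h := IsOpenImmersion.isPullback f b j g hbg e2
      change IsProper (pullback.snd g j)
      rw [← h.flip.isoPullback_inv_snd]
      infer_instance
    · have h := IsOpenImmersion.isPullback (𝟙 _) a X₀.ι g (by rw [hag, Category.id_comp])
        (by rw [Scheme.Opens.opensRange_ι, e1])
      change IsProper (pullback.snd g X₀.ι)
      rw [← h.flip.isoPullback_inv_snd]
      infer_instance
  · obtain ⟨p, hpX⟩ := hne
    haveI : Nonempty X₀ := ⟨⟨_, hpX⟩⟩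
    obtain ⟨u, hu⟩ := (f ∣_ A₀).homeomorph.surjective ⟨p, hpX⟩
    exact isIntegral_of_cover hcov' (hB₀ u).symm

end Glued

end DerBlowup

/-! ### Surfaces with one `A_m` chart, and the blow-up of `(x, y)` in it -/

namespace DerBlowup

/-- Every nonempty open of the integral scheme `Z` meets the preimage of `U`, where lifts are
determined; separatedness spreads the uniqueness and the local lifts glue. -/
lemma existsUnique_lift_of_local {X Y Z : Scheme.{0}} (g : Y ⟶ X) [IsSeparated g] [IsIntegral Z]
    (U : X.Opens) [IsIso (g ∣_ U)] (σ : Z ⟶ X) (hU : ∃ z, σ z ∈ U)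
    (hloc : ∀ z : Z, ∃ V : Z.Opens, z ∈ V ∧ ∃ β : (V : Scheme) ⟶ Y, β ≫ g = V.ι ≫ σ) :
    ∃! β : Z ⟶ Y, β ≫ g = σ := by
  obtain ⟨z, hz⟩ := hU
  have huniq (W : Scheme.{0}) (i : W ⟶ Z) [IsOpenImmersion i] (β β' : W ⟶ Y)
      (h : β ≫ g = i ≫ σ) (h' : β' ≫ g = i ≫ σ) : β = β' := by
    by_cases hW : Nonempty W
    · haveI : IsIntegral W := isIntegral_of_isOpenImmersion i
      obtain ⟨_, ⟨w, rfl⟩, hw⟩ : (Set.range i ∩ (σ ⁻¹ᵁ U : Z.Opens)).Nonempty :=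
        nonempty_preirreducible_inter i.isOpenEmbedding.isOpen_range (σ ⁻¹ᵁ U).isOpen
          (Set.range_nonempty _) ⟨z, hz⟩
      refine lift_unique g U (h.trans h'.symm) w ?_
      rw [h, Scheme.Hom.comp_apply]
      exact hw
    · exact Scheme.hom_ext_of_forall _ _ fun w ↦ (hW ⟨w⟩).elim
  obtain ⟨β, hβ⟩ := exists_lift_of_local g σ hloc huniq
  exact ⟨β, hβ, fun β' hβ' ↦ huniq Z (𝟙 Z) _ _ (by simpa using hβ') (by simpa using hβ)⟩

/-- The structure morphism of the surface `A_n`. -/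
abbrev anStr (n : ℕ) : SpecAn n ⟶ Spec (CommRingCat.of ℂ) :=
  Spec.map (CommRingCat.ofHom (algebraMap ℂ (AnR n)))

/-- The surface `A_0` is the affine plane. -/
instance smooth_anR_zero : Algebra.Smooth ℂ (AnR 0) := by
  let φ : MvPolynomial (Fin 2) ℂ →ₐ[ℂ] AnR 0 := MvPolynomial.aeval ![cx 0, cz 0]
  let ψ₀ : AnR 0 →+* MvPolynomial (Fin 2) ℂ := liftAn 0 (algebraMap ℂ _) (MvPolynomial.X 0)
    (MvPolynomial.X 0 * MvPolynomial.X 1) (MvPolynomial.X 1) (by ring)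
  let ψ : AnR 0 →ₐ[ℂ] MvPolynomial (Fin 2) ℂ :=
    { ψ₀ with commutes' := fun r ↦ liftAn_algebraMap _ _ }
  have h := cx_mul_cz 0
  simp only [zero_add, pow_one] at h
  have h1 : φ.comp ψ = AlgHom.id ℂ _ := by
    have : (φ : MvPolynomial (Fin 2) ℂ →+* AnR 0).comp ψ₀ = RingHom.id _ := by
      apply anRing_hom_ext
      · ext r; simp [ψ₀]
      · simp [ψ₀, φ]
      · simp [ψ₀, φ, h]
      · simp [ψ₀, φ]
    ext r
    exact RingHom.congr_fun this r
  have h2 : ψ.comp φ = AlgHom.id ℂ _ := by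
    apply MvPolynomial.algHom_ext
    intro i
    change ψ₀ (φ _) = _
    fin_cases i <;> simp [φ, ψ₀]
  haveI : Algebra.Smooth ℂ (MvPolynomial (Fin 2) ℂ) := ⟨inferInstance, inferInstance⟩
  exact Algebra.Smooth.of_equiv (AlgEquiv.ofAlgHom φ ψ h1 h2)

instance smooth_anStr_zero : Smooth (anStr 0) := by
  rw [HasRingHomProperty.Spec_iff (P := @Smooth)]
  rw [CommRingCat.hom_ofHom, RingHom.smooth_algebraMap]
  infer_instance

/-- `j : A_m ⟶ X` is an open immersion onto a neighbourhood of the only possibly singular point of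
the integral surface `X`. -/
structure IsAnChart {X : Scheme.{0}} (m : ℕ) (s : X ⟶ Spec (CommRingCat.of ℂ)) (j : SpecAn m ⟶ X)
    (X₀ : X.Opens) : Prop where
  integral : IsIntegral X
  isOpenImmersion : IsOpenImmersion j
  comp : j ≫ s = anStr m
  cover : ∀ x, x ∈ X₀ ∨ ∃ p, j p = x
  mem_iff : ∀ p, j p ∈ X₀ ↔ p ≠ origin m
  smooth : Smooth (X₀.ι ≫ s)

/-- Locally on `Z`, the pullback along `σ` of the ideal `(x, y)` of the chart `j` is principal,
generated by `x` or `y`. -/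
def PrincipalAlong {m : ℕ} {X Z : Scheme.{0}} (j : SpecAn m ⟶ X) (σ : Z ⟶ X) : Prop :=
  ∀ z, (∃ p, j p = σ z) → ∃ V : Z.Opens, z ∈ V ∧ ∃ τ : (V : Scheme) ⟶ SpecAn m,
    τ ≫ j = V.ι ≫ σ ∧ PrincipalXY τ

lemma PrincipalXY.comp {m : ℕ} {W Z : Scheme.{0}} {τ : Z ⟶ SpecAn m} (hτ : PrincipalXY τ)
    (h : W ⟶ Z) : PrincipalXY (h ≫ τ) := by
  rw [PrincipalXY, pull_comp, pull_comp]
  exact hτ.imp (map_dvd _) (map_dvd _)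

lemma PrincipalAlong.comp {m : ℕ} {X Z Z' : Scheme.{0}} {j : SpecAn m ⟶ X} {σ : Z ⟶ X}
    (hσ : PrincipalAlong j σ) (h : Z' ⟶ Z) : PrincipalAlong j (h ≫ σ) := by
  intro z hz
  obtain ⟨V, hV, τ, hτ, hp⟩ := hσ (h z) (by rwa [Scheme.Hom.comp_apply] at hz)
  refine ⟨h ⁻¹ᵁ V, hV, h ∣_ V ≫ τ, ?_, hp.comp _⟩
  rw [Category.assoc, hτ, morphismRestrict_ι_assoc]

lemma PrincipalAlong.of_opensRange {m : ℕ} {X Y Z : Scheme.{0}} {j : SpecAn m ⟶ X} {σ : Z ⟶ X}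
    (i : Y ⟶ Z) [IsOpenImmersion i] (τ : Y ⟶ SpecAn m) (h : τ ≫ j = i ≫ σ) (hp : PrincipalXY τ)
    (y : Y) : ∃ V : Z.Opens, i y ∈ V ∧ ∃ τ : (V : Scheme) ⟶ SpecAn m,
      τ ≫ j = V.ι ≫ σ ∧ PrincipalXY τ :=
  ⟨i.opensRange, ⟨y, rfl⟩, i.isoOpensRange.inv ≫ τ, by
    rw [Category.assoc, h, Scheme.Hom.isoOpensRange_inv_comp_assoc], hp.comp _⟩

/-- `g : X₁ ⟶ X` is the blow-up of the ideal `(x, y)` of the chart `j`. -/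
structure IsChartModification {X X₁ : Scheme.{0}} {k : ℕ} (j : SpecAn (k + 1) ⟶ X) (X₀ : X.Opens)
    (g : X₁ ⟶ X) (j₀ : SpecAn 0 ⟶ X₁) (j₁ : SpecAn k ⟶ X₁) (X₁₀ : X₁.Opens) : Prop where
  isProper : IsProper g
  isIso : IsIso (g ∣_ X₀)
  isOpenImmersion : IsOpenImmersion j₀
  comp_zero : j₀ ≫ g = Spec.map (CommRingCat.ofHom (chartOne (k + 1))) ≫ j
  comp_one : j₁ ≫ g = Spec.map (CommRingCat.ofHom (chartTwo k)) ≫ j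
  cover : ∀ x, (∃ p, j p = g x) → (∃ q, j₀ q = x) ∨ ∃ q, j₁ q = x
  le : g ⁻¹ᵁ X₀ ≤ X₁₀
  principalAlong : PrincipalAlong j g
  universal : ∀ (Z : Scheme.{0}) (σ : Z ⟶ X), IsIntegral Z → (∃ z, σ z ∈ X₀) →
    PrincipalAlong j σ → ∃! β : Z ⟶ X₁, β ≫ g = σ

lemma ne_origin_of_nonvanishingAt {m : ℕ} {p : SpecAn m} (h : NonvanishingAt (cx m) p ∨
    NonvanishingAt (cy m) p ∨ NonvanishingAt (cz m) p) : p ≠ origin m := by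
  rintro rfl
  have := not_nonvanishingAt_origin m
  tauto

lemma IsChartBlowup.comp_inr_ne_origin_iff {k : ℕ} {B : Scheme.{0}} {f : B ⟶ SpecAn (k + 1)}
    {inl : SpecAn 0 ⟶ B} {inr : SpecAn k ⟶ B} (hB : IsChartBlowup k f inl inr) (q : SpecAn k) :
    f (inr q) ≠ origin (k + 1) ↔ NonvanishingAt (cy k) q ∨ NonvanishingAt (cz k) q := by
  constructor
  · intro h
    have h3 := nonvanishingAt_of_ne_origin _ h
    rw [hB.nonvanishingAt_inr_iff, hB.nonvanishingAt_inr_iff, hB.nonvanishingAt_inr_iff] at h3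
    simp only [chartTwo, liftAn_cx, liftAn_cy, liftAn_cz, nonvanishingAt_mul] at h3
    tauto
  · intro h
    refine ne_origin_of_nonvanishingAt (.inr ?_)
    rw [hB.nonvanishingAt_inr_iff, hB.nonvanishingAt_inr_iff]
    simpa only [chartTwo, liftAn_cy, liftAn_cz] using h

lemma smooth_sup_ι {X Y Z S : Scheme.{0}} {s : X ⟶ S} (a : Y ⟶ X) (b : Z ⟶ X) [IsOpenImmersion a]
    [IsOpenImmersion b] (ha : Smooth (a ≫ s)) (hb : Smooth (b ≫ s)) :
    Smooth ((a.opensRange ⊔ b.opensRange).ι ≫ s) := by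
  set T := a.opensRange ⊔ b.opensRange
  obtain ⟨a', ha'⟩ := exists_factor T.ι a fun z ↦ ⟨⟨a z, .inl ⟨z, rfl⟩⟩, rfl⟩
  obtain ⟨b', hb'⟩ := exists_factor T.ι b fun z ↦ ⟨⟨b z, .inr ⟨z, rfl⟩⟩, rfl⟩
  haveI : IsOpenImmersion (a' ≫ T.ι) := by rw [ha']; infer_instance
  haveI : IsOpenImmersion (b' ≫ T.ι) := by rw [hb']; infer_instance
  haveI : IsOpenImmersion a' := .of_comp a' T.ι
  haveI : IsOpenImmersion b' := .of_comp b' T.ι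
  haveI : IsZariskiLocalAtSource @Smooth.{0} :=
    HasRingHomProperty.instIsZariskiLocalAtSource (Q := RingHom.Smooth)
  refine IsZariskiLocalAtSource.of_openCover (P := @Smooth.{0}) (twoCover a' b' ?_) ?_
  · rintro ⟨x, ⟨z, hz⟩ | ⟨z, hz⟩⟩
    · exact .inl ⟨z, T.ι.isOpenEmbedding.injective
        (by rw [← Scheme.Hom.comp_apply, ha']; exact hz)⟩
    · exact .inr ⟨z, T.ι.isOpenEmbedding.injective
        (by rw [← Scheme.Hom.comp_apply, hb']; exact hz)⟩
  · rintro (_ | _)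
    · change Smooth (b' ≫ T.ι ≫ s)
      rwa [← Category.assoc, hb']
    · change Smooth (a' ≫ T.ι ≫ s)
      rwa [← Category.assoc, ha']

/-- The blow-up of the chart is glued to `X₀`. The new smooth part is the old one together with the
plane chart, and of the chart `A_k` only the origin lies outside it. -/
theorem IsAnChart.exists_chartModification {X : Scheme.{0}} {k : ℕ}
    {s : X ⟶ Spec (CommRingCat.of ℂ)} {j : SpecAn (k + 1) ⟶ X} {X₀ : X.Opens}
    (h : IsAnChart (k + 1) s j X₀) :
    ∃ (X₁ : Scheme.{0}) (g : X₁ ⟶ X) (j₀ : SpecAn 0 ⟶ X₁) (j₁ : SpecAn k ⟶ X₁) (X₁₀ : X₁.Opens),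
      IsAnChart k (g ≫ s) j₁ X₁₀ ∧ IsChartModification j X₀ g j₀ j₁ X₁₀ := by
  obtain ⟨B, f, inl, inr, hB⟩ := exists_isChartBlowup k
  haveI := h.isOpenImmersion
  haveI := h.integral
  haveI := hB.isProper
  haveI := hB.isIntegral
  haveI := hB.isOpenImmersion_inl
  haveI := hB.isOpenImmersion_inr
  haveI : IsIso (f ∣_ (j ⁻¹ᵁ X₀)) :=
    isIso_morphismRestrict_of_existsUnique _ _ fun W τ hτ ↦
      hB.existsUnique_lift_of_ne_origin τ fun w ↦ (h.mem_iff _).mp (hτ w)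
  have hgen : (⟨⊥, Ideal.isPrime_bot⟩ : PrimeSpectrum (AnR (k + 1))) ≠ origin (k + 1) :=
    ne_origin_of_nonvanishingAt (m := k + 1) (.inr (.inr (by
      change cz (k + 1) ∉ (⊥ : Ideal _)
      simpa using cz_ne_zero (k + 1))))
  obtain ⟨X₁, g, a, b, ha, hb, hag, hbg, h1, h2, hiso, hproper, hint⟩ :=
    exists_glued_modification f j X₀ h.cover ⟨_, (h.mem_iff _).mpr hgen⟩
  have hgb (x) : g (b x) = j (f x) := by
    rw [← Scheme.Hom.comp_apply, hbg, Scheme.Hom.comp_apply]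
  have hc0 : (inl ≫ b) ≫ g = Spec.map (CommRingCat.ofHom (chartOne (k + 1))) ≫ j := by
    rw [Category.assoc, hbg, ← Category.assoc, hB.inl_comp]
  have hc1 : (inr ≫ b) ≫ g = Spec.map (CommRingCat.ofHom (chartTwo k)) ≫ j := by
    rw [Category.assoc, hbg, ← Category.assoc, hB.inr_comp]
  have hcov (x) (hx : ∃ p, j p = g x) : (∃ q, (inl ≫ b) q = x) ∨ ∃ q, (inr ≫ b) q = x := by
    obtain ⟨y, rfl⟩ := (h2 x).mp hx
    rcases hB.cover y with ⟨q, rfl⟩ | ⟨q, rfl⟩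
    · exact .inl ⟨q, Scheme.Hom.comp_apply ..⟩
    · exact .inr ⟨q, Scheme.Hom.comp_apply ..⟩
  refine ⟨X₁, g, inl ≫ b, inr ≫ b, a.opensRange ⊔ (inl ≫ b).opensRange, ?_, ?_⟩
  · refine ⟨hint, inferInstance, ?_, fun x ↦ ?_, fun q ↦ ?_, ?_⟩
    · rw [← Category.assoc, hc1, Category.assoc, h.comp, ← Spec.map_comp, ← CommRingCat.ofHom_comp,
        chartTwo, liftAn_comp_algebraMap]
    · rcases h.cover (g x) with hx | hx
      · obtain ⟨y, hy⟩ := (h1 x).mp hx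
        exact .inl (.inl ⟨y, hy⟩)
      · rcases hcov x hx with hx | hx
        · exact .inl (.inr hx)
        · exact .inr hx
    · have hq0 : (inr ≫ b) q ∈ a.opensRange ↔ f (inr q) ≠ origin (k + 1) := by
        rw [← h.mem_iff, ← hgb, h1, Scheme.Hom.comp_apply]
        rfl
      constructor
      · rintro (hq | ⟨p, hp⟩) hq'
        · have h3 := (hB.comp_inr_ne_origin_iff _).mp (hq0.mp hq)
          rw [hq'] at h3
          exact h3.elim (not_nonvanishingAt_origin k).2.1 (not_nonvanishingAt_origin k).2.2
        · rw [Scheme.Hom.comp_apply, Scheme.Hom.comp_apply] at hp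
          have h3 := (hB.overlap _ _ (b.isOpenEmbedding.injective hp)).2
          rw [hq'] at h3
          exact (not_nonvanishingAt_origin k).1 h3
      · intro hq
        rcases nonvanishingAt_of_ne_origin q hq with hq | hq | hq
        · obtain ⟨p, hp⟩ := hB.inr_mem q hq
          exact .inr ⟨p, by rw [Scheme.Hom.comp_apply, Scheme.Hom.comp_apply, hp]⟩
        · exact .inl (hq0.mpr ((hB.comp_inr_ne_origin_iff _).mpr (.inl hq)))
        · exact .inl (hq0.mpr ((hB.comp_inr_ne_origin_iff _).mpr (.inr hq)))
    · haveI := h.smooth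
      refine smooth_sup_ι _ _ (by rw [← Category.assoc, hag]; exact h.smooth) ?_
      rw [← Category.assoc, hc0, Category.assoc, h.comp, ← Spec.map_comp, ← CommRingCat.ofHom_comp,
        chartOne, liftAn_comp_algebraMap]
      infer_instance
  · refine ⟨hproper, hiso, inferInstance, hc0, hc1, hcov, fun x hx ↦ .inl ((h1 x).mp hx), ?_, ?_⟩
    · intro x hx
      rcases hcov x hx with ⟨q, rfl⟩ | ⟨q, rfl⟩
      · exact PrincipalAlong.of_opensRange (inl ≫ b) _ hc0.symm
          (by simpa using principalXY_chartOne (n := k + 1) (𝟙 _)) q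
      · exact PrincipalAlong.of_opensRange (inr ≫ b) _ hc1.symm
          (by simpa using principalXY_chartTwo (k := k) (𝟙 _)) q
    · intro Z σ hZ hz hσ
      refine existsUnique_lift_of_local g X₀ σ hz fun z ↦ ?_
      rcases h.cover (σ z) with hz | hz
      · exact ⟨σ ⁻¹ᵁ X₀, hz, σ ∣_ X₀ ≫ a, by rw [Category.assoc, hag, morphismRestrict_ι]⟩
      · obtain ⟨V, hV, τ, hτ, hp⟩ := hσ z hz
        haveI : Nonempty V := ⟨⟨z, hV⟩⟩
        haveI : IsIntegral (V : Scheme) := isIntegral_of_isOpenImmersion V.ι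
        obtain ⟨β, hβ⟩ := hB.exists_lift_of_principalXY τ hp
        exact ⟨V, hV, β ≫ b, by rw [Category.assoc, hbg, ← Category.assoc, hβ, hτ]⟩

end DerBlowup

/-! ### Blowing up both ideals `(x, y)` and `(z, y)` -/

namespace DerBlowup

lemma isIso_morphismRestrict_of_le {X Y : Scheme.{0}} (f : X ⟶ Y) {U V : Y.Opens} (h : U ≤ V)
    [IsIso (f ∣_ V)] : IsIso (f ∣_ U) := by
  have h1 := isPullback_morphismRestrict f U
  have h2 := isPullback_morphismRestrict f V
  have hle : f ⁻¹ᵁ U ≤ f ⁻¹ᵁ V := fun _ hx ↦ h hx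
  have h3 : IsPullback (X.homOfLE hle) (f ∣_ U) (f ∣_ V)
      (Y.homOfLE h) := by
    refine IsPullback.of_right (t := h2.flip) ?_ ?_
    · rw [Scheme.homOfLE_ι, Scheme.homOfLE_ι]
      exact h1.flip
    · rw [← cancel_mono V.ι, Category.assoc, morphismRestrict_ι, Scheme.homOfLE_ι_assoc,
        Category.assoc, Scheme.homOfLE_ι, morphismRestrict_ι]
  exact MorphismProperty.of_isPullback (P := MorphismProperty.isomorphisms Scheme.{0}) h3
    (inferInstanceAs (IsIso (f ∣_ V)))

/-- The involution of `A_n` exchanging `x` and `z`. -/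
def swapMap (n : ℕ) : SpecAn n ⟶ SpecAn n := Spec.map (CommRingCat.ofHom (swapHom n))

@[simp] lemma swapMap_swapMap (n : ℕ) : swapMap n ≫ swapMap n = 𝟙 _ := by
  rw [swapMap, ← Spec.map_comp, ← CommRingCat.ofHom_comp, swapHom_comp_swapHom]
  exact Spec.map_id _

@[simp] lemma swapMap_swapMap_assoc (n : ℕ) {X : Scheme.{0}} (j : SpecAn n ⟶ X) :
    swapMap n ≫ swapMap n ≫ j = j := by
  rw [← Category.assoc, swapMap_swapMap, Category.id_comp]

instance (n : ℕ) : IsIso (swapMap n) := ⟨swapMap n, by simp, by simp⟩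

lemma swapMap_apply_apply (n : ℕ) (p : SpecAn n) : swapMap n (swapMap n p) = p := by
  rw [← Scheme.Hom.comp_apply, swapMap_swapMap]
  rfl

lemma swapMap_eq_origin_iff {n : ℕ} (p : SpecAn n) : swapMap n p = origin n ↔ p = origin n := by
  have h (p : SpecAn n) (hp : p ≠ origin n) : swapMap n p ≠ origin n := by
    apply ne_origin_of_nonvanishingAt
    have h := nonvanishingAt_of_ne_origin p hp
    have h' (r : AnR n) : NonvanishingAt r (swapMap n p) ↔ NonvanishingAt (swapHom n r) p :=
      (nonvanishingAt_specMap ..).symm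
    simp only [h', swapHom, liftAn_cx, liftAn_cy, liftAn_cz]
    tauto
  refine not_iff_not.mp ⟨fun h1 h2 ↦ ?_, h p⟩
  have h3 := fun h4 ↦ h (swapMap n p) h4
  rw [swapMap_apply_apply] at h3
  exact h3 h1 h2

lemma exists_swapMap_comp_iff {n : ℕ} {X : Scheme.{0}} (j : SpecAn n ⟶ X) (x : X) :
    (∃ p, (swapMap n ≫ j) p = x) ↔ ∃ p, j p = x := by
  constructor
  · rintro ⟨p, hp⟩
    exact ⟨_, (Scheme.Hom.comp_apply ..).symm.trans hp⟩
  · rintro ⟨p, hp⟩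
    exact ⟨swapMap n p, by rw [Scheme.Hom.comp_apply, swapMap_apply_apply, hp]⟩

lemma IsAnChart.swap {X : Scheme.{0}} {m : ℕ} {s : X ⟶ Spec (CommRingCat.of ℂ)}
    {j : SpecAn m ⟶ X} {X₀ : X.Opens} (h : IsAnChart m s j X₀) :
    IsAnChart m s (swapMap m ≫ j) X₀ := by
  haveI := h.isOpenImmersion
  refine ⟨h.integral, inferInstance, ?_, fun x ↦ ?_, fun p ↦ ?_, h.smooth⟩
  · rw [Category.assoc, h.comp, swapMap, ← Spec.map_comp, ← CommRingCat.ofHom_comp, swapHom,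
      liftAn_comp_algebraMap]
  · rw [exists_swapMap_comp_iff]
    exact h.cover x
  · rw [Scheme.Hom.comp_apply, h.mem_iff]
    exact not_congr (swapMap_eq_origin_iff p)

lemma principalXY_iff {n : ℕ} {W : Scheme.{0}} (τ : W ⟶ SpecAn n) : PrincipalXY τ ↔
    pull τ (cx n) ∣ pull τ (cy n) ∨ pull τ (cy n) ∣ pull τ (cx n) := Iff.rfl

lemma pull_swapMap {n : ℕ} {W : Scheme.{0}} (τ : W ⟶ SpecAn n) (r : AnR n) :
    pull (τ ≫ swapMap n) r = pull τ (swapHom n r) := by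
  rw [swapMap, pull_comp_specMap]; rfl

/-- On `xz = y²`, `y = xc` gives `z = yc`, and `x = yc` gives `y = zc`. This is why one blow-up is
enough for `A_1`. -/
lemma principalXY_swap_of_isIntegral {W : Scheme.{0}} [IsIntegral W] (τ : W ⟶ SpecAn 1)
    (h : PrincipalXY τ) : PrincipalXY (τ ≫ swapMap 1) := by
  have h2 := pull_cx_mul_cz τ
  simp only [Nat.reduceAdd] at h2
  simp only [principalXY_iff, pull_swapMap, swapHom, liftAn_cx, liftAn_cy]
  rcases h with ⟨c, hc⟩ | ⟨c, hc⟩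
  · by_cases hx : pull τ (cx 1) = 0
    · left
      rw [hc, hx, zero_mul]
      exact dvd_zero _
    · refine .inr ⟨c, mul_left_cancel₀ hx ?_⟩
      rw [h2, hc]; ring
  · by_cases hy : pull τ (cy 1) = 0
    · left
      rw [hy]
      exact dvd_zero _
    · refine .inl ⟨c, mul_left_cancel₀ hy ?_⟩
      rw [← sq, ← h2, hc]; ring

lemma PrincipalAlong.swap_of_isIntegral {X Z : Scheme.{0}} [IsIntegral Z] {j : SpecAn 1 ⟶ X}
    {σ : Z ⟶ X} (h : PrincipalAlong j σ) : PrincipalAlong (swapMap 1 ≫ j) σ := by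
  intro z hz
  obtain ⟨V, hV, τ, hτ, hp⟩ := h z ((exists_swapMap_comp_iff _ _).mp hz)
  haveI : Nonempty V := ⟨⟨z, hV⟩⟩
  haveI : IsIntegral (V : Scheme) := isIntegral_of_isOpenImmersion V.ι
  exact ⟨V, hV, τ ≫ swapMap 1, by simpa using hτ, principalXY_swap_of_isIntegral τ hp⟩

/-- `g : X' ⟶ X` is the blow-up of the ideals `(x, y)` and `(z, y)` of the chart `j`. -/
structure IsNashModification {X X' : Scheme.{0}} {m : ℕ} (j : SpecAn m ⟶ X) (X₀ : X.Opens)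
    (g : X' ⟶ X) (X₀' : X'.Opens) : Prop where
  isProper : IsProper g
  isIso : IsIso (g ∣_ X₀)
  le : g ⁻¹ᵁ X₀ ≤ X₀'
  principalAlong : PrincipalAlong j g
  principalAlong_swap : PrincipalAlong (swapMap m ≫ j) g
  universal : ∀ (Z : Scheme.{0}) (σ : Z ⟶ X), IsIntegral Z → (∃ z, σ z ∈ X₀) →
    PrincipalAlong j σ → PrincipalAlong (swapMap m ≫ j) σ → ∃! β : Z ⟶ X', β ≫ g = σ

lemma principalXY_chartTwo_swap_iff {k : ℕ} {W : Scheme.{0}} (τ : W ⟶ SpecAn k) :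
    PrincipalXY (((τ ≫ swapMap k) ≫ Spec.map (CommRingCat.ofHom (chartTwo k))) ≫
      swapMap (k + 1)) ↔ PrincipalXY τ := by
  simp only [principalXY_iff, pull_swapMap, pull_comp_specMap, RingHom.comp_apply, swapHom,
    chartTwo, liftAn_cx, liftAn_cy, liftAn_cz]

/-- On the plane chart `z` is a multiple of `y`, namely `y·x^m (y/x)^(m+1)`. -/
lemma principalXY_chartOne_swap {m : ℕ} {W : Scheme.{0}} (τ : W ⟶ SpecAn 0) :
    PrincipalXY ((τ ≫ Spec.map (CommRingCat.ofHom (chartOne (m + 1)))) ≫ swapMap (m + 1)) := by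
  have h := cx_mul_cz 0
  simp only [zero_add, pow_one] at h
  simp only [principalXY_iff, pull_swapMap, pull_comp_specMap, RingHom.comp_apply, swapHom,
    chartOne, liftAn_cx, liftAn_cy, liftAn_cz]
  right
  rw [← h]
  exact map_dvd _ ⟨cx 0 ^ m * cz 0 ^ (m + 1), by ring⟩

lemma exists_local_factor {X Y Z : Scheme.{0}} (i : X ⟶ Y) [IsOpenImmersion i] (σ : Z ⟶ Y) (z : Z)
    (hz : ∃ x, i x = σ z) : ∃ V : Z.Opens, z ∈ V ∧ ∃ τ : (V : Scheme) ⟶ X, τ ≫ i = V.ι ≫ σ := by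
  refine ⟨σ ⁻¹ᵁ i.opensRange, hz, exists_factor i _ fun v ↦ ?_⟩
  rw [Scheme.Hom.comp_apply]
  exact v.2

section TwoSteps

variable {X X₁ X₂ : Scheme.{0}} {k : ℕ} {j : SpecAn (k + 2) ⟶ X} {X₀ : X.Opens}
  {g₁ : X₁ ⟶ X} {j₀ : SpecAn 0 ⟶ X₁} {j₁ : SpecAn (k + 1) ⟶ X₁} {X₁₀ : X₁.Opens}
  (h₁ : IsChartModification j X₀ g₁ j₀ j₁ X₁₀)
include h₁

lemma IsChartModification.principalAlong_swap_comp {g₂ : X₂ ⟶ X₁}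
    (h : PrincipalAlong (swapMap (k + 1) ≫ j₁) g₂) :
    PrincipalAlong (swapMap (k + 2) ≫ j) (g₂ ≫ g₁) := by
  intro z hz
  rw [exists_swapMap_comp_iff] at hz
  rcases h₁.cover (g₂ z) (by rwa [Scheme.Hom.comp_apply] at hz) with hz | hz
  · haveI := h₁.isOpenImmersion
    obtain ⟨V, hV, τ, hτ⟩ := exists_local_factor j₀ g₂ z hz
    refine ⟨V, hV, _, ?_, principalXY_chartOne_swap τ⟩
    rw [Category.assoc, swapMap_swapMap_assoc, Category.assoc, ← h₁.comp_zero, ← Category.assoc, hτ,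
      Category.assoc]
  · obtain ⟨V, hV, τ, hτ, hp⟩ := h z ((exists_swapMap_comp_iff _ _).mpr hz)
    refine ⟨V, hV, _, ?_, (principalXY_chartTwo_swap_iff τ).mpr hp⟩
    rw [Category.assoc, swapMap_swapMap_assoc, Category.assoc, ← h₁.comp_one]
    simpa only [Category.assoc] using congrArg (· ≫ g₁) hτ

/-- The functions `y` and `z` of the chart `A_{k+1}` are those of `A_{k+2}`, so after the first
blow-up the ideal left to principalize is the `(z, y)` of the new chart. -/
lemma IsChartModification.principalAlong_swap_lift [IsOpenImmersion j] [IsOpenImmersion j₁]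
    {β : X₂ ⟶ X₁} (h : PrincipalAlong (swapMap (k + 2) ≫ j) (β ≫ g₁)) :
    PrincipalAlong (swapMap (k + 1) ≫ j₁) β := by
  intro z hz
  obtain ⟨V, hV, τ, hτ, hp⟩ := h z (by
    rw [exists_swapMap_comp_iff]
    obtain ⟨q, hq⟩ := (exists_swapMap_comp_iff _ _).mp hz
    rw [Scheme.Hom.comp_apply, ← hq, ← Scheme.Hom.comp_apply, h₁.comp_one, Scheme.Hom.comp_apply]
    exact ⟨_, rfl⟩)
  obtain ⟨V', hV', τ', hτ'⟩ := exists_local_factor (swapMap (k + 1) ≫ j₁) β z hz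
  refine ⟨V ⊓ V', ⟨hV, hV'⟩, X₂.homOfLE inf_le_right ≫ τ', ?_, ?_⟩
  · rw [Category.assoc, hτ', Scheme.homOfLE_ι_assoc]
  · rw [← principalXY_chartTwo_swap_iff]
    have : ((((X₂.homOfLE (inf_le_right : V ⊓ V' ≤ V') ≫ τ') ≫ swapMap (k + 1)) ≫
        Spec.map (CommRingCat.ofHom (chartTwo (k + 1)))) ≫ swapMap (k + 2)) =
        X₂.homOfLE (inf_le_left : V ⊓ V' ≤ V) ≫ τ := by
      have h3 := congrArg (X₂.homOfLE (inf_le_right : V ⊓ V' ≤ V') ≫ · ≫ g₁) hτ'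
      have h4 := congrArg (X₂.homOfLE (inf_le_left : V ⊓ V' ≤ V) ≫ ·) hτ
      simp only [Category.assoc, Scheme.homOfLE_ι_assoc] at h3 h4
      rw [← cancel_mono (swapMap (k + 2) ≫ j)]
      simp only [Category.assoc, swapMap_swapMap_assoc, ← h₁.comp_one]
      rw [h3, h4]
    rw [this]
    exact hp.comp _

end TwoSteps

/-- Blowing up `(x, y)` and then `(z, y)` lowers the index by one each time. For `m = 1` a single
blow-up does both, and the truncated `1 - 2 = 0` is the index of its chart. -/
theorem IsAnChart.exists_nashModification {X : Scheme.{0}} {m : ℕ}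
    {s : X ⟶ Spec (CommRingCat.of ℂ)} {j : SpecAn m ⟶ X} {X₀ : X.Opens}
    (h : IsAnChart m s j X₀) (hm : 1 ≤ m) :
    ∃ (X' : Scheme.{0}) (g : X' ⟶ X) (j' : SpecAn (m - 2) ⟶ X') (X₀' : X'.Opens),
      IsAnChart (m - 2) (g ≫ s) j' X₀' ∧ IsNashModification j X₀ g X₀' := by
  match m, hm with
  | 1, _ =>
    obtain ⟨X₁, g, j₀, j₁, X₁₀, h₁, hg⟩ := h.exists_chartModification
    haveI := h₁.integral
    exact ⟨X₁, g, j₁, X₁₀, h₁, hg.isProper, hg.isIso, hg.le, hg.principalAlong,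
      hg.principalAlong.swap_of_isIntegral, fun Z σ hZ hz hσ _ ↦ hg.universal Z σ hZ hz hσ⟩
  | k + 2, _ =>
    obtain ⟨X₁, g₁, j₀, j₁, X₁₀, h₁, hg₁⟩ := h.exists_chartModification
    obtain ⟨X₂, g₂, j₀', j₂, X₂₀, h₂, hg₂⟩ := h₁.swap.exists_chartModification
    haveI := h.isOpenImmersion
    haveI := h₁.isOpenImmersion
    haveI := hg₁.isProper
    haveI := hg₂.isProper
    haveI := hg₁.isIso
    haveI := hg₂.isIso
    haveI : IsIso (g₂ ∣_ (g₁ ⁻¹ᵁ X₀)) := isIso_morphismRestrict_of_le g₂ hg₁.le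
    refine ⟨X₂, g₂ ≫ g₁, j₂, X₂₀, by rw [Category.assoc]; exact h₂, inferInstance, ?_, ?_,
      hg₁.principalAlong.comp _, hg₁.principalAlong_swap_comp hg₂.principalAlong, ?_⟩
    · rw [morphismRestrict_comp]
      exact IsIso.comp_isIso' ‹_› ‹_›
    · exact fun x hx ↦ hg₂.le (hg₁.le hx)
    · intro Z σ hZ hz hσ hσ'
      obtain ⟨β₁, rfl, hβ₁⟩ := hg₁.universal Z σ hZ hz hσ
      obtain ⟨β₂, rfl, hβ₂⟩ := hg₂.universal Z β₁ hZ
        (by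
          obtain ⟨z, hz⟩ := hz
          exact ⟨z, hg₁.le (by rwa [Scheme.Hom.comp_apply] at hz)⟩)
        (hg₁.principalAlong_swap_lift hσ')
      exact ⟨β₂, (Category.assoc ..).symm, fun β hβ ↦
        hβ₂ β (hβ₁ (β ≫ g₂) ((Category.assoc ..).trans hβ))⟩

end DerBlowup

namespace DerBlowup

/-! ### Principality in terms of sections over the chart -/

section ChartSections

variable {m : ℕ} {X Z : Scheme.{0}} (j : SpecAn m ⟶ X) [IsOpenImmersion j]

/-- The functions on the image of a chart. -/
def chartSec : AnR m →+* Γ(X, j ''ᵁ ⊤) :=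
  ((Scheme.ΓSpecIso (CommRingCat.of (AnR m))).inv ≫ (j.appIso ⊤).inv).hom

lemma chartSec_bijective : Function.Bijective (chartSec j) :=
  ((Scheme.ΓSpecIso (CommRingCat.of (AnR m))).symm ≪≫
    (j.appIso ⊤).symm).commRingCatIsoToRingEquiv.bijective

/-- The pullback of the functions on the image of a chart. -/
def pullSec (σ : Z ⟶ X) (V : Z.Opens) (e : V ≤ σ ⁻¹ᵁ j ''ᵁ ⊤) : AnR m →+* Γ(Z, V) :=
  (σ.appLE _ V e).hom.comp (chartSec j)

variable {j}

lemma mem_chart_iff {x : X} : x ∈ j ''ᵁ ⊤ ↔ ∃ p, j p = x := by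
  rw [Scheme.Hom.image_top_eq_opensRange]
  exact Iff.rfl

lemma isAffineOpen_chart : IsAffineOpen (j ''ᵁ ⊤) :=
  (isAffineOpen_top _).image_of_isOpenImmersion j

lemma le_of_comp_eq {σ : Z ⟶ X} {V : Z.Opens} {τ : (V : Scheme) ⟶ SpecAn m}
    (h : τ ≫ j = V.ι ≫ σ) : V ≤ σ ⁻¹ᵁ j ''ᵁ ⊤ := by
  intro v hv
  change σ v ∈ j ''ᵁ ⊤
  rw [mem_chart_iff]
  let v' : (V : Scheme) := (⟨v, hv⟩ : V)
  refine ⟨τ v', ?_⟩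
  rw [← Scheme.Hom.comp_apply, h, Scheme.Hom.comp_apply]
  rfl

lemma pull_eq_pullSec {σ : Z ⟶ X} {V : Z.Opens} {τ : (V : Scheme) ⟶ SpecAn m}
    (h : τ ≫ j = V.ι ≫ σ) (r : AnR m) :
    pull τ r = (V.ι.appLE V ⊤ V.ι_preimage_self.ge).hom (pullSec j σ V (le_of_comp_eq h) r) := by
  have h1 : (j.appIso ⊤).inv ≫ σ.appLE _ V (le_of_comp_eq h) ≫
      V.ι.appLE V ⊤ V.ι_preimage_self.ge = τ.appTop := by
    have h2 : τ.appTop = τ.appLE ⊤ ⊤ le_top := (Scheme.Hom.appLE_eq_app _).symm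
    rw [Scheme.Hom.appLE_comp_appLE, Iso.inv_comp_eq, Scheme.Hom.appIso_hom', h2]
    refine Eq.trans ?_ (Scheme.Hom.appLE_comp_appLE τ j (j ''ᵁ ⊤) ⊤ ⊤
      (j.preimage_image_eq ⊤).ge le_top).symm
    simp only [h]
  have h2 := congrArg (fun f ↦ ((Scheme.ΓSpecIso (CommRingCat.of (AnR m))).inv ≫ f).hom r) h1
  exact h2.symm

lemma pullSec_res {σ : Z ⟶ X} {V V' : Z.Opens} (e : V ≤ σ ⁻¹ᵁ j ''ᵁ ⊤) (i : V' ⟶ V) (r : AnR m) :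
    (Z.presheaf.map i.op).hom (pullSec j σ V e r) = pullSec j σ V' (i.le.trans e) r := by
  rw [pullSec, RingHom.comp_apply, ← CommRingCat.comp_apply, Scheme.Hom.appLE_map]
  rfl

lemma exists_comp_eq {σ : Z ⟶ X} {V : Z.Opens} (e : V ≤ σ ⁻¹ᵁ j ''ᵁ ⊤) :
    ∃ τ : (V : Scheme) ⟶ SpecAn m, τ ≫ j = V.ι ≫ σ :=
  exists_factor j _ fun v ↦ by
    rw [Scheme.Hom.comp_apply]
    exact mem_chart_iff.mp (e v.2)

lemma dvd_pull_iff {σ : Z ⟶ X} {V : Z.Opens} {τ : (V : Scheme) ⟶ SpecAn m}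
    (h : τ ≫ j = V.ι ≫ σ) (r r' : AnR m) : pull τ r ∣ pull τ r' ↔
      pullSec j σ V (le_of_comp_eq h) r ∣ pullSec j σ V (le_of_comp_eq h) r' := by
  rw [pull_eq_pullSec h, pull_eq_pullSec h]
  exact map_dvd_iff (asIso (V.ι.appLE V ⊤ V.ι_preimage_self.ge)).commRingCatIsoToRingEquiv

lemma principalAlong_iff {σ : Z ⟶ X} : PrincipalAlong j σ ↔
    ∀ z, (∃ p, j p = σ z) → ∃ (V : Z.Opens) (e : V ≤ σ ⁻¹ᵁ j ''ᵁ ⊤), z ∈ V ∧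
      (pullSec j σ V e (cx m) ∣ pullSec j σ V e (cy m) ∨
        pullSec j σ V e (cy m) ∣ pullSec j σ V e (cx m)) := by
  refine forall_congr' fun z ↦ forall_congr' fun hz ↦ exists_congr fun V ↦ ?_
  constructor
  · rintro ⟨hV, τ, hτ, hp⟩
    exact ⟨le_of_comp_eq hτ, hV, by rwa [← dvd_pull_iff hτ, ← dvd_pull_iff hτ]⟩
  · rintro ⟨e, hV, hp⟩
    obtain ⟨τ, hτ⟩ := exists_comp_eq e
    exact ⟨hV, τ, hτ, by rwa [principalXY_iff, dvd_pull_iff hτ, dvd_pull_iff hτ]⟩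

lemma principalAlong_swap_iff {σ : Z ⟶ X} : PrincipalAlong (swapMap m ≫ j) σ ↔
    ∀ z, (∃ p, j p = σ z) → ∃ (V : Z.Opens) (e : V ≤ σ ⁻¹ᵁ j ''ᵁ ⊤), z ∈ V ∧
      (pullSec j σ V e (cz m) ∣ pullSec j σ V e (cy m) ∨
        pullSec j σ V e (cy m) ∣ pullSec j σ V e (cz m)) := by
  simp only [PrincipalAlong, exists_swapMap_comp_iff]
  refine forall_congr' fun z ↦ forall_congr' fun hz ↦ exists_congr fun V ↦ ?_
  constructor
  · rintro ⟨hV, τ, hτ, hp⟩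
    rw [← Category.assoc] at hτ
    refine ⟨le_of_comp_eq hτ, hV, ?_⟩
    rw [← dvd_pull_iff hτ, ← dvd_pull_iff hτ]
    simp only [pull_swapMap, swapHom, liftAn_cy, liftAn_cz]
    exact hp
  · rintro ⟨e, hV, hp⟩
    obtain ⟨τ, hτ⟩ := exists_comp_eq e
    refine ⟨hV, τ ≫ swapMap m, by simpa using hτ, ?_⟩
    rw [principalXY_iff]
    simp only [pull_swapMap, swapHom, liftAn_cx, liftAn_cy]
    rwa [dvd_pull_iff hτ, dvd_pull_iff hτ]

lemma pullSec_ne_zero [IsIntegral Z] {σ : Z ⟶ X} {X₀ : X.Opens}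
    (hX₀ : ∀ p, j p ∈ X₀ ↔ p ≠ origin m) (h : ∃ z, σ z ∈ X₀) {V : Z.Opens} (hV : (V : Set Z).Nonempty)
    (e : V ≤ σ ⁻¹ᵁ j ''ᵁ ⊤) : ¬ (pullSec j σ V e (cx m) = 0 ∧ pullSec j σ V e (cy m) = 0 ∧
      pullSec j σ V e (cz m) = 0) := by
  obtain ⟨z, hz⟩ := h
  obtain ⟨v, hv, hvX⟩ : ((V : Set Z) ∩ (σ ⁻¹ᵁ X₀ : Z.Opens)).Nonempty :=
    nonempty_preirreducible_inter V.isOpen (σ ⁻¹ᵁ X₀).isOpen hV ⟨z, hz⟩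
  obtain ⟨τ, hτ⟩ := exists_comp_eq e
  let v' : (V : Scheme) := (⟨v, hv⟩ : V)
  have hne : τ v' ≠ origin m := by
    rw [← hX₀, ← Scheme.Hom.comp_apply, hτ, Scheme.Hom.comp_apply]
    exact hvX
  have h0 (r : AnR m) (hr : NonvanishingAt r (τ v')) : pullSec j σ V e r ≠ 0 := by
    intro h0
    rw [nonvanishingAt_iff, pull_eq_pullSec hτ, h0, map_zero, Scheme.basicOpen_zero] at hr
    exact hr
  have := nonvanishingAt_of_ne_origin _ hne
  rintro ⟨hx, hy, hz⟩
  rcases this with h | h | h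
  exacts [h0 _ h hx, h0 _ h hy, h0 _ h hz]

end ChartSections

section Transfer

/-- Freeness of the pullback of the derivations depends only on a common localization. -/
lemma derPullbackFree_iff_of_common_localization {R₁ R₂ S A : Type} [CommRing R₁] [CommRing R₂]
    [CommRing S] [CommRing A] [IsDomain R₁] [IsDomain R₂] [IsDomain A] [Algebra ℂ R₁] [Algebra ℂ R₂]
    [Algebra R₁ A] [Algebra R₂ A] [Algebra.FiniteType ℂ R₁] [Algebra.FiniteType ℂ R₂]
    [Algebra R₁ S] [Algebra R₂ S] (hc : (algebraMap R₁ S).comp (algebraMap ℂ R₁) =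
      (algebraMap R₂ S).comp (algebraMap ℂ R₂)) (t : S →+* A)
    (h₁ : t.comp (algebraMap R₁ S) = algebraMap R₁ A)
    (h₂ : t.comp (algebraMap R₂ S) = algebraMap R₂ A) {f₁ : R₁} {f₂ : R₂} (hf₁ : f₁ ≠ 0)
    (hf₂ : f₂ ≠ 0) [IsLocalization.Away f₁ S] [IsLocalization.Away f₂ S] :
    DerPullbackFree R₁ A ↔ DerPullbackFree R₂ A := by
  letI := t.toAlgebra
  letI := ((algebraMap R₁ S).comp (algebraMap ℂ R₁)).toAlgebra
  haveI : IsScalarTower ℂ R₁ S := .of_algebraMap_eq' rfl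
  haveI : IsScalarTower ℂ R₂ S := .of_algebraMap_eq' hc
  haveI : IsScalarTower R₁ S A := .of_algebraMap_eq' h₁.symm
  haveI : IsScalarTower R₂ S A := .of_algebraMap_eq' h₂.symm
  exact (derPullbackFree_iff_of_isLocalization (R' := S) (Submonoid.powers f₁)
    (powers_le_nonZeroDivisors_of_noZeroDivisors hf₁)).trans
    (derPullbackFree_iff_of_isLocalization (R' := S) (Submonoid.powers f₂)
    (powers_le_nonZeroDivisors_of_noZeroDivisors hf₂)).symm

end Transfer

end DerBlowup

namespace DerBlowup

/-! ### Principal ideals imply local freeness -/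

section Structure

variable {m : ℕ} {X Z : Scheme.{0}} {s : X ⟶ Spec (CommRingCat.of ℂ)} {j : SpecAn m ⟶ X}

lemma IsAnChart.locallyOfFiniteType {X₀ : X.Opens} (h : IsAnChart m s j X₀) :
    LocallyOfFiniteType s := by
  haveI := h.isOpenImmersion
  haveI := h.smooth
  haveI : IsZariskiLocalAtSource @LocallyOfFiniteType.{0} :=
    HasRingHomProperty.instIsZariskiLocalAtSource (Q := RingHom.FiniteType)
  refine IsZariskiLocalAtSource.of_openCover (P := @LocallyOfFiniteType.{0})
    (twoCover X₀.ι j fun x ↦ ?_) ?_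
  · rcases h.cover x with hx | hx
    · exact .inl ⟨(⟨x, hx⟩ : X₀), rfl⟩
    · exact .inr hx
  · rintro (_ | _)
    · change LocallyOfFiniteType (j ≫ s)
      rw [h.comp, HasRingHomProperty.Spec_iff (P := @LocallyOfFiniteType), CommRingCat.hom_ofHom,
        RingHom.finiteType_algebraMap]
      infer_instance
    · change LocallyOfFiniteType (X₀.ι ≫ s)
      infer_instance

lemma strHom_eq (U : X.Opens) : strHom s U = ((Scheme.ΓSpecIso (CommRingCat.of ℂ)).inv ≫
    s.appLE ⊤ U (show U ≤ s ⁻¹ᵁ ⊤ from le_top)).hom := rfl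

lemma finiteType_strHom [LocallyOfFiniteType s] {U : X.Opens} (hU : IsAffineOpen U) :
    (strHom s U).FiniteType := by
  rw [strHom, CommRingCat.hom_comp]
  refine (s.finiteType_appLE (isAffineOpen_top _) hU le_top).comp
    (RingHom.FiniteType.of_surjective _ ?_)
  exact (Scheme.ΓSpecIso (CommRingCat.of ℂ)).symm.commRingCatIsoToRingEquiv.surjective

lemma res_comp_strHom {U V : X.Opens} (i : V ⟶ U) :
    (X.presheaf.map i.op).hom.comp (strHom s U) = strHom s V := by
  rw [strHom_eq, ← CommRingCat.hom_comp, Category.assoc, Scheme.Hom.appLE_map]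
  rfl

lemma chartSec_comp_algebraMap [IsOpenImmersion j] (h : j ≫ s = anStr m) :
    (chartSec j).comp (algebraMap ℂ (AnR m)) = strHom s (j ''ᵁ ⊤) := by
  have h1 : s.appLE ⊤ (j ''ᵁ ⊤) le_top ≫ (j.appIso ⊤).hom = (anStr m).appTop := by
    rw [Scheme.Hom.appIso_hom']
    refine (Scheme.Hom.appLE_comp_appLE j s ⊤ (j ''ᵁ ⊤) ⊤ le_top
      (j.preimage_image_eq ⊤).ge).trans ?_
    simp only [h]
    exact Scheme.Hom.appLE_eq_app _
  have h2 : CommRingCat.ofHom (algebraMap ℂ (AnR m)) ≫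
      (Scheme.ΓSpecIso (CommRingCat.of (AnR m))).inv ≫ (j.appIso ⊤).inv =
      (Scheme.ΓSpecIso (CommRingCat.of ℂ)).inv ≫ s.appLE ⊤ (j ''ᵁ ⊤) le_top := by
    rw [Scheme.ΓSpecIso_inv_naturality_assoc, ← h1, Category.assoc, Iso.hom_inv_id,
      Category.comp_id]
  exact congrArg CommRingCat.Hom.hom h2

/-- Over the image of a chart, the freeness of the pullback of the sheaf of derivations can be
computed on the coordinate ring of `A_m`. -/
lemma derPullbackFree_chart_iff [IsIntegral X] [IsOpenImmersion j] [LocallyOfFiniteType s]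
    (h : j ≫ s = anStr m) {A : Type} [CommRing A] [IsDomain A] (t : Γ(X, j ''ᵁ ⊤) →+* A) :
    (letI := (strHom s (j ''ᵁ ⊤)).toAlgebra; letI := t.toAlgebra
     DerPullbackFree Γ(X, j ''ᵁ ⊤) A) ↔
    (letI := (t.comp (chartSec j)).toAlgebra; DerPullbackFree (AnR m) A) := by
  letI := (strHom s (j ''ᵁ ⊤)).toAlgebra
  letI := t.toAlgebra
  letI := (t.comp (chartSec j)).toAlgebra
  letI := (chartSec j).toAlgebra
  haveI : Nonempty (j ''ᵁ ⊤ : X.Opens) := ⟨⟨j (origin m), mem_chart_iff.mpr ⟨_, rfl⟩⟩⟩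
  haveI : Algebra.FiniteType ℂ Γ(X, j ''ᵁ ⊤) := finiteType_strHom isAffineOpen_chart
  haveI : IsLocalization.Away (1 : AnR m) Γ(X, j ''ᵁ ⊤) :=
    IsLocalization.away_of_isUnit_of_bijective _ isUnit_one (chartSec_bijective j)
  haveI : IsLocalization.Away (1 : Γ(X, j ''ᵁ ⊤)) Γ(X, j ''ᵁ ⊤) :=
    IsLocalization.away_of_isUnit_of_bijective _ isUnit_one Function.bijective_id
  exact derPullbackFree_iff_of_common_localization (S := Γ(X, j ''ᵁ ⊤)) (f₁ := 1) (f₂ := 1)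
    (by exact (chartSec_comp_algebraMap h).symm) t rfl rfl one_ne_zero one_ne_zero

lemma dvd_or_dvd_res {V V' : Z.Opens} (i : V' ⟶ V) {σ : Z ⟶ X} [IsOpenImmersion j]
    {e : V ≤ σ ⁻¹ᵁ j ''ᵁ ⊤} {r r' : AnR m}
    (h : pullSec j σ V e r ∣ pullSec j σ V e r' ∨ pullSec j σ V e r' ∣ pullSec j σ V e r) :
    pullSec j σ V' (i.le.trans e) r ∣ pullSec j σ V' (i.le.trans e) r' ∨
      pullSec j σ V' (i.le.trans e) r' ∣ pullSec j σ V' (i.le.trans e) r := by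
  rw [← pullSec_res e i, ← pullSec_res e i]
  exact h.imp (map_dvd _) (map_dvd _)

theorem IsAnChart.exists_derPullbackFree_chart [IsIntegral Z] {X₀ : X.Opens}
    (h : IsAnChart m s j X₀) (hm : 1 ≤ m) {σ : Z ⟶ X} (hne : ∃ z, σ z ∈ X₀)
    (h₁ : PrincipalAlong j σ) (h₂ : PrincipalAlong (swapMap m ≫ j) σ) {z : Z}
    (hz : ∃ p, j p = σ z) : ∃ (U : X.Opens) (V : Z.Opens) (e : V ≤ σ ⁻¹ᵁ U),
      IsAffineOpen U ∧ IsAffineOpen V ∧ z ∈ V ∧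
      letI : Algebra ℂ Γ(X, U) := (strHom s U).toAlgebra
      letI : Algebra Γ(X, U) Γ(Z, V) := (σ.appLE U V e).hom.toAlgebra
      DerPullbackFree Γ(X, U) Γ(Z, V) := by
  haveI := h.integral
  haveI := h.isOpenImmersion
  haveI := h.locallyOfFiniteType
  obtain ⟨V₁, e₁, hz₁, hp₁⟩ := principalAlong_iff.mp h₁ z hz
  obtain ⟨V₂, e₂, hz₂, hp₂⟩ := principalAlong_swap_iff.mp h₂ z hz
  obtain ⟨V, hV, hzV, hle⟩ := exists_isAffineOpen_mem_and_subset (U := V₁ ⊓ V₂) ⟨hz₁, hz₂⟩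
  have hle₁ : V ≤ V₁ := fun x hx ↦ (hle hx).1
  have hle₂ : V ≤ V₂ := fun x hx ↦ (hle hx).2
  haveI : Nonempty V := ⟨⟨z, hzV⟩⟩
  refine ⟨j ''ᵁ ⊤, V, hle₁.trans e₁, isAffineOpen_chart, hV, hzV, ?_⟩
  rw [derPullbackFree_chart_iff h.comp]
  letI := (pullSec j σ V (hle₁.trans e₁)).toAlgebra
  exact derPullbackFree_of_dvd (n := m) (A := Γ(Z, V)) hm
    (pullSec_ne_zero h.mem_iff hne ⟨z, hzV⟩ (hle₁.trans e₁))
    (dvd_or_dvd_res (homOfLE hle₁) hp₁) (dvd_or_dvd_res (homOfLE hle₂) hp₂)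

lemma free_derivation_of_isStandardSmooth {R : Type} [CommRing R] [Algebra ℂ R]
    [Algebra.IsStandardSmooth ℂ R] :
    Module.Free R (Derivation ℂ R R) ∧ Module.Finite R (Derivation ℂ R R) := by
  haveI : Module.Free R (Ω[R⁄ℂ]) := Algebra.IsStandardSmooth.free_kaehlerDifferential
  haveI : Algebra.FiniteType ℂ R := inferInstance
  let e := KaehlerDifferential.linearMapEquivDerivation (M := R) ℂ R
  exact ⟨Module.Free.of_equiv e, Module.Finite.equiv e⟩

theorem exists_derPullbackFree_of_smooth [IsIntegral X] [IsIntegral Z] {X₀ : X.Opens}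
    [Smooth (X₀.ι ≫ s)] {σ : Z ⟶ X} {z : Z} (hz : σ z ∈ X₀) :
    ∃ (U : X.Opens) (V : Z.Opens) (e : V ≤ σ ⁻¹ᵁ U),
      IsAffineOpen U ∧ IsAffineOpen V ∧ z ∈ V ∧
      letI : Algebra ℂ Γ(X, U) := (strHom s U).toAlgebra
      letI : Algebra Γ(X, U) Γ(Z, V) := (σ.appLE U V e).hom.toAlgebra
      DerPullbackFree Γ(X, U) Γ(Z, V) := by
  obtain ⟨T, -, V₀, hV₀, hzV₀, e, he⟩ :=
    Smooth.exists_isStandardSmooth (X₀.ι ≫ s) (⟨σ z, hz⟩ : X₀)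
  -- `Spec ℂ` is a single point.
  obtain rfl : T = ⊤ := by
    haveI : Subsingleton (Spec (CommRingCat.of ℂ)) :=
      inferInstanceAs (Subsingleton (PrimeSpectrum ℂ))
    rw [eq_top_iff]
    intro t _
    rw [Subsingleton.elim t ((X₀.ι ≫ s) (⟨σ z, hz⟩ : X₀))]
    exact e hzV₀
  have hU : IsAffineOpen (X₀.ι ''ᵁ V₀) := hV₀.image_of_isOpenImmersion _
  have hzU : σ z ∈ X₀.ι ''ᵁ V₀ := ⟨_, hzV₀, rfl⟩
  obtain ⟨V, hV, hzV, hle⟩ := exists_isAffineOpen_mem_and_subset (U := σ ⁻¹ᵁ (X₀.ι ''ᵁ V₀)) hzU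
  refine ⟨X₀.ι ''ᵁ V₀, V, hle, hU, hV, hzV, ?_⟩
  haveI : Nonempty V := ⟨⟨z, hzV⟩⟩
  haveI : Nonempty (X₀.ι ''ᵁ V₀ : X.Opens) := ⟨⟨_, hzU⟩⟩
  letI := (strHom s (X₀.ι ''ᵁ V₀)).toAlgebra
  letI := (σ.appLE _ V hle).hom.toAlgebra
  have h1 : s.appLE ⊤ (X₀.ι ''ᵁ V₀) (show _ ≤ s ⁻¹ᵁ ⊤ from le_top) ≫ (X₀.ι.appIso V₀).hom = (X₀.ι ≫ s).appLE ⊤ V₀ e := by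
    rw [Scheme.Hom.appIso_hom']
    exact Scheme.Hom.appLE_comp_appLE X₀.ι s ⊤ _ V₀ le_top (X₀.ι.preimage_image_eq V₀).ge
  have h2 : (strHom s (X₀.ι ''ᵁ V₀)).IsStandardSmooth := by
    rw [strHom_eq, (Iso.eq_comp_inv _).mpr h1, CommRingCat.hom_comp, CommRingCat.hom_comp]
    exact RingHom.isStandardSmooth_respectsIso.2 _
      (Scheme.ΓSpecIso (CommRingCat.of ℂ)).symm.commRingCatIsoToRingEquiv
      (RingHom.isStandardSmooth_respectsIso.1 _
        (X₀.ι.appIso V₀).symm.commRingCatIsoToRingEquiv he)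
  haveI : Algebra.IsStandardSmooth ℂ Γ(X, X₀.ι ''ᵁ V₀) := h2
  obtain ⟨h3, h4⟩ := free_derivation_of_isStandardSmooth (R := Γ(X, X₀.ι ''ᵁ V₀))
  exact derPullbackFree_of_free

theorem IsAnChart.derPullbackLocallyFree [IsIntegral Z] {X₀ : X.Opens}
    (h : IsAnChart m s j X₀) (hm : 1 ≤ m) {σ : Z ⟶ X} (hne : ∃ z, σ z ∈ X₀)
    (h₁ : PrincipalAlong j σ) (h₂ : PrincipalAlong (swapMap m ≫ j) σ) :
    DerPullbackLocallyFree s σ := by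
  intro z
  haveI := h.integral
  haveI := h.smooth
  rcases h.cover (σ z) with hz | hz
  · exact exists_derPullbackFree_of_smooth hz
  · exact h.exists_derPullbackFree_chart hm hne h₁ h₂ hz

end Structure

end DerBlowup

/-! ### Local freeness implies principal ideals -/

namespace DerBlowup

lemma appLE_germ {X Z : Scheme.{0}} (σ : Z ⟶ X) {U : X.Opens} {V : Z.Opens} (e : V ≤ σ ⁻¹ᵁ U)
    (z : Z) (hz : z ∈ V) : σ.appLE U V e ≫ Z.presheaf.germ V z hz =
      X.presheaf.germ U (σ z) (show σ z ∈ U from e hz) ≫ σ.stalkMap z := by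
  rw [Scheme.Hom.germ_stalkMap, Scheme.Hom.appLE, Category.assoc, TopCat.Presheaf.germ_res]

lemma exists_res_dvd {Z : Scheme.{0}} {V : Z.Opens} {z : Z} (hz : z ∈ V) (a b : Γ(Z, V))
    (h : (Z.presheaf.germ V z hz).hom a ∣ (Z.presheaf.germ V z hz).hom b) :
    ∃ (V' : Z.Opens) (i : V' ⟶ V), z ∈ V' ∧
      (Z.presheaf.map i.op).hom a ∣ (Z.presheaf.map i.op).hom b := by
  obtain ⟨c, hc⟩ := h
  obtain ⟨W, hW, c, rfl⟩ := TopCat.Presheaf.exists_germ_eq Z.presheaf c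
  let i₁ : V ⊓ W ⟶ V := homOfLE inf_le_left
  let i₂ : V ⊓ W ⟶ W := homOfLE inf_le_right
  have h1 : (Z.presheaf.germ (V ⊓ W) z ⟨hz, hW⟩).hom ((Z.presheaf.map i₁.op).hom b) =
      (Z.presheaf.germ (V ⊓ W) z ⟨hz, hW⟩).hom
        ((Z.presheaf.map i₁.op).hom a * (Z.presheaf.map i₂.op).hom c) := by
    rw [map_mul]
    exact ((TopCat.Presheaf.germ_res_apply Z.presheaf i₁ z ⟨hz, hW⟩ b).trans hc).trans
      (congrArg₂ (· * ·) (TopCat.Presheaf.germ_res_apply Z.presheaf i₁ z ⟨hz, hW⟩ a).symm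
        (TopCat.Presheaf.germ_res_apply Z.presheaf i₂ z ⟨hz, hW⟩ c).symm)
  obtain ⟨V', hV', i₃, i₄, h2⟩ := TopCat.Presheaf.germ_eq Z.presheaf z _ _ _ _ h1
  refine ⟨V', i₃ ≫ i₁, hV', (Z.presheaf.map i₃.op).hom ((Z.presheaf.map i₂.op).hom c), ?_⟩
  obtain rfl : i₃ = i₄ := Subsingleton.elim _ _
  rw [op_comp, Z.presheaf.map_comp, CommRingCat.hom_comp, RingHom.comp_apply, RingHom.comp_apply,
    ← map_mul]
  exact h2

section Converse

variable {m : ℕ} {X Z : Scheme.{0}} {s : X ⟶ Spec (CommRingCat.of ℂ)} {j : SpecAn m ⟶ X}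

/-- The pullback of the functions on a chart to the local ring at a point. -/
def stalkSec (j : SpecAn m ⟶ X) [IsOpenImmersion j] (σ : Z ⟶ X) (z : Z) (hz : σ z ∈ j ''ᵁ ⊤) :
    AnR m →+* Z.presheaf.stalk z :=
  ((X.presheaf.germ (j ''ᵁ ⊤) (σ z) hz ≫ σ.stalkMap z).hom).comp (chartSec j)

lemma stalkSec_eq [IsOpenImmersion j] (σ : Z ⟶ X) {z : Z} (hz : σ z ∈ j ''ᵁ ⊤) (r : AnR m) :
    stalkSec j σ z hz r = (Z.presheaf.germ (σ ⁻¹ᵁ j ''ᵁ ⊤) z hz).hom (pullSec j σ _ le_rfl r) := by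
  rw [stalkSec, ← appLE_germ σ (U := j ''ᵁ ⊤) le_rfl z hz]
  rfl

/-- Freeness is given for some affine open around `σ z`; a common basic open transfers it to the
chart. Passing to the stalk supplies the local domain needed for `dvd_of_derPullbackFree`. -/
lemma derPullbackFree_stalk [IsIntegral X] [IsIntegral Z] [LocallyOfFiniteType s]
    [IsOpenImmersion j] (hj : j ≫ s = anStr m) {σ : Z ⟶ X} (H : DerPullbackLocallyFree s σ) {z : Z}
    (hz : σ z ∈ j ''ᵁ ⊤) :
    letI := (stalkSec j σ z hz).toAlgebra; DerPullbackFree (AnR m) (Z.presheaf.stalk z) := by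
  obtain ⟨U, V, e, hU, hV, hzV, H⟩ := H z
  obtain ⟨f, g, hfg, hzf⟩ := exists_basicOpen_le_affine_inter hU (isAffineOpen_chart (j := j)) (σ z)
    ⟨e hzV, hz⟩
  haveI : Nonempty U := ⟨⟨σ z, e hzV⟩⟩
  haveI : Nonempty V := ⟨⟨z, hzV⟩⟩
  haveI : Nonempty (j ''ᵁ ⊤ : X.Opens) := ⟨⟨σ z, hz⟩⟩
  let i₁ : X.basicOpen f ⟶ U := homOfLE (X.basicOpen_le f)
  let i₂ : X.basicOpen f ⟶ j ''ᵁ ⊤ := homOfLE (hfg ▸ X.basicOpen_le g)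
  letI : Algebra ℂ Γ(X, U) := (strHom s U).toAlgebra
  letI : Algebra ℂ Γ(X, j ''ᵁ ⊤) := (strHom s _).toAlgebra
  letI : Algebra Γ(X, U) Γ(Z, V) := (σ.appLE U V e).hom.toAlgebra
  letI : Algebra Γ(Z, V) (Z.presheaf.stalk z) := (Z.presheaf.germ V z hzV).hom.toAlgebra
  letI : Algebra Γ(X, U) (Z.presheaf.stalk z) :=
    (X.presheaf.germ U (σ z) (e hzV) ≫ σ.stalkMap z).hom.toAlgebra
  letI : Algebra Γ(X, j ''ᵁ ⊤) (Z.presheaf.stalk z) :=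
    (X.presheaf.germ (j ''ᵁ ⊤) (σ z) hz ≫ σ.stalkMap z).hom.toAlgebra
  letI : Algebra Γ(X, U) Γ(X, X.basicOpen f) := (X.presheaf.map i₁.op).hom.toAlgebra
  letI : Algebra Γ(X, j ''ᵁ ⊤) Γ(X, X.basicOpen f) := (X.presheaf.map i₂.op).hom.toAlgebra
  haveI : IsScalarTower Γ(X, U) Γ(Z, V) (Z.presheaf.stalk z) :=
    .of_algebraMap_eq' (congrArg CommRingCat.Hom.hom (appLE_germ σ e z hzV)).symm
  haveI : Algebra.FiniteType ℂ Γ(X, U) := finiteType_strHom hU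
  haveI : Algebra.FiniteType ℂ Γ(X, j ''ᵁ ⊤) := finiteType_strHom isAffineOpen_chart
  haveI : IsLocalization.Away f Γ(X, X.basicOpen f) :=
    hU.isLocalization_of_eq_basicOpen f i₁ rfl
  haveI : IsLocalization.Away g Γ(X, X.basicOpen f) :=
    isAffineOpen_chart.isLocalization_of_eq_basicOpen g i₂ hfg
  have hf : f ≠ 0 := by
    rintro rfl
    rw [Scheme.basicOpen_zero] at hzf
    exact hzf
  have hg : g ≠ 0 := by
    rintro rfl
    rw [hfg, Scheme.basicOpen_zero] at hzf
    exact hzf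
  have h1 : DerPullbackFree Γ(X, U) (Z.presheaf.stalk z) :=
    DerPullbackFree.baseChange (germ_injective_of_isIntegral Z z hzV) H
  have h2 : DerPullbackFree Γ(X, j ''ᵁ ⊤) (Z.presheaf.stalk z) := by
    refine (derPullbackFree_iff_of_common_localization (S := Γ(X, X.basicOpen f)) (f₁ := f)
      (f₂ := g) ?_ (X.presheaf.germ (X.basicOpen f) (σ z) hzf ≫ σ.stalkMap z).hom ?_ ?_ hf hg).mp h1
    · exact (res_comp_strHom i₁).trans (res_comp_strHom i₂).symm
    · refine congrArg CommRingCat.Hom.hom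
        (?_ : X.presheaf.map i₁.op ≫ X.presheaf.germ (X.basicOpen f) (σ z) hzf ≫ σ.stalkMap z = _)
      rw [TopCat.Presheaf.germ_res_assoc]
    · refine congrArg CommRingCat.Hom.hom
        (?_ : X.presheaf.map i₂.op ≫ X.presheaf.germ (X.basicOpen f) (σ z) hzf ≫ σ.stalkMap z = _)
      rw [TopCat.Presheaf.germ_res_assoc]
  exact (derPullbackFree_chart_iff hj _).mp h2

lemma pullSec_eq_zero [IsReduced Z] [IsOpenImmersion j] {σ : Z ⟶ X} {X₀ : X.Opens}
    (hX₀ : ∀ p, j p ∈ X₀ ↔ p ≠ origin m) (h : ∀ z, σ z ∉ X₀) {V : Z.Opens}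
    (e : V ≤ σ ⁻¹ᵁ j ''ᵁ ⊤) {r : AnR m} (hr : ¬ NonvanishingAt r (origin m)) :
    pullSec j σ V e r = 0 := by
  obtain ⟨τ, hτ⟩ := exists_comp_eq e
  have h1 : pull τ r = 0 := by
    rw [← basicOpen_eq_bot_iff, eq_bot_iff]
    intro v hv
    rw [← nonvanishingAt_iff] at hv
    have h2 : τ v = origin m := by
      by_contra h2
      refine h (V.ι v) ?_
      rw [← Scheme.Hom.comp_apply, ← hτ, Scheme.Hom.comp_apply, hX₀]
      exact h2
    rw [h2] at hv
    exact (hr hv).elim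
  have h2 := dvd_pull_iff hτ 0 r
  rw [map_zero, map_zero, zero_dvd_iff, zero_dvd_iff] at h2
  exact h2.mp h1

lemma exists_dvd_of_stalkSec_dvd [IsOpenImmersion j] {σ : Z ⟶ X} {z : Z} (hz : σ z ∈ j ''ᵁ ⊤)
    {r r' : AnR m} (h : stalkSec j σ z hz r ∣ stalkSec j σ z hz r') :
    ∃ (V : Z.Opens) (e : V ≤ σ ⁻¹ᵁ j ''ᵁ ⊤), z ∈ V ∧ pullSec j σ V e r ∣ pullSec j σ V e r' := by
  rw [stalkSec_eq, stalkSec_eq] at h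
  obtain ⟨V, i, hzV, h⟩ := exists_res_dvd (V := σ ⁻¹ᵁ j ''ᵁ ⊤) hz _ _ h
  rw [pullSec_res, pullSec_res] at h
  exact ⟨V, i.le, hzV, h⟩

/-- A morphism pulling back the sheaf of derivations to a locally free sheaf modulo torsion
principalizes the ideals `(x, y)` and `(z, y)` of the chart. -/
theorem IsAnChart.principal_of_derPullbackLocallyFree [IsIntegral Z] {X₀ : X.Opens}
    (h : IsAnChart m s j X₀) (hm : 1 ≤ m) {σ : Z ⟶ X} (H : DerPullbackLocallyFree s σ) :
    (∃ z, σ z ∈ X₀) ∧ PrincipalAlong j σ ∧ PrincipalAlong (swapMap m ≫ j) σ := by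
  haveI := h.integral
  haveI := h.isOpenImmersion
  haveI := h.locallyOfFiniteType
  refine ⟨?_, principalAlong_iff.mpr fun z hz ↦ ?_, principalAlong_swap_iff.mpr fun z hz ↦ ?_⟩
  -- Otherwise `Z` maps entirely to the origin of the chart, so `x`, `y`, `z` pull back to zero and
  -- the rank would be too large.
  · by_contra! hne
    obtain ⟨z⟩ : Nonempty Z := inferInstance
    have hz : σ z ∈ j ''ᵁ ⊤ := mem_chart_iff.mpr ((h.cover (σ z)).resolve_left (hne z))
    letI := (stalkSec j σ z hz).toAlgebra
    have h0 (r : AnR m) (hr : ¬ NonvanishingAt r (origin m)) : stalkSec j σ z hz r = 0 := by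
      rw [stalkSec_eq, pullSec_eq_zero h.mem_iff hne le_rfl hr, map_zero]
    have h1 := not_nonvanishingAt_origin m
    exact not_derPullbackFree_of_eq_zero hm (h0 _ h1.1) (h0 _ h1.2.1) (h0 _ h1.2.2)
      (derPullbackFree_stalk h.comp H hz)
  · have hz' := mem_chart_iff.mpr hz
    letI := (stalkSec j σ z hz').toAlgebra
    rcases (dvd_of_derPullbackFree hm (derPullbackFree_stalk h.comp H hz')).1 with h1 | h1
    · obtain ⟨V, e, hzV, h2⟩ := exists_dvd_of_stalkSec_dvd hz' h1
      exact ⟨V, e, hzV, .inl h2⟩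
    · obtain ⟨V, e, hzV, h2⟩ := exists_dvd_of_stalkSec_dvd hz' h1
      exact ⟨V, e, hzV, .inr h2⟩
  · have hz' := mem_chart_iff.mpr hz
    letI := (stalkSec j σ z hz').toAlgebra
    rcases (dvd_of_derPullbackFree hm (derPullbackFree_stalk h.comp H hz')).2 with h1 | h1
    · obtain ⟨V, e, hzV, h2⟩ := exists_dvd_of_stalkSec_dvd hz' h1
      exact ⟨V, e, hzV, .inl h2⟩
    · obtain ⟨V, e, hzV, h2⟩ := exists_dvd_of_stalkSec_dvd hz' h1
      exact ⟨V, e, hzV, .inr h2⟩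

end Converse

end DerBlowup

namespace DerBlowup

/-! ### Smooth surfaces over `X` principalize `(x, y)` -/

section Birational

variable {X Z : Scheme.{0}}

lemma isIso_app_of_isIso_morphismRestrict (σ : Z ⟶ X) (U : X.Opens) [IsIso (σ ∣_ U)] :
    IsIso (σ.app U) := by
  have h : IsIso (σ ∣_ U).appTop := inferInstanceAs (IsIso ((σ ∣_ U).app ⊤))
  have h2 : IsIso (σ.app (U.ι ''ᵁ ⊤)) := by
    rw [(IsIso.eq_comp_inv _).mpr (morphismRestrict_appTop σ U).symm]
    exact IsIso.comp_isIso' h inferInstance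
  have h3 : ∀ U', U' = U → IsIso (σ.app U') → IsIso (σ.app U) := by
    rintro _ rfl h
    exact h
  exact h3 _ U.ι_image_top h2

/-- Over the resulting basic open, functions on `Z` and on `X` coincide, and the preimage lies in
`V`. This presents functions on `V` as fractions of functions on `R`. -/
lemma exists_basicOpen_of_birational [IsIntegral X] [IsIntegral Z] (σ : Z ⟶ X) (W : X.Opens)
    [IsIso (σ ∣_ W)] (hW : (W : Set X).Nonempty) {V : Z.Opens} (hV : (V : Set Z).Nonempty)
    {R : X.Opens} (hR : IsAffineOpen R) (hRne : (R : Set X).Nonempty) :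
    ∃ g : Γ(X, R), (X.basicOpen g : Set X).Nonempty ∧ X.basicOpen g ≤ W ∧
      σ ⁻¹ᵁ X.basicOpen g ≤ V := by
  let V' : (σ ⁻¹ᵁ W : Scheme).Opens := (σ ⁻¹ᵁ W).ι ⁻¹ᵁ V
  let W' : X.Opens := W.ι ''ᵁ (σ ∣_ W) ''ᵁ V'
  have hne : (W' : Set X).Nonempty := by
    obtain ⟨x, hx⟩ := hW
    obtain ⟨z, hz⟩ := (σ ∣_ W).homeomorph.surjective (⟨x, hx⟩ : W)
    obtain ⟨v, hv, hvW⟩ : ((V : Set Z) ∩ (σ ⁻¹ᵁ W : Z.Opens)).Nonempty :=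
      nonempty_preirreducible_inter V.isOpen (σ ⁻¹ᵁ W).isOpen hV ⟨z.1, z.2⟩
    let v' : (σ ⁻¹ᵁ W : Scheme) := (⟨v, hvW⟩ : σ ⁻¹ᵁ W)
    exact ⟨_, _, ⟨v', hv, rfl⟩, rfl⟩
  obtain ⟨x, hxR, hxW⟩ : ((R : Set X) ∩ W').Nonempty :=
    nonempty_preirreducible_inter R.isOpen W'.isOpen hRne hne
  obtain ⟨g, hg, hxg⟩ := hR.exists_basicOpen_le (V := W') ⟨x, hxW⟩ hxR
  have hW' : W' ≤ W := W.ι_image_le _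
  refine ⟨g, ⟨x, hxg⟩, hg.trans hW', fun z hz ↦ ?_⟩
  obtain ⟨_, ⟨v, hv, rfl⟩, hvz⟩ := hg hz
  let z' : (σ ⁻¹ᵁ W : Scheme) := (⟨z, hW' (hg hz)⟩ : σ ⁻¹ᵁ W)
  have h1 : W.ι ((σ ∣_ W) z') = σ z := by
    rw [← Scheme.Hom.comp_apply, morphismRestrict_ι, Scheme.Hom.comp_apply]
    rfl
  have h2 : v = z' := (σ ∣_ W).homeomorph.injective
    (W.ι.isOpenEmbedding.injective (hvz.trans h1.symm))
  rw [h2] at hv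
  exact hv

lemma appLE_comp_strHom {s : X ⟶ Spec (CommRingCat.of ℂ)} (σ : Z ⟶ X) {U : X.Opens} {V : Z.Opens}
    (e : V ≤ σ ⁻¹ᵁ U) : (σ.appLE U V e).hom.comp (strHom s U) = strHom (σ ≫ s) V := by
  rw [strHom_eq, strHom_eq, ← CommRingCat.hom_comp, Category.assoc]
  congr 2
  exact Scheme.Hom.appLE_comp_appLE σ s ⊤ U V le_top e

lemma smooth_strHom {s : X ⟶ Spec (CommRingCat.of ℂ)} [Smooth s] {U : X.Opens}
    (hU : IsAffineOpen U) : (strHom s U).Smooth := by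
  rw [strHom_eq, CommRingCat.hom_comp]
  exact RingHom.Smooth.respectsIso.2 _
    (Scheme.ΓSpecIso (CommRingCat.of ℂ)).symm.commRingCatIsoToRingEquiv
    (s.smooth_appLE (isAffineOpen_top _) hU le_top)

lemma map_pullSec {m : ℕ} {j : SpecAn m ⟶ X} [IsOpenImmersion j] (σ : Z ⟶ X) {V : Z.Opens}
    (e : V ≤ σ ⁻¹ᵁ j ''ᵁ ⊤) {D : X.Opens} (i : D ⟶ j ''ᵁ ⊤) (i' : σ ⁻¹ᵁ D ⟶ V) (r : AnR m) :
    (Z.presheaf.map i'.op).hom (pullSec j σ V e r) =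
      (σ.app D).hom ((X.presheaf.map i.op).hom (chartSec j r)) := by
  have h : σ.appLE _ V e ≫ Z.presheaf.map i'.op = X.presheaf.map i.op ≫ σ.app D := by
    rw [Scheme.Hom.appLE_map, Scheme.Hom.app_eq_appLE, Scheme.Hom.map_appLE]
  exact RingHom.congr_fun (congrArg CommRingCat.Hom.hom h) (chartSec j r)

/-- A smooth surface that is birational to `X` principalizes the ideal `(x, y)` of a chart. -/
theorem principalAlong_of_smooth {m : ℕ} {s : X ⟶ Spec (CommRingCat.of ℂ)} {j : SpecAn m ⟶ X}
    [IsIntegral X] [IsIntegral Z] [IsOpenImmersion j] (hj : j ≫ s = anStr m) {σ : Z ⟶ X}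
    [Smooth (σ ≫ s)] (W : X.Opens) (hW : (W : Set X).Nonempty) [IsIso (σ ∣_ W)] :
    PrincipalAlong j σ := by
  rw [principalAlong_iff]
  intro z hz
  have hzR : σ z ∈ j ''ᵁ ⊤ := mem_chart_iff.mpr hz
  obtain ⟨V, hV, hzV, e⟩ := exists_isAffineOpen_mem_and_subset (U := σ ⁻¹ᵁ j ''ᵁ ⊤) hzR
  haveI : Nonempty V := ⟨⟨z, hzV⟩⟩
  haveI : Nonempty (j ''ᵁ ⊤ : X.Opens) := ⟨⟨_, hzR⟩⟩
  replace e : V ≤ σ ⁻¹ᵁ j ''ᵁ ⊤ := e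
  obtain ⟨g, hgne, hgW, hgV⟩ := exists_basicOpen_of_birational σ W hW ⟨z, hzV⟩
    (isAffineOpen_chart (j := j)) ⟨_, hzR⟩
  haveI := isIso_morphismRestrict_of_le σ hgW
  haveI : IsIso (σ.app (X.basicOpen g)) := isIso_app_of_isIso_morphismRestrict _ _
  have hbij : Function.Bijective (σ.app (X.basicOpen g)).hom :=
    (asIso (σ.app (X.basicOpen g))).commRingCatIsoToRingEquiv.bijective
  let i : X.basicOpen g ⟶ j ''ᵁ ⊤ := homOfLE (X.basicOpen_le g)
  let i' : σ ⁻¹ᵁ X.basicOpen g ⟶ V := homOfLE hgV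
  haveI : Nonempty (X.basicOpen g) := hgne.to_subtype
  haveI : Nonempty (σ ⁻¹ᵁ X.basicOpen g : Z.Opens) := by
    obtain ⟨x, hx⟩ := hgne
    obtain ⟨y, hy⟩ := (σ ∣_ X.basicOpen g).homeomorph.surjective (⟨x, hx⟩ : X.basicOpen g)
    exact ⟨y⟩
  have hinj : Function.Injective (X.presheaf.map i.op).hom := map_injective_of_isIntegral X i
  have hinj' : Function.Injective (Z.presheaf.map i'.op).hom := map_injective_of_isIntegral Z i'
  letI : Algebra ℂ Γ(Z, V) := (strHom (σ ≫ s) V).toAlgebra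
  haveI : Algebra.Smooth ℂ Γ(Z, V) := smooth_strHom hV
  let φ : AnR m →ₐ[ℂ] Γ(Z, V) :=
    { pullSec j σ V e with
      commutes' := RingHom.congr_fun (show (pullSec j σ V e).comp (algebraMap ℂ (AnR m)) =
        strHom (σ ≫ s) V by
          rw [pullSec, RingHom.comp_assoc, chartSec_comp_algebraMap hj, appLE_comp_strHom]) }
  have hφ (r : AnR m) : φ r = pullSec j σ V e r := rfl
  have hφinj : Function.Injective φ := by
    intro r r' h
    rw [hφ, hφ] at h
    have h1 := congrArg (Z.presheaf.map i'.op).hom h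
    rw [map_pullSec σ e i i', map_pullSec σ e i i'] at h1
    exact (chartSec_bijective j).injective (hinj (hbij.injective h1))
  letI : Algebra Γ(X, j ''ᵁ ⊤) Γ(X, X.basicOpen g) := (X.presheaf.map i.op).hom.toAlgebra
  haveI : IsLocalization.Away g Γ(X, X.basicOpen g) :=
    isAffineOpen_chart.isLocalization_of_eq_basicOpen g i rfl
  have hg0 : g ≠ 0 := by
    rintro rfl
    rw [Scheme.basicOpen_zero] at hgne
    exact Set.not_nonempty_empty hgne
  have hgen (b : Γ(Z, V)) : ∃ r t, φ t ≠ 0 ∧ φ t * b = φ r := by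
    obtain ⟨a, ha⟩ := hbij.surjective ((Z.presheaf.map i'.op).hom b)
    obtain ⟨⟨c, d, hd⟩, hcd⟩ := IsLocalization.surj (Submonoid.powers g) a
    obtain ⟨r, rfl⟩ := (chartSec_bijective j).surjective c
    obtain ⟨t, rfl⟩ := (chartSec_bijective j).surjective d
    refine ⟨r, t, ?_, hinj' ?_⟩
    · rw [map_ne_zero_iff φ hφinj]
      rintro rfl
      rw [map_zero] at hd
      obtain ⟨k, hk⟩ := hd
      exact pow_ne_zero k hg0 hk
    · rw [map_mul, hφ, hφ, map_pullSec σ e i i', map_pullSec σ e i i', ← ha, ← map_mul, mul_comm]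
      exact congrArg _ hcd
  -- The prime ideal of the point `z`, which need not be closed.
  let p : Ideal Γ(Z, V) :=
    (IsLocalRing.maximalIdeal (Z.presheaf.stalk z)).comap (Z.presheaf.germ V z hzV).hom
  obtain ⟨f, hf, c, h⟩ := exists_mul_eq_of_smooth φ hφinj hgen p
  have hzf : z ∈ Z.basicOpen f := by
    rw [Scheme.mem_basicOpen _ _ z hzV]
    by_contra h
    exact hf h
  let k : Z.basicOpen f ⟶ V := homOfLE (Z.basicOpen_le f)
  have hu : IsUnit ((Z.presheaf.map k.op).hom f) :=
    RingedSpace.isUnit_res_basicOpen Z.toRingedSpace f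
  have key (a b c : Γ(Z, V)) (h : f * b = a * c) :
      (Z.presheaf.map k.op).hom a ∣ (Z.presheaf.map k.op).hom b := by
    rw [← hu.dvd_mul_left, ← map_mul, h, map_mul]
    exact dvd_mul_right _ _
  refine ⟨Z.basicOpen f, k.le.trans e, hzf, ?_⟩
  rw [← pullSec_res e k, ← pullSec_res e k]
  exact h.imp (key _ _ c) (key _ _ c)

end Birational

end DerBlowup

namespace DerBlowup

/-! ### One blow-up at the sheaf of derivations -/

section Step

variable {m : ℕ} {X Z : Scheme.{0}} {s : X ⟶ Spec (CommRingCat.of ℂ)} {j : SpecAn m ⟶ X}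
  {X₀ : X.Opens}

lemma exists_ne_origin (m : ℕ) : ∃ p : SpecAn m, p ≠ origin m :=
  ⟨(⟨⊥, Ideal.isPrime_bot⟩ : PrimeSpectrum (AnR m)),
    ne_origin_of_nonvanishingAt (m := m) (.inr (.inr (by
      change cz m ∉ (⊥ : Ideal _)
      simpa using cz_ne_zero m)))⟩

lemma IsAnChart.nonempty (h : IsAnChart m s j X₀) : (X₀ : Set X).Nonempty := by
  obtain ⟨p, hp⟩ := exists_ne_origin m
  exact ⟨_, (h.mem_iff p).mpr hp⟩

lemma IsAnChart.smooth_of_zero {j : SpecAn 0 ⟶ X} (h : IsAnChart 0 s j X₀) : Smooth s := by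
  haveI := h.isOpenImmersion
  haveI := h.smooth
  haveI : IsZariskiLocalAtSource @Smooth.{0} :=
    HasRingHomProperty.instIsZariskiLocalAtSource (Q := RingHom.Smooth)
  refine IsZariskiLocalAtSource.of_openCover (P := @Smooth.{0})
    (twoCover X₀.ι j fun x ↦ ?_) ?_
  · rcases h.cover x with hx | hx
    · exact .inl ⟨(⟨x, hx⟩ : X₀), rfl⟩
    · exact .inr hx
  · rintro (_ | _)
    · change Smooth (j ≫ s)
      rw [h.comp]
      infer_instance
    · change Smooth (X₀.ι ≫ s)
      infer_instance

lemma IsAnChart.not_smooth (h : IsAnChart m s j X₀) (hm : 1 ≤ m) : ¬ Smooth s := by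
  intro hs
  haveI := h.isOpenImmersion
  have h1 : Smooth (j ≫ s) := inferInstance
  rw [h.comp, HasRingHomProperty.Spec_iff (P := @Smooth), CommRingCat.hom_ofHom,
    RingHom.smooth_algebraMap] at h1
  exact not_smooth_anR hm h1

lemma derPullbackLocallyFree_of_smooth [IsIntegral X] [IsIntegral Z] [Smooth s] (σ : Z ⟶ X) :
    DerPullbackLocallyFree s σ := fun z ↦
  exists_derPullbackFree_of_smooth (X₀ := ⊤) (σ := σ) (z := z) trivial

/-- The pullback of the sheaf of derivations to a smooth surface birational to `X` is locally free
modulo torsion. -/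
theorem IsAnChart.derPullbackLocallyFree_of_birational [IsIntegral Z] (h : IsAnChart m s j X₀)
    {σ : Z ⟶ X} [Smooth (σ ≫ s)] (W : X.Opens) (hW : (W : Set X).Nonempty) [IsIso (σ ∣_ W)] :
    DerPullbackLocallyFree s σ := by
  haveI := h.integral
  haveI := h.isOpenImmersion
  obtain rfl | hm := Nat.eq_zero_or_pos m
  · haveI := h.smooth_of_zero
    exact derPullbackLocallyFree_of_smooth σ
  · obtain ⟨x, hxW, hx⟩ : ((W : Set X) ∩ X₀).Nonempty :=
      nonempty_preirreducible_inter W.isOpen X₀.isOpen hW h.nonempty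
    obtain ⟨z, hz⟩ := (σ ∣_ W).homeomorph.surjective (⟨x, hxW⟩ : W)
    have hz' : σ ((σ ⁻¹ᵁ W).ι z) = x := by
      rw [← Scheme.Hom.comp_apply, ← morphismRestrict_ι, Scheme.Hom.comp_apply]
      exact congrArg W.ι hz
    exact h.derPullbackLocallyFree hm ⟨_, hz'.symm ▸ hx⟩
      (principalAlong_of_smooth h.comp W hW) (principalAlong_of_smooth h.swap.comp W hW)

/-- The blow-up of `X` at its sheaf of derivations. -/
theorem IsAnChart.exists_isDerBlowup (h : IsAnChart m s j X₀) :
    ∃ (X' : Scheme.{0}) (g : X' ⟶ X) (j' : SpecAn (m - 2) ⟶ X') (X₀' : X'.Opens),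
      IsAnChart (m - 2) (g ≫ s) j' X₀' ∧ IsDerBlowup s g ∧ IsProper g ∧ IsIso (g ∣_ X₀) ∧
      g ⁻¹ᵁ X₀ ≤ X₀' := by
  obtain rfl | hm := Nat.eq_zero_or_pos m
  -- A smooth surface is its own blow-up, and `0 - 2 = 0` keeps the index.
  · haveI := h.integral
    haveI := h.smooth_of_zero
    exact ⟨X, 𝟙 X, j, X₀, by rwa [Category.id_comp],
      ⟨h.integral, derPullbackLocallyFree_of_smooth _, fun Z σ _ _ ↦
        ⟨σ, Category.comp_id σ, fun β hβ ↦ (Category.comp_id β).symm.trans hβ⟩⟩,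
      inferInstance, inferInstance, le_rfl⟩
  · obtain ⟨X', g, j', X₀', h', hg⟩ := h.exists_nashModification hm
    haveI := h'.integral
    refine ⟨X', g, j', X₀', h', ⟨h'.integral, ?_, fun Z σ hZ hσ ↦ ?_⟩, hg.isProper, hg.isIso, hg.le⟩
    · obtain ⟨x, hx⟩ := h.nonempty
      haveI := hg.isIso
      obtain ⟨z, hz⟩ := (g ∣_ X₀).homeomorph.surjective (⟨x, hx⟩ : X₀)
      exact h.derPullbackLocallyFree hm ⟨z.1, z.2⟩ hg.principalAlong hg.principalAlong_swap
    · obtain ⟨h1, h2, h3⟩ := h.principal_of_derPullbackLocallyFree hm hσ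
      exact hg.universal Z σ hZ h1 h2 h3

lemma IsAnChart.of_iso {X' : Scheme.{0}} (h : IsAnChart m s j X₀) (e : X' ≅ X) :
    IsAnChart m (e.hom ≫ s) (j ≫ e.inv) (e.hom ⁻¹ᵁ X₀) := by
  haveI := h.integral
  haveI := h.isOpenImmersion
  haveI := h.smooth
  have hinv (x) : e.hom (e.inv x) = x := by
    rw [← Scheme.Hom.comp_apply, e.inv_hom_id]; rfl
  have hinv' (x) : e.inv (e.hom x) = x := by
    rw [← Scheme.Hom.comp_apply, e.hom_inv_id]; rfl
  have hmem (p) : (j ≫ e.inv) p ∈ e.hom ⁻¹ᵁ X₀ ↔ j p ∈ X₀ := by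
    rw [Scheme.Hom.comp_apply]
    change e.hom (e.inv (j p)) ∈ X₀ ↔ _
    rw [hinv]
  refine ⟨?_, inferInstance, ?_, fun x ↦ ?_, fun p ↦ (hmem p).trans (h.mem_iff p), ?_⟩
  · obtain ⟨x⟩ : Nonempty X := inferInstance
    haveI : Nonempty X' := ⟨e.inv x⟩
    exact isIntegral_of_isOpenImmersion e.hom
  · rw [Category.assoc, Iso.inv_hom_id_assoc, h.comp]
  · refine (h.cover (e.hom x)).imp id ?_
    rintro ⟨p, hp⟩
    exact ⟨p, by rw [Scheme.Hom.comp_apply, hp, hinv']⟩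
  · rw [← morphismRestrict_ι_assoc]
    infer_instance

/-- Each blow-up satisfies the universal property of the other. This transports what is known of the
constructed model to an arbitrary blow-up. -/
lemma IsDerBlowup.exists_iso {X₁ X₂ : Scheme.{0}} {f₁ : X₁ ⟶ X} {f₂ : X₂ ⟶ X}
    (h₁ : IsDerBlowup s f₁) (h₂ : IsDerBlowup s f₂) : ∃ e : X₁ ≅ X₂, e.hom ≫ f₂ = f₁ := by
  obtain ⟨a, ha, -⟩ := h₂.universal _ f₁ h₁.integral h₁.locallyFree
  obtain ⟨b, hb, -⟩ := h₁.universal _ f₂ h₂.integral h₂.locallyFree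
  refine ⟨⟨a, b, ?_, ?_⟩, ha⟩
  · exact (h₁.universal _ f₁ h₁.integral h₁.locallyFree).unique
      (by rw [Category.assoc, hb, ha]) (Category.id_comp _)
  · exact (h₂.universal _ f₂ h₂.integral h₂.locallyFree).unique
      (by rw [Category.assoc, ha, hb]) (Category.id_comp _)

end Step

/-! ### The punctured surface `A_n` is smooth -/

section Base

variable (n : ℕ)

/-- The open subscheme of `A_n` on which `x` is invertible. -/
def invX : Spec (CommRingCat.of (Localization.Away (cx n))) ⟶ SpecAn n :=
  Spec.map (CommRingCat.ofHom (algebraMap (AnR n) (Localization.Away (cx n))))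

instance : IsOpenImmersion (invX n) :=
  IsOpenImmersion.of_isLocalization (cx n)

lemma mem_invX_iff (p : SpecAn n) : p ∈ (invX n).opensRange ↔ NonvanishingAt (cx n) p := by
  constructor
  · rintro ⟨u, rfl⟩
    exact nonvanishing_specMap_localization _ u
  · exact exists_nonvanishing_localization _ p

/-- The overlap of the two charts identifies this open set with an open subset of the plane `A_0`.
-/
lemma smooth_invX : Smooth (invX n ≫ anStr n) := by
  have h1 : ((overlapEquiv n).symm : Localization.Away (cz 0) →+* Localization.Away (cx n)).comp
      ((algebraMap (AnR 0) (Localization.Away (cz 0))).comp (algebraMap ℂ (AnR 0))) =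
      (algebraMap (AnR n) (Localization.Away (cx n))).comp (algebraMap ℂ (AnR n)) := by
    ext r
    have h2 : (overlapEquiv n).symm (algebraMap (AnR 0) (Localization.Away (cz 0))
        (algebraMap ℂ (AnR 0) r)) = overlapHom' n (algebraMap ℂ (AnR 0) r) :=
      IsLocalization.Away.lift_eq _ (isUnit_overlapHom'_cz n) _
    simp only [RingHom.comp_apply]
    refine h2.trans ?_
    rw [overlapHom', liftAn_algebraMap, ← IsScalarTower.algebraMap_apply]
  haveI : IsOpenImmersion (Spec.map (CommRingCat.ofHom (algebraMap (AnR 0)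
      (Localization.Away (cz 0))))) := IsOpenImmersion.of_isLocalization (cz 0)
  haveI : IsIso (Spec.map (CommRingCat.ofHom ((overlapEquiv n).symm :
      Localization.Away (cz 0) →+* Localization.Away (cx n)))) :=
    inferInstanceAs (IsIso (Spec.map (overlapEquiv n).symm.toCommRingCatIso.hom))
  have h3 : invX n ≫ anStr n = Spec.map (CommRingCat.ofHom ((overlapEquiv n).symm :
      Localization.Away (cz 0) →+* Localization.Away (cx n))) ≫
      Spec.map (CommRingCat.ofHom (algebraMap (AnR 0) (Localization.Away (cz 0)))) ≫ anStr 0 := by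
    rw [invX, ← Spec.map_comp, ← CommRingCat.ofHom_comp, ← h1, CommRingCat.ofHom_comp,
      CommRingCat.ofHom_comp, Spec.map_comp, Spec.map_comp]
  rw [h3]
  infer_instance

/-- The complement of the origin in `A_n`. -/
def punctured : (SpecAn n).Opens := (invX n).opensRange ⊔ (invX n ≫ swapMap n).opensRange

lemma mem_punctured_iff (p : SpecAn n) : p ∈ punctured n ↔ p ≠ origin n := by
  have h1 : p ∈ (invX n ≫ swapMap n).opensRange ↔ NonvanishingAt (cz n) p := by
    have h2 : NonvanishingAt (cz n) p ↔ NonvanishingAt (cx n) (swapMap n p) := by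
      refine Iff.trans ?_ (nonvanishingAt_specMap (swapHom n) (cx n) p).symm
      rw [swapHom, liftAn_cx]
    rw [h2, ← mem_invX_iff]
    constructor
    · rintro ⟨u, rfl⟩
      exact ⟨u, by rw [Scheme.Hom.comp_apply, swapMap_apply_apply]⟩
    · rintro ⟨u, hu⟩
      exact ⟨u, by rw [Scheme.Hom.comp_apply, hu, swapMap_apply_apply]⟩
  change p ∈ (invX n).opensRange ∨ p ∈ (invX n ≫ swapMap n).opensRange ↔ _
  rw [h1, mem_invX_iff]
  refine ⟨fun h ↦ ne_origin_of_nonvanishingAt (by tauto), fun h ↦ ?_⟩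
  rcases nonvanishingAt_of_ne_origin p h with h | h | h
  · exact .inl h
  · left
    -- Where `y` is nonzero so is `xz = y^(n+1)`, hence two open sets suffice.
    have h2 : NonvanishingAt (cx n * cz n) p := by
      rw [cx_mul_cz]
      exact fun h3 ↦ h ((show PrimeSpectrum (AnR n) from p).isPrime.mem_of_pow_mem _ h3)
    exact (nonvanishingAt_mul.mp h2).1
  · exact .inr h

/-- The surface `A_n` itself. -/
theorem isAnChart_id : IsAnChart n (anStr n) (𝟙 (SpecAn n)) (punctured n) := by
  refine ⟨inferInstance, inferInstance, Category.id_comp _, fun x ↦ .inr ⟨x, rfl⟩,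
    fun p ↦ mem_punctured_iff n p, ?_⟩
  refine smooth_sup_ι _ _ (smooth_invX n) ?_
  have h : swapMap n ≫ anStr n = anStr n := by
    rw [swapMap, ← Spec.map_comp, ← CommRingCat.ofHom_comp, swapHom, liftAn_comp_algebraMap]
  rw [Category.assoc, h]
  exact smooth_invX n

end Base

/-! ### Induction along the tower of blow-ups -/

section Iterate

variable {n : ℕ}

/-- The properties of the iterated blow-ups that are carried along the induction. -/
structure IsPartialResolution (n k : ℕ) {Y : Scheme.{0}} (π : Y ⟶ SpecAn n) : Prop where
  chart : ∃ (m : ℕ) (j : SpecAn m ⟶ Y) (Y₀ : Y.Opens), m = n - 2 * k ∧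
    IsAnChart m (π ≫ anStr n) j Y₀ ∧ π ⁻¹ᵁ punctured n ≤ Y₀
  isProper : IsProper π
  isIso : IsIso (π ∣_ punctured n)
  minimal : ∀ (Z : Scheme.{0}) (τ : Z ⟶ SpecAn n), IsResolution (anStr n) (origin n) τ →
    ∃! h : Z ⟶ Y, h ≫ π = τ

lemma origin_notMem_punctured : origin n ∉ punctured n := fun h ↦
  (mem_punctured_iff n (origin n)).mp h rfl

lemma le_punctured {U : (SpecAn n).Opens} (h : origin n ∉ U) : U ≤ punctured n := fun p hp ↦
  (mem_punctured_iff n p).mpr fun h' ↦ h (h' ▸ hp)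

lemma IsPartialResolution.of_isIso {Y : Scheme.{0}} (π : Y ⟶ SpecAn n) [IsIso π] :
    IsPartialResolution n 0 π :=
  ⟨⟨n, _, _, by simp, (isAnChart_id n).of_iso (asIso π), le_rfl⟩, inferInstance, inferInstance, fun _ τ _ ↦
    ⟨τ ≫ inv π, by simp, fun h hh ↦ by simp [← hh]⟩⟩

/-- A resolution already lifted to `Y` is smooth and an isomorphism over the punctured surface.
Hence it makes the derivations of `Y` locally free modulo torsion, and the universal property lifts
it once more. -/
lemma IsPartialResolution.comp {k : ℕ} {Y Y' : Scheme.{0}} {π : Y ⟶ SpecAn n} {f : Y' ⟶ Y}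
    (h : IsPartialResolution n k π) (hf : IsDerBlowup (π ≫ anStr n) f) :
    IsPartialResolution n (k + 1) (f ≫ π) := by
  obtain ⟨m, j, Y₀, hm, hj, hle⟩ := h.chart
  obtain ⟨X', g, j', X₀', hj', hg, hgp, hgi, hgle⟩ := hj.exists_isDerBlowup
  obtain ⟨e, rfl⟩ := hf.exists_iso hg
  haveI := h.isProper
  haveI := h.isIso
  haveI := hj.integral
  haveI : IsIso (g ∣_ (π ⁻¹ᵁ punctured n)) := isIso_morphismRestrict_of_le g hle
  refine ⟨⟨m - 2, j' ≫ e.inv, e.hom ⁻¹ᵁ X₀', by omega, ?_, fun x hx ↦ hgle (hle hx)⟩, inferInstance, ?_, ?_⟩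
  · have := hj'.of_iso e
    simpa only [Category.assoc] using this
  · rw [Category.assoc, morphismRestrict_comp, morphismRestrict_comp]
    haveI (U : X'.Opens) : IsIso (e.hom ∣_ U) := inferInstance
    exact IsIso.comp_isIso' (this _) (IsIso.comp_isIso' ‹_› ‹_›)
  · intro Z τ hτ
    obtain ⟨σ, rfl, hσ⟩ := h.minimal Z τ hτ
    haveI := hτ.integral
    haveI : Smooth (σ ≫ π ≫ anStr n) := by simpa only [Category.assoc] using hτ.smooth
    haveI : IsIso (σ ∣_ (π ⁻¹ᵁ punctured n)) := by
      have h1 := hτ.isIso_away (punctured n) origin_notMem_punctured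
      rw [morphismRestrict_comp] at h1
      have h2 : IsIso (π ∣_ punctured n) := h.isIso
      exact @IsIso.of_isIso_comp_right _ _ _ _ _ _ _ h2 h1
    have hne : ((π ⁻¹ᵁ punctured n : Y.Opens) : Set Y).Nonempty := by
      obtain ⟨p, hp⟩ := exists_ne_origin n
      obtain ⟨y, -⟩ := (π ∣_ punctured n).homeomorph.surjective
        (⟨p, (mem_punctured_iff n p).mpr hp⟩ : punctured n)
      exact ⟨y.1, y.2⟩
    obtain ⟨β, rfl, hβ⟩ := hf.universal Z σ hτ.integral
      (hj.derPullbackLocallyFree_of_birational _ hne)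
    exact ⟨β, by simp only [Category.assoc], fun β' hβ' ↦
      hβ β' (hσ _ (by simpa only [Category.assoc] using hβ'))⟩

lemma isPartialResolution : ∀ (k : ℕ) {Y : Scheme.{0}} (π : Y ⟶ SpecAn n),
    IsIteratedDerBlowup (anStr n) k π → IsPartialResolution n k π
  | 0, _, π, h => by
    haveI : IsIso π := h
    exact .of_isIso π
  | k + 1, _, _, ⟨_, _, _, hπ, hf, h⟩ => h ▸ (isPartialResolution k _ hπ).comp hf

lemma exists_isIteratedDerBlowup (n : ℕ) : ∀ k : ℕ, ∃ (Y : Scheme.{0}) (π : Y ⟶ SpecAn n),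
    IsIteratedDerBlowup (anStr n) k π
  | 0 => ⟨_, 𝟙 _, inferInstanceAs (IsIso (𝟙 _))⟩
  | k + 1 => by
    obtain ⟨Y, π, hπ⟩ := exists_isIteratedDerBlowup n k
    obtain ⟨_, j, Y₀, -, hj, -⟩ := (isPartialResolution k π hπ).chart
    obtain ⟨Y', f, -, -, -, hf, -⟩ := hj.exists_isDerBlowup
    exact ⟨Y', f ≫ π, Y, π, f, hπ, hf, rfl⟩

lemma IsPartialResolution.not_smooth {k : ℕ} {Y : Scheme.{0}} {π : Y ⟶ SpecAn n}
    (h : IsPartialResolution n k π) (hk : 1 ≤ n - 2 * k) : ¬ Smooth (π ≫ anStr n) := by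
  obtain ⟨m, j, Y₀, rfl, hj, -⟩ := h.chart
  exact hj.not_smooth hk

/-- In both parities the number is `n/2` rounded up, the first step at which the index reaches zero.
-/
lemma numSteps_spec (n : ℕ) : n - 2 * numSteps n = 0 ∧ ∀ k < numSteps n, 1 ≤ n - 2 * k := by
  rw [numSteps]
  split_ifs with h
  · rw [Nat.even_iff] at h
    exact ⟨by omega, fun k hk ↦ by omega⟩
  · rw [Nat.even_iff] at h
    exact ⟨by omega, fun k hk ↦ by omega⟩

lemma IsPartialResolution.isMinimalResolution {k : ℕ} {Y : Scheme.{0}} {π : Y ⟶ SpecAn n}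
    (h : IsPartialResolution n k π) (hk : n - 2 * k = 0) :
    IsMinimalResolution (anStr n) (origin n) π := by
  haveI := h.isIso
  obtain ⟨m, j, Y₀, hm, hj, -⟩ := h.chart
  obtain rfl : m = 0 := hm.trans hk
  have hs := hj.smooth_of_zero
  exact ⟨⟨hj.integral, hs, h.isProper, fun U hU ↦ isIso_morphismRestrict_of_le π (le_punctured hU)⟩,
    h.minimal⟩

end Iterate

end DerBlowup

end

theorem mainTheorem9 (n : ℕ) (hn : 1 ≤ n) :
    -- the iterated blow-ups exist
    (∀ k : ℕ, ∃ (Y : Scheme.{0}) (π : Y ⟶ DerBlowup.An n),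
      DerBlowup.IsIteratedDerBlowup (DerBlowup.AnStr n) k π) ∧
    -- fewer blow-ups do not suffice
    (∀ (k : ℕ) (Y : Scheme.{0}) (π : Y ⟶ DerBlowup.An n), k < DerBlowup.numSteps n →
      DerBlowup.IsIteratedDerBlowup (DerBlowup.AnStr n) k π →
      ¬ Smooth (π ≫ DerBlowup.AnStr n)) ∧
    -- this number of blow-ups produces a resolution, and in fact the minimal one
    (∀ (Y : Scheme.{0}) (π : Y ⟶ DerBlowup.An n),
      DerBlowup.IsIteratedDerBlowup (DerBlowup.AnStr n) (DerBlowup.numSteps n) π →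
      DerBlowup.IsMinimalResolution (DerBlowup.AnStr n) (DerBlowup.origin n) π) := by
  exact ⟨DerBlowup.exists_isIteratedDerBlowup n,
    fun k _ π hk hπ ↦ (DerBlowup.isPartialResolution k π hπ).not_smooth
      ((DerBlowup.numSteps_spec n).2 k hk),
    fun _ π hπ ↦ (DerBlowup.isPartialResolution _ π hπ).isMinimalResolution
      (DerBlowup.numSteps_spec n).1⟩
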